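/- Let $K$ be a field of characteristic zero (e.g. $K=\mathbb{C}$) and let $\hat\psi(\hbar^2,y)=\sum_{k\ge 1,m\ge 0}c_{k,m}y^k\hbar^{2m}$ and $\hat y(\hbar^2,z)=\sum_{k\ge 1,m\ge 0}s_{k,m}z^k\hbar^{2m}=\sum_{j\ge1}s_j z^j$, $s_j=s_j(\hbar^2)$, be arbitrary formal power series over $K$ with $\hat\psi(\hbar^2,0)=\hat y(\hbar^2,0)=0$. Put $\mathcal S(z)=(e^{z/2}-e^{-z/2})/z$. **The functions $W_n$.** Let $$Z=\sum_\lambda s_\lambda(p_1,p_2,\dots)\,s_\lambda\Big(\frac{s_1}{\hbar},\frac{s_2}{\hbar},\dots\Big)\exp\Big(\sum_{\square\in\lambda}\hat\psi(\hbar^2,\hbar\, c(\square))\Big),$$ where $s_\lambda$ are the Schur functions in power sums and $c(\square)$ is the content (column minus row). Let $X_i$ be formal variables, $D_i=X_i\partial_{X_i}$, and $$H_n=\sum_{k_1,\dots,k_n\ge1}\frac{\partial^n\log Z}{\partial p_{k_1}\cdots\partial p_{k_n}}\bigg|_{p=0}X_1^{k_1}\cdots X_n^{k_n},\qquad W_n=D_1\cdots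 D_nH_n+\delta_{n,2}\frac{X_1X_2}{(X_1-X_2)^2},$$ so that $W_n=\sum_{g\ge0}\hbar^{2g-2+n}W_{g,n}$ in terms of the genus expansion $\log Z=\sum_{g\ge 0}\hbar^{2g-2}F_g(\hbar p)$. The points $z_i$ correspond to $X_i$ by $X_i=X(z_i)$, $X(z)=z\,e^{-\hat\psi(0,\hat y(0,z))}$; all functions of the $z_i$ below are considered as formal series in the $X_i$. Write $[n]=\{1,\dots,n\}$. **First expression.** For $n\ge1$ and $J\subseteq[n]\setminus 1$ set $$T_{|J|+1}(z_1;z_J;u)=\sum_{k\ge1}\frac1{k!}\Big(\prod_{i=1}^k\big\rfloor_{z_{\bar i}=z_1}u\hbar\,\mathcal S(u\hbar D_{\bar i})\Big)W_{k+|J|}(z_{\bar1},\dots,z_{\bar k},z_J),$$ where the singular summand of $W_2$ is dropped if both of its arguments are to be restricted to $z_1$ (that is, for $k=2$, $J=\emptyset$), and $X_1X_j/(X_1-X_j)^2$ for $j\ne1$ is expanded as $\sum_{m\ge1}mX_1^mX_j^{-m}$. Set $$\mathcal T_n(z_1;z_{[n]\setminus1};u)=\frac{\mathcal S(u\hbar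 D_1)}{\hbar\,\mathcal S(u\hbar)}\sum_{l\ge1}\frac1{l!}\sum_{J_1\sqcup\dots\sqcup J_l=[n]\setminus 1}\ \prod_{i=1}^lT_{|J_i|+1}(z_1;z_{J_i};u),$$ the sum being over ordered partitions into possibly empty sets. The first definition is $\mathcal W^{(r)}_{g,n}=r!\,[\hbar^{2g-2+n}u^r]\,\mathcal T_n$. **Second expression.** On the (completed) semi-infinite wedge space let $\hat E_{i,j}={:}\psi_i\psi_j^*{:}$, $i,j\in\mathbb Z+\frac12$, be the normally ordered operators, $J_m=\sum_k\hat E_{k-m,k}$, $J(X)=\sum_{m\in\mathbb Z}X^mJ_m$, $\mathcal E_0(v)=\sum_ke^{vk}\hat E_{k,k}$, and $\mathcal D(\hbar)=\exp\big(\sum_kw(\hbar k)\hat E_{k,k}\big)$, where $w(y+\hbar/2)-w(y-\hbar/2)=\hat\psi(\hbar^2,y)$. Put $G=\mathcal D(\hbar)\exp\big(\sum_{j\ge1}\frac{s_jJ_{-j}}{j\hbar}\big)$, $$\mathcal A_1=G^{-1}\Big(\sum_{m\ne0}\frac{X_1^mJ_m}{m\hbar}\Big)\mathcal E_0(\hbar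 u)\,G,\qquad \mathcal A_k=G^{-1}J(X_k)G\quad(k\ge2),$$ and let $\langle\cdot\rangle$ be the vacuum expectation value. Let $$\mathcal W_n(z_1;z_{[n]\setminus1};u)=\langle\mathcal A_1\cdots\mathcal A_n\rangle^\circ=\sum_{l=1}^n\frac1{l!}\sum_{\substack{I_1\sqcup\dots\sqcup I_l=[n]\\ I_j\ne\emptyset}}(-1)^{l-1}(l-1)!\prod_{i=1}^l\langle\mathcal A_{I_i}\rangle,$$ where $\mathcal A_I=\mathcal A_{i_1}\cdots\mathcal A_{i_p}$ for $I=\{i_1<\dots<i_p\}$. The second definition is $\mathcal W^{(r)}_{g,n}=r!\,[u^r]\,\mathcal W_{g,n}$ with $\mathcal W_{g,n}=[\hbar^{2g-2+n}]\mathcal W_n$. **Theorem.** For all $n\ge1$, as formal series in $X_1,\dots,X_n$ with coefficients in $K((\hbar))[[u]]$, $$\mathcal W_n(z_1;z_{[n]\setminus1};u)=\mathcal T_n(z_1;z_{[n]\setminus1};u).$$ Consequently the two definitions of $\mathcal W^{(r)}_{g,n}$ agree for all $r,g\ge0$, $n\ge1$. -/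

import Mathlib

/-! Scalars.  `K` is a field of characteristic zero, `LaurentSeries K = K((ħ))`, and all
correlators take values in `K((ħ))⟦u⟧`. -/

namespace HypKP

noncomputable section

/-- The ring of scalars `K((ħ))⟦u⟧`. -/
abbrev Scal (K : Type*) [Field K] : Type _ := PowerSeries (LaurentSeries K)

/-- The formal parameter `ħ` in `K((ħ))`. -/
def hbar (K : Type*) [Field K] : LaurentSeries K := HahnSeries.single 1 1

/-- The inclusion `K⟦ħ⟧ → K((ħ))`. -/
def toL {K : Type*} [Field K] (x : PowerSeries K) : LaurentSeries K :=
  HahnSeries.ofPowerSeries ℤ K x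

/-- The exponential `∑ₚ xᵖ / p!` of a power series `x` with zero constant term
(terms with `p > N` do not contribute to the coefficient of degree `N`). -/
def fexp (K : Type*) [Field K] {A : Type*} [CommRing A] [Algebra K A] (x : PowerSeries A) :
    PowerSeries A :=
  PowerSeries.mk fun N =>
    ∑ p ∈ Finset.range (N + 1), ((p.factorial : K)⁻¹) • PowerSeries.coeff N (x ^ p)

/-- `𝒮(z) = (e^{z/2} - e^{-z/2}) / z` as a power series in `z`, see `X_mul_sSeries`. -/
def sSeries (K : Type*) [Field K] : PowerSeries K :=
  PowerSeries.mk fun n => if Even n then ((2 : K) ^ n * ((n + 1).factorial : K))⁻¹ else 0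

theorem X_mul_sSeries (K : Type*) [Field K] [CharZero K] :
    PowerSeries.X * sSeries K =
      PowerSeries.mk (fun n => ((1 : K) / 2) ^ n / (n.factorial : K)) -
        PowerSeries.mk (fun n => (-(1 : K) / 2) ^ n / (n.factorial : K)) := by
  ext n
  cases n with
  | zero => simp
  | succ n =>
    rw [PowerSeries.coeff_succ_X_mul]
    simp only [sSeries, PowerSeries.coeff_mk, map_sub]
    have h : ((n + 1).factorial : K) ≠ 0 := Nat.cast_ne_zero.2 (Nat.factorial_ne_zero _)
    have h1 : (-(1 : K) / 2) ^ (n + 1) = (-1) ^ (n + 1) * ((1 : K) / 2) ^ (n + 1) := by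
      rw [← mul_pow]; congr 1; ring
    rw [h1]
    split_ifs with he
    · rw [Odd.neg_one_pow he.add_one]
      have h2 : ((1 : K) / 2) ^ n * 2 ^ n = 1 := by rw [← mul_pow]; norm_num
      field_simp
      rw [mul_comm] at h2
      linear_combination -h2
    · rw [Even.neg_one_pow (Nat.not_even_iff_odd.1 he).add_one]
      ring

/-- `𝒮(a u ħ)` as an element of `K((ħ))⟦u⟧`; this is also the eigenvalue of `𝒮(u ħ D)`,
`D = X ∂_X`, on `X ^ a`. -/
def sAt {K : Type*} [Field K] (a : K) : Scal K :=
  PowerSeries.mk fun n => (PowerSeries.coeff n (sSeries K) * a ^ n) • hbar K ^ n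

/-- `e^{a u ħ}` as an element of `K((ħ))⟦u⟧`. -/
def expAt {K : Type*} [Field K] (a : K) : Scal K :=
  PowerSeries.mk fun n => (a ^ n / (n.factorial : K)) • hbar K ^ n

/-- `u ħ`. -/
def uh (K : Type*) [Field K] : Scal K := PowerSeries.C (hbar K) * PowerSeries.X

/-! The initial data.  `ψ̂(ħ², y) = ∑ c_{k,m} y^k ħ^{2m}` and `ŷ(ħ², z) = ∑ s_{k,m} z^k ħ^{2m}`
are elements of `K⟦t⟧⟦y⟧`, `K⟦t⟧⟦z⟧` with `t = ħ²`: `c_{k,m} = coeff m (coeff k ψ)`. -/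

/-- `ψ̂(ħ², ħ a) = ∑ c_{k,m} a^k ħ^{k+2m}` in `K⟦ħ⟧`. -/
def psiAt {K : Type*} [Field K] (ψ : PowerSeries (PowerSeries K)) (a : K) : PowerSeries K :=
  PowerSeries.mk fun N => ∑ q ∈ Finset.HasAntidiagonal.antidiagonal N,
    if Even q.2 then PowerSeries.coeff (q.2 / 2) (PowerSeries.coeff q.1 ψ) * a ^ q.1 else 0

/-- The value `w(ħ x)` in `K⟦ħ⟧` of the series `w` with
`w(y + ħ/2) - w(y - ħ/2) = ψ̂(ħ², y)` (see `wAt_sub`), namely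
`w(y) = ∑ c_{k,m} ħ^{2m} ħ^k B_{k+1}(y/ħ + 1/2) / (k+1)` with the Bernoulli polynomials `B`. -/
def wAt {K : Type*} [Field K] [CharZero K] (ψ : PowerSeries (PowerSeries K)) (x : K) :
    PowerSeries K :=
  PowerSeries.mk fun N => ∑ q ∈ Finset.HasAntidiagonal.antidiagonal N,
    if Even q.2 then PowerSeries.coeff (q.2 / 2) (PowerSeries.coeff q.1 ψ) *
      (Polynomial.aeval (x + 1 / 2) (Polynomial.bernoulli (q.1 + 1)) / ((q.1 + 1 : ℕ) : K))
    else 0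

theorem wAt_sub {K : Type*} [Field K] [CharZero K] (ψ : PowerSeries (PowerSeries K)) (x : K) :
    wAt ψ (x + 1 / 2) - wAt ψ (x - 1 / 2) = psiAt ψ x := by
  have key : ∀ k : ℕ, Polynomial.aeval (1 + x) (Polynomial.bernoulli (k + 1)) =
      Polynomial.aeval x (Polynomial.bernoulli (k + 1)) + ((k + 1 : ℕ) : K) * x ^ k := by
    intro k
    have h := congrArg (Polynomial.aeval x) (Polynomial.bernoulli_comp_one_add_X (k + 1))
    simpa [Polynomial.aeval_comp] using h
  ext N
  simp only [wAt, psiAt, map_sub, PowerSeries.coeff_mk, ← Finset.sum_sub_distrib]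
  refine Finset.sum_congr rfl fun q _ => ?_
  split_ifs with he
  · have hne : ((q.1 + 1 : ℕ) : K) ≠ 0 := Nat.cast_ne_zero.2 (Nat.succ_ne_zero _)
    have e1 : x + 1 / 2 + 1 / 2 = 1 + x := by ring
    have e2 : x - 1 / 2 + 1 / 2 = x := by ring
    rw [e1, e2, key, ← mul_sub, ← sub_div, add_sub_cancel_left, mul_div_cancel_left₀ _ hne]
  · simp

/-- `ŷ_j(ħ²) / ħ = s_j / ħ` in `K((ħ))`, where `ŷ(ħ², z) = ∑ ŷ_j(ħ²) z^j`. -/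
def yOverH {K : Type*} [Field K] (y : PowerSeries (PowerSeries K)) (j : ℕ) : LaurentSeries K :=
  (hbar K)⁻¹ * toL (PowerSeries.mk fun N =>
    if Even N then PowerSeries.coeff (N / 2) (PowerSeries.coeff j y) else 0)

/-! The partition function `Z` and the functions `W_n`. -/

/-- The complete homogeneous function `h_n` in the power sums `p_k`, `k ≥ 1`:
`∑ h_n t^n = exp(∑_{k ≥ 1} p_k t^k / k)`; `h_n = 0` for `n < 0`. -/
def hSym (K : Type*) [Field K] {A : Type*} [CommRing A] [Algebra K A] (p : ℕ → A) (n : ℤ) : A :=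
  if 0 ≤ n then
    PowerSeries.coeff n.toNat
      (fexp K (PowerSeries.mk fun k => if k = 0 then 0 else ((k : K)⁻¹) • p k))
  else 0

/-- The Schur function `s_λ` in the power sums (Jacobi-Trudi determinant). -/
def schur (K : Type*) [Field K] {A : Type*} [CommRing A] [Algebra K A] (p : ℕ → A)
    (μ : YoungDiagram) : A :=
  Matrix.det (Matrix.of fun i j : Fin (μ.colLen 0) =>
    hSym K p ((μ.rowLen i : ℤ) - (i : ℤ) + (j : ℤ)))

/-- The partition function
`Z = ∑_λ s_λ(p) s_λ(ŷ/ħ) exp(∑_{boxes} ψ̂(ħ², ħ · (column - row)))`, a power series in the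
variables `p_k` (variable number `k`, `k ≥ 1`) over `K((ħ))`.  Since `s_λ` is homogeneous of
weighted degree `|λ|`, only finitely many `λ` contribute to each coefficient. -/
def partitionFunction {K : Type*} [Field K] (ψ y : PowerSeries (PowerSeries K)) :
    MvPowerSeries ℕ (LaurentSeries K) := fun d =>
  ∑ᶠ μ : YoungDiagram,
    MvPolynomial.coeff d
        (schur K (fun k => (MvPolynomial.X k : MvPolynomial ℕ (LaurentSeries K))) μ) *
      schur K (yOverH y) μ *
      toL (fexp K (∑ b ∈ μ.cells, psiAt ψ ((b.2 : K) - (b.1 : K))))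

/-- `log Z = ∑_{q ≥ 1} (-1)^{q+1} (Z - 1)^q / q`, for `Z` with constant term `1`
(terms with `q > |d|` do not contribute to the coefficient of a monomial of degree `|d|`).
Thus `log Z = ∑_g ħ^{2g-2} F_g(ħ p)`. -/
def logZ {K : Type*} [Field K] (ψ y : PowerSeries (PowerSeries K)) :
    MvPowerSeries ℕ (LaurentSeries K) := fun d =>
  ∑ q ∈ Finset.Icc 1 d.degree,
    ((-1 : K) ^ (q + 1) / (q : K)) • MvPowerSeries.coeff d ((partitionFunction ψ y - 1) ^ q)

/-- The coefficient of `∏ X_i ^ {m_i}`, `i ∈ ι`, in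
`D_1 ⋯ D_n H_n`, `H_n = ∑_g ħ^{2g-2+n} H_{g,n} =
∑_{k_1,…,k_n ≥ 1} (∂^n log Z / ∂p_{k_1} ⋯ ∂p_{k_n})|_{p = 0} ∏ X_i ^ {k_i}`, where `n = |ι|`. -/
def regW {K : Type*} [Field K] (ψ y : PowerSeries (PowerSeries K)) {ι : Type*} [Fintype ι]
    (m : ι → ℤ) : LaurentSeries K :=
  if ∀ i, 0 < m i then
    let d : ℕ →₀ ℕ := ∑ i, Finsupp.single (m i).toNat 1
    ((∏ i, (m i : K)) * (d.prod fun _ e => (e.factorial : K))) • MvPowerSeries.coeff d (logZ ψ y)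
  else 0

/-- The coefficient of `X_1 ^ a X_2 ^ b` in the expansion of `X_1 X_2 / (X_1 - X_2)^2` in the
sector `|X_1| < |X_2|`, i.e. in `∑_{m ≥ 1} m X_1^m X_2^{-m}`. -/
def sing {K : Type*} [Field K] (a b : ℤ) : LaurentSeries K :=
  if 0 < a ∧ b = -a then ((a : K)) • (1 : LaurentSeries K) else 0

/-- The coefficient of `∏_{i} X_{ī} ^ {a_i} ∏_{j ∈ J} X_j ^ {m_j}` in
`W_{k+|J|}(z_{1̄}, …, z_{k̄}, z_J)`, prepared for the restriction `z_{1̄} = ⋯ = z_{k̄} = z_1`: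
for `k = |J| = 1` this is `D_1 D_2 H_2 + X_1 X_2 / (X_1 - X_2)^2`, while for `k = 2`, `J = ∅`,
when both arguments of `W_{0,2}` become `z_1`, the singular term is dropped. -/
def coeffW {K : Type*} [Field K] (ψ y : PowerSeries (PowerSeries K)) {n k : ℕ}
    (J : Finset (Fin n)) (a : Fin k → ℤ) (m : Fin n → ℤ) : LaurentSeries K :=
  regW ψ y (Sum.elim a (fun j : J => m j)) +
    if k = 1 ∧ J.card = 1 then ∑ i, ∑ j ∈ J, sing (a i) (m j) else 0

/-- The coefficient of `∏_{j ∈ J} X_j ^ {m_j}` in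
`T_{|J|+1}(z_1; z_J; u) = ∑_{k ≥ 1} 1/k! (∏_i |_{z_ī = z_1} u ħ 𝒮(u ħ D_ī)) W_{k+|J|}(z_{1̄…k̄}, z_J)`
as a power series in `X_1`.  As `W_{k+|J|}` contains only positive powers of the `X_ī`, the
terms with `k > N` do not contribute to the coefficient of `X_1 ^ N`. -/
def seriesT {K : Type*} [Field K] (ψ y : PowerSeries (PowerSeries K)) {n : ℕ}
    (J : Finset (Fin n)) (m : Fin n → ℤ) : PowerSeries (Scal K) :=
  PowerSeries.mk fun N => ∑ k ∈ Finset.Icc 1 N, ((k.factorial : K)⁻¹) •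
    ∑ a ∈ Finset.Nat.antidiagonalTuple k N,
      (∏ i, uh K * sAt ((a i : ℕ) : K)) *
        PowerSeries.C (coeffW ψ y J (fun i => (a i : ℤ)) m)

/-- The coefficient of `X_1 ^ {m_1} ∏_j X_j ^ {m_j}` in
`𝒯_{n+1}(z_1; z_2, …, z_{n+1}; u) = 𝒮(u ħ D_1) / (ħ 𝒮(u ħ)) ∑_{l ≥ 1} 1/l!
∑_{J_1 ⊔ ⋯ ⊔ J_l} ∏_i T_{|J_i|+1}(z_1; z_{J_i}; u)`, the inner sum being over ordered partitions
of the set of the `n` variables `z_2, …, z_{n+1}` into `l` possibly empty sets, i.e. over maps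
`f` to `{1, …, l}`.  Every `T` is divisible by `X_1`, so `l ≤ m_1`. -/
def calT {K : Type*} [Field K] (ψ y : PowerSeries (PowerSeries K)) (n : ℕ)
    (m₁ : ℤ) (m : Fin n → ℤ) : Scal K :=
  if 0 < m₁ then
    sAt (m₁ : K) * PowerSeries.C (hbar K)⁻¹ * (sAt (1 : K))⁻¹ *
      ∑ l ∈ Finset.Icc 1 m₁.toNat, ((l.factorial : K)⁻¹) •
        ∑ f : Fin n → Fin l,
          PowerSeries.coeff m₁.toNat
            (∏ i : Fin l, seriesT ψ y (Finset.univ.filter fun j => f j = i) m)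
  else 0

/-! The semi-infinite wedge space.  The integer `k` stands for the half-integer `k + 1/2`. -/

/-- A basis vector of the semi-infinite wedge space: a set of half-integers (`k ∈ ℤ` stands for
`k + 1/2`) with finitely many positive elements and finitely many missing negative ones. -/
structure Maya where
  set : Set ℤ
  finite_pos : (set ∩ Set.Ici 0).Finite
  finite_neg : (Set.Iio 0 \ set).Finite

/-- The vacuum. -/
def Maya.vac : Maya where
  set := Set.Iio 0
  finite_pos := by
    have : Set.Iio (0 : ℤ) ∩ Set.Ici 0 = ∅ := by ext x; simp
    rw [this]; exact Set.finite_empty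
  finite_neg := by simp

/-- Replace `i` by `j`. -/
def Maya.move (S : Maya) (i j : ℤ) : Maya where
  set := insert j (S.set \ {i})
  finite_pos := (S.finite_pos.insert j).subset (by
    rintro x ⟨hx, h0⟩
    rcases hx with rfl | ⟨hx, -⟩
    · exact Set.mem_insert _ _
    · exact Set.mem_insert_of_mem _ ⟨hx, h0⟩)
  finite_neg := (S.finite_neg.insert i).subset (by
    rintro x ⟨h0, hx⟩
    by_cases hxi : x = i
    · exact hxi ▸ Set.mem_insert _ _
    · exact Set.mem_insert_of_mem _ ⟨h0, fun h => hx (Set.mem_insert_of_mem _ ⟨h, hxi⟩)⟩)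

/-- The completed Fock space: arbitrary formal linear combinations `∑_S f(S) v_S`. -/
abbrev Fock (R : Type*) : Type _ := Maya → R

open Classical in
/-- The vacuum vector. -/
def vacVec (R : Type*) [CommRing R] : Fock R := fun S => if S = Maya.vac then 1 else 0

open Classical in
/-- The eigenvalue on `v_S` of the normally ordered `Ê_{k,k} = :ψ_k ψ_k^*:`. -/
def occ (k : ℤ) (S : Maya) : ℤ :=
  (if k ∈ S.set then 1 else 0) - (if k < 0 then 1 else 0)

open Classical in
/-- The operator `Ê_{i,j} = :ψ_i ψ_j^*:`.  For `i ≠ j` it replaces the factor `j` of a semi-infinite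
wedge by `i`; put back in decreasing order this gives a sign.  Here it is
written by its coefficient at `v_S`. -/
def Ehat {R : Type*} [CommRing R] (i j : ℤ) (f : Fock R) : Fock R := fun S =>
  if i = j then (occ i S : R) * f S
  else if i ∈ S.set ∧ j ∉ S.set then
    (-1) ^ (S.set ∩ Set.Ioo (min i j) (max i j)).ncard * f (S.move i j)
  else 0

/-- `∑_k c_k Ê_{k-m,k}`; at each `S` the sum is finite, see `finite_support_band`. -/
def band {R : Type*} [CommRing R] (m : ℤ) (c : ℤ → R) (f : Fock R) : Fock R := fun S =>
  ∑ᶠ k : ℤ, c k * Ehat (k - m) k f S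

theorem finite_support_band {R : Type*} [CommRing R] (m : ℤ) (c : ℤ → R) (f : Fock R)
    (S : Maya) : (Function.support fun k : ℤ => c k * Ehat (k - m) k f S).Finite := by
  have hfin : (((fun k : ℤ => k - m) ⁻¹' (S.set ∩ Set.Ici 0)) ∪
      ((S.set ∩ Set.Ici 0) ∪ ((Set.Iio 0 \ S.set) ∪ Set.Ico 0 m))).Finite :=
    (S.finite_pos.preimage (fun a _ b _ h => by simpa using h)).union
      (S.finite_pos.union (S.finite_neg.union (Set.finite_Ico 0 m)))
  refine hfin.subset fun k hk => ?_
  by_contra hn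
  simp only [Set.mem_union, Set.mem_preimage, Set.mem_inter_iff, Set.mem_Ici, Set.mem_sdiff,
    Set.mem_Iio, Set.mem_Ico, not_or, not_and, not_lt, not_le] at hn
  obtain ⟨h1, h2, h3, h4⟩ := hn
  apply hk
  by_cases hm : m = 0
  · subst hm
    have : occ k S = 0 := by
      unfold occ
      by_cases h : k ∈ S.set
      · simp [h, h2 h]
      · have : ¬ k < 0 := fun h0 => h (not_not.1 (h3 h0))
        simp [h, this]
    simp [Ehat, this]
  · have hne : k - m ≠ k := by omega
    have : ¬ (k - m ∈ S.set ∧ k ∉ S.set) := by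
      rintro ⟨ha, hb⟩
      have hk0 : 0 ≤ k := by by_contra h0; exact h3 (by omega) hb
      have := h4 hk0
      have := h1 ha
      omega
    simp [Ehat, hne, this]

/-- `J_m = ∑_k Ê_{k-m,k}`. -/
def Jop {R : Type*} [CommRing R] (m : ℤ) : Fock R → Fock R := band m fun _ => 1

/-- `ℰ_0(ħ u) = ∑_k e^{ħ u k} Ê_{k,k}`. -/
def E0 (K : Type*) [Field K] : Fock (Scal K) → Fock (Scal K) :=
  band 0 fun k => expAt ((k : K) + 1 / 2)

/-- The eigenvalue `∑_k w(ħ k) · occ_k(S)` on `v_S` of `∑_k w(ħ k) Ê_{k,k}`. -/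
def wEig {K : Type*} [Field K] [CharZero K] (ψ : PowerSeries (PowerSeries K)) (S : Maya) :
    PowerSeries K :=
  ∑ᶠ k : ℤ, (occ k S : PowerSeries K) * wAt ψ ((k : K) + 1 / 2)

/-- `𝒟(ħ) = exp(∑_k w(ħ k) Ê_{k,k})`. -/
def Dop {K : Type*} [Field K] [CharZero K] (ψ : PowerSeries (PowerSeries K))
    (f : Fock (Scal K)) : Fock (Scal K) := fun S =>
  PowerSeries.C (toL (fexp K (wEig ψ S))) * f S

/-- `𝒟(ħ)⁻¹`. -/
def DopInv {K : Type*} [Field K] [CharZero K] (ψ : PowerSeries (PowerSeries K))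
    (f : Fock (Scal K)) : Fock (Scal K) := fun S =>
  PowerSeries.C (toL (fexp K (-wEig ψ S))) * f S

/-- `∑_{j ≥ 1} s_j J_{-j} / (j ħ)`; at each `S` only finitely many `j` contribute, as a Maya
diagram admits only finitely many moves of an element down to an empty place. -/
def creation {K : Type*} [Field K] (y : PowerSeries (PowerSeries K))
    (f : Fock (Scal K)) : Fock (Scal K) := fun S =>
  ∑ᶠ j : ℕ, if j = 0 then 0 else
    ((j : K)⁻¹) • (PowerSeries.C (yOverH y j) * Jop (-(j : ℤ)) f S)

/-- The exponential `∑_p A^p / p!` of an operator such that, at each `S`, `A^p` vanishes for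
large `p`. -/
def expOp {K : Type*} [Field K] (A : Fock (Scal K) → Fock (Scal K))
    (f : Fock (Scal K)) : Fock (Scal K) := fun S =>
  ∑ᶠ p : ℕ, ((p.factorial : K)⁻¹) • (A^[p]) f S

/-- `G = 𝒟(ħ) exp(∑_{j ≥ 1} s_j J_{-j} / (j ħ))`. -/
def Gop {K : Type*} [Field K] [CharZero K] (ψ y : PowerSeries (PowerSeries K)) :
    Fock (Scal K) → Fock (Scal K) :=
  Dop ψ ∘ expOp (creation y)

/-- `G⁻¹ = exp(-∑_{j ≥ 1} s_j J_{-j} / (j ħ)) 𝒟(ħ)⁻¹`. -/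
def GopInv {K : Type*} [Field K] [CharZero K] (ψ y : PowerSeries (PowerSeries K)) :
    Fock (Scal K) → Fock (Scal K) :=
  expOp (fun f => -creation y f) ∘ DopInv ψ

/-- The vacuum expectation value of an operator. -/
def vev {R : Type*} [CommRing R] (A : Fock R → Fock R) : R := A (vacVec R) Maya.vac

/-- The coefficient of `X_1 ^ m` in `(∑_{m ≠ 0} X_1^m J_m / (m ħ)) ℰ_0(ħ u)`. -/
def insertion (K : Type*) [Field K] (m : ℤ) (f : Fock (Scal K)) : Fock (Scal K) := fun S =>
  if m = 0 then 0 else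
    ((m : K)⁻¹) • (PowerSeries.C (hbar K)⁻¹ * Jop m (E0 K f) S)

/-- The coefficient of `X_{i+1} ^ {m_i}` in the operator `𝒜_{i+1}`, `i = 0, …, n`:
`𝒜_1 = G⁻¹ (∑ X_1^m J_m / (m ħ)) ℰ_0(ħ u) G` and `𝒜_k = G⁻¹ J(X_k) G` for `k ≥ 2`, where
`J(X) = ∑_m X^m J_m`. -/
def opA {K : Type*} [Field K] [CharZero K] (ψ y : PowerSeries (PowerSeries K)) {n : ℕ}
    (m : Fin (n + 1) → ℤ) (i : Fin (n + 1)) : Fock (Scal K) → Fock (Scal K) :=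
  GopInv ψ y ∘ (if i = 0 then insertion K (m i) else Jop (m i)) ∘ Gop ψ y

/-- `⟨𝒜_I⟩ = ⟨𝒜_{i_1} ⋯ 𝒜_{i_p}⟩` for `I = {i_1 < ⋯ < i_p}` (its coefficient of
`∏_{i ∈ I} X_i ^ {m_i}`). -/
def corr {K : Type*} [Field K] [CharZero K] (ψ y : PowerSeries (PowerSeries K)) {n : ℕ}
    (m : Fin (n + 1) → ℤ) (I : Finset (Fin (n + 1))) : Scal K :=
  vev (((I.sort (· ≤ ·)).map (opA ψ y m)).foldr (fun A B => A ∘ B) id)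

/-- The coefficient of `X_1 ^ {m_1} ∏_j X_j ^ {m_j}` in the connected function
`𝒲_{n+1}(z_1; z_2, …, z_{n+1}; u) = ⟨𝒜_1 ⋯ 𝒜_{n+1}⟩°`, given by the inclusion-exclusion formula
`∑_l 1/l! ∑_{I_1 ⊔ ⋯ ⊔ I_l} (-1)^{l-1} (l-1)! ∏_i ⟨𝒜_{I_i}⟩`, the inner sum being over
ordered partitions of the index set into non-empty sets, i.e. over surjections to `{1, …, l}`. -/
def calW {K : Type*} [Field K] [CharZero K] (ψ y : PowerSeries (PowerSeries K)) (n : ℕ)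
    (m₁ : ℤ) (m : Fin n → ℤ) : Scal K :=
  ∑ l ∈ Finset.Icc 1 (n + 1), ((l.factorial : K)⁻¹) •
    ∑ f : {f : Fin (n + 1) → Fin l // Function.Surjective f},
      ((-1 : K) ^ (l - 1) * ((l - 1).factorial : K)) •
        ∏ i : Fin l, corr ψ y (Fin.cons m₁ m) (Finset.univ.filter fun j => f.1 j = i)

/-- `[ħ^e u^r]`. -/
def coeffHU {K : Type*} [Field K] (e : ℤ) (r : ℕ) (x : Scal K) : K :=
  (PowerSeries.coeff r x).coeff e

/-- The coefficients in `X_1, …, X_{n+1}` of `𝒲^{(r)}_{g,n+1} = r! [ħ^{2g-2+(n+1)} u^r] 𝒯_{n+1}`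
(first definition). -/
def calWrFirst {K : Type*} [Field K] (ψ y : PowerSeries (PowerSeries K)) (r g n : ℕ)
    (m₁ : ℤ) (m : Fin n → ℤ) : K :=
  (r.factorial : K) * coeffHU (2 * g - 2 + (n + 1)) r (calT ψ y n m₁ m)

/-- The coefficients in `X_1, …, X_{n+1}` of `𝒲^{(r)}_{g,n+1} = r! [u^r] 𝒲_{g,n+1}`,
`𝒲_{g,n+1} = [ħ^{2g-2+(n+1)}] 𝒲_{n+1}` (definition by vacuum expectation values). -/
def calWrVEV {K : Type*} [Field K] [CharZero K] (ψ y : PowerSeries (PowerSeries K)) (r g n : ℕ)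
    (m₁ : ℤ) (m : Fin n → ℤ) : K :=
  (r.factorial : K) * coeffHU (2 * g - 2 + (n + 1)) r (calW ψ y n m₁ m)

end

end HypKP

/-!
The proof transports the correlators to power series in the `p_k` by the boson–fermion
correspondence, where both expressions become coefficients of exponentials of one and the same
family of connected series.

*Bosonization.* Charge zero Maya diagrams are partitions, and a vector `v` of the completed Fock
space has the bosonic image `∑_λ v_λ s_λ(p)` (`boson`). Euler's identity for the Jacobi–Trudi
determinants, `|λ| s_λ = ∑_j p_j (J_{-j} s)_λ` (`energy_mul_tau`), together with the Heisenberg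
relations (`Jop_commutator`), shows that `J_b` acts on bosonic images as `b ∂/∂p_b` and `J_{-b}` as
multiplication by `p_b` (`boson_Jop_pos`, `boson_Jop_neg`). The same identity gives
`exp(∑ p_j J_{-j} / j)|0⟩ = ∑_λ s_λ(p) v_λ` (`expOp_raising_vac`), and `𝒟(ħ)` multiplies `v_λ` by
the product over the boxes of `λ`; hence the bosonic image of `G|0⟩` is `Z` (`boson_Gop_vac`).

*The first point.* At `p_a = q^a - q^{-a}`, `q = e^{uħ/2}`, only the hooks have nonvanishing Schur
functions, and their values are, up to a common factor, the matrix elements of `J_N ℰ_0` between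
the covacuum and the hooks of size `N`. So the coefficient of `X_1^N` of the insertion is
`𝒮(uħN) / (ħ 𝒮(uħ))` times the coefficient of `X^N` of the bosonic image under the substitution
`p_a ↦ uħ a 𝒮(uħa) X^a` (`insertion_vac`, `coeff_evalHom_boson`). By Taylor's formula this
substitution, applied to the derivatives of `log Z`, produces precisely the series `T`
(`seriesT_eq`). The linear terms `p_{-m}` contributed by creation operators account for the singular
part of `W_2` in its chosen expansion.

*Exponentials.* A product of currents applied to `G|0⟩` has as bosonic image the sum over set
partitions of products of connected series (`isExp_currentSeries`). The substitution is a ring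
homomorphism, and each connected series is sent to `T` plus its value at the origin. Exponentials
of sums are products of exponentials, so the correlators containing `𝒜_1` are convolutions of the
first expression with the correlators of the remaining currents (`evalHom_currentSeries`,
`corr_insert_zero_eq_sum`). Inclusion-exclusion is the logarithm of the generating function of the
correlators in variables `ε_i` with `ε_i² = 0`; its derivative with respect to `ε_1` shows that the
connected correlators satisfy the same convolution identity (`sum_connPart_mul`). The correlator
over the empty set is `1`, so the identity can be cancelled (`conv_right_cancel`).
-/

namespace HypKP

noncomputable section

/-! ### Exponentials of power series -/

section Exponential

variable {K : Type*} [Field K] {A : Type*} [CommRing A] [Algebra K A]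

/-- Cancellation of a nonzero natural factor in a vector space over a field of characteristic
zero. -/
theorem eq_of_natCast_mul_eq (K : Type*) [Field K] [CharZero K] {A : Type*} [CommRing A]
    [Algebra K A] {n : ℕ} (hn : n ≠ 0) {x y : A} (h : (n : A) * x = n * y) : x = y := by
  have hn' : (n : K) ≠ 0 := Nat.cast_ne_zero.2 hn
  have key : ∀ z : A, ((n : K)⁻¹) • ((n : A) * z) = z := fun z => by
    rw [← map_natCast (algebraMap K A), ← Algebra.smul_def, smul_smul, inv_mul_cancel₀ hn',
      one_smul]
  rw [← key x, h, key]

theorem coeff_pow_eq_zero {x : PowerSeries A} (hx : PowerSeries.constantCoeff x = 0) {N p : ℕ}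
    (h : N < p) : PowerSeries.coeff N (x ^ p) = 0 :=
  PowerSeries.X_pow_dvd_iff.1 (pow_dvd_pow_of_dvd (PowerSeries.X_dvd_iff.2 hx) p) N h

/-- The defining sum may be truncated anywhere beyond the degree under consideration. -/
theorem coeff_fexp {x : PowerSeries A} (hx : PowerSeries.constantCoeff x = 0) {N M : ℕ}
    (h : N ≤ M) : PowerSeries.coeff N (fexp K x) =
      PowerSeries.coeff N (∑ p ∈ Finset.range (M + 1), ((p.factorial : K)⁻¹) • x ^ p) := by
  rw [map_sum, fexp, PowerSeries.coeff_mk]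
  refine Finset.sum_subset (Finset.range_mono (by omega)) fun p _ hp => ?_
  rw [coeff_pow_eq_zero hx (by simpa using hp), smul_zero]

@[simp]
theorem constantCoeff_fexp (x : PowerSeries A) : PowerSeries.constantCoeff (fexp K x) = 1 := by
  rw [← PowerSeries.coeff_zero_eq_constantCoeff_apply, fexp, PowerSeries.coeff_mk]
  simp

theorem coeff_mul_congr {f f' : PowerSeries A} {N : ℕ}
    (h : ∀ n ≤ N, PowerSeries.coeff n f = PowerSeries.coeff n f') (g : PowerSeries A) :
    PowerSeries.coeff N (f * g) = PowerSeries.coeff N (f' * g) := by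
  rw [PowerSeries.coeff_mul, PowerSeries.coeff_mul]
  refine Finset.sum_congr rfl fun q hq => ?_
  rw [h q.1 (by have := Finset.HasAntidiagonal.mem_antidiagonal.1 hq; omega)]

/-- A derivation of `A⟦X⟧` that lowers the `X`-adic order by at most one satisfies the chain rule
for the exponential. -/
theorem derivation_fexp [CharZero K] (D : Derivation K (PowerSeries A) (PowerSeries A))
    (hD : ∀ N f, (∀ n ≤ N + 1, PowerSeries.coeff n f = 0) → PowerSeries.coeff N (D f) = 0)
    {x : PowerSeries A} (hx : PowerSeries.constantCoeff x = 0) :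
    D (fexp K x) = fexp K x * D x := by
  have hpoly : ∀ M : ℕ, D (∑ p ∈ Finset.range (M + 2), ((p.factorial : K)⁻¹) • x ^ p) =
      (∑ p ∈ Finset.range (M + 1), ((p.factorial : K)⁻¹) • x ^ p) * D x := by
    intro M
    rw [Finset.sum_range_succ', map_add, map_sum, Finset.sum_mul]
    simp only [pow_zero, D.map_smul, D.map_one_eq_zero, smul_zero, add_zero]
    refine Finset.sum_congr rfl fun p _ => ?_
    have h1 : ((p + 1 : ℕ) : K) ≠ 0 := Nat.cast_ne_zero.2 (Nat.succ_ne_zero p)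
    rw [D.leibniz_pow, Nat.add_sub_cancel, ← Nat.cast_smul_eq_nsmul K, smul_smul,
      Nat.factorial_succ, Nat.cast_mul, mul_inv, mul_comm ((p + 1 : ℕ) : K)⁻¹, mul_assoc,
      inv_mul_cancel₀ h1, mul_one, smul_eq_mul, smul_mul_assoc]
  ext N
  have h1 : PowerSeries.coeff N (D (fexp K x -
      ∑ p ∈ Finset.range (N + 2), ((p.factorial : K)⁻¹) • x ^ p)) = 0 := by
    refine hD N _ fun n hn => ?_
    rw [map_sub, coeff_fexp hx hn, sub_self]
  rw [map_sub, map_sub, sub_eq_zero] at h1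
  rw [h1, hpoly]
  exact coeff_mul_congr (fun n hn => (coeff_fexp hx hn).symm) _

theorem derivative_fexp [CharZero K] {x : PowerSeries A}
    (hx : PowerSeries.constantCoeff x = 0) :
    PowerSeries.derivative A (fexp K x) = fexp K x * PowerSeries.derivative A x := by
  refine derivation_fexp ((PowerSeries.derivative A).restrictScalars K) (fun N f hf => ?_) hx
  change PowerSeries.coeff N (PowerSeries.derivative A f) = 0
  rw [PowerSeries.coeff_derivative, hf _ le_rfl, zero_mul]

variable (K) in
/-- A first order linear equation with given initial value has at most one solution. -/
theorem eq_of_derivative_eq_mul [CharZero K] {f g a : PowerSeries A}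
    (hf : PowerSeries.derivative A f = f * a) (hg : PowerSeries.derivative A g = g * a)
    (h0 : PowerSeries.constantCoeff f = PowerSeries.constantCoeff g) : f = g := by
  ext N
  induction N using Nat.strong_induction_on with
  | _ N ih =>
  cases N with
  | zero => simpa using h0
  | succ N =>
    have h1 := congrArg (PowerSeries.coeff N) hf
    have h2 := congrArg (PowerSeries.coeff N) hg
    rw [PowerSeries.coeff_derivative] at h1 h2
    refine eq_of_natCast_mul_eq K (Nat.succ_ne_zero N) ?_
    push_cast
    rw [mul_comm, h1, mul_comm (_ + _), h2]
    exact coeff_mul_congr (fun n hn => ih n (by omega)) _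

theorem fexp_unique [CharZero K] {f x : PowerSeries A} (hx : PowerSeries.constantCoeff x = 0)
    (h0 : PowerSeries.constantCoeff f = 1)
    (hf : PowerSeries.derivative A f = f * PowerSeries.derivative A x) : f = fexp K x :=
  eq_of_derivative_eq_mul K hf (derivative_fexp hx) (by rw [h0, constantCoeff_fexp])

theorem fexp_add [CharZero K] {x y : PowerSeries A} (hx : PowerSeries.constantCoeff x = 0)
    (hy : PowerSeries.constantCoeff y = 0) : fexp K (x + y) = fexp K x * fexp K y := by
  refine (fexp_unique (by simp [hx, hy]) (by simp) ?_).symm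
  rw [Derivation.leibniz, derivative_fexp hx, derivative_fexp hy, map_add, smul_eq_mul,
    smul_eq_mul]
  ring

@[simp]
theorem fexp_zero [CharZero K] : fexp K (0 : PowerSeries A) = 1 :=
  (fexp_unique (by simp) (by simp) (by
    rw [← map_one PowerSeries.C, PowerSeries.derivative_C, map_zero, mul_zero])).symm

theorem fexp_mul_fexp_neg [CharZero K] {x : PowerSeries A}
    (hx : PowerSeries.constantCoeff x = 0) : fexp K x * fexp K (-x) = 1 := by
  rw [← fexp_add hx (by simp [hx]), add_neg_cancel, fexp_zero]

theorem map_fexp {B : Type*} [CommRing B] [Algebra K B] (φ : A →ₐ[K] B) (x : PowerSeries A) :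
    PowerSeries.map (φ : A →+* B) (fexp K x) = fexp K (PowerSeries.map (φ : A →+* B) x) := by
  ext N
  simp only [fexp, PowerSeries.coeff_map, PowerSeries.coeff_mk, map_sum, ← map_pow]
  refine Finset.sum_congr rfl fun p _ => ?_
  exact φ.toLinearMap.map_smul _ _

end Exponential

/-! ### Complete homogeneous functions -/

section Homogeneous

variable (K : Type*) [Field K] {A : Type*} [CommRing A] [Algebra K A]

theorem hSym_neg (p : ℕ → A) {n : ℤ} (h : n < 0) : hSym K p n = 0 := if_neg (by omega)

theorem hSym_zero (p : ℕ → A) : hSym K p 0 = 1 := by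
  rw [hSym, if_pos le_rfl, Int.toNat_zero, PowerSeries.coeff_zero_eq_constantCoeff_apply,
    constantCoeff_fexp]

theorem map_hSym {B : Type*} [CommRing B] [Algebra K B] (φ : A →ₐ[K] B) (p : ℕ → A) (n : ℤ) :
    φ (hSym K p n) = hSym K (fun k => φ (p k)) n := by
  unfold hSym
  split_ifs with h
  · have h1 := congrArg (PowerSeries.coeff n.toNat)
      (map_fexp φ (PowerSeries.mk fun k => if k = 0 then 0 else ((k : K)⁻¹) • p k))
    rw [PowerSeries.coeff_map] at h1
    refine h1.trans (congrArg (fun y => PowerSeries.coeff n.toNat (fexp K y)) ?_)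
    ext k
    simp only [PowerSeries.coeff_map, PowerSeries.coeff_mk]
    split_ifs
    · exact map_zero φ
    · exact φ.toLinearMap.map_smul _ _
  · exact map_zero φ

/-- Newton's identity `n h_n = ∑_{j ≥ 1} p_j h_{n-j}`. -/
theorem intCast_mul_hSym [CharZero K] (p : ℕ → A) (n : ℤ) {B : ℕ} (hB : n ≤ B) :
    (n : A) * hSym K p n = ∑ j ∈ Finset.Icc 1 B, p j * hSym K p (n - j) := by
  rcases le_or_gt n 0 with hn | hn
  · rw [Finset.sum_eq_zero fun j hj => by
      rw [hSym_neg K p (by have := (Finset.mem_Icc.1 hj).1; omega), mul_zero]]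
    rcases hn.eq_or_lt with rfl | h
    · simp
    · rw [hSym_neg K p h, mul_zero]
  obtain ⟨N, rfl⟩ : ∃ N : ℕ, n = (N + 1 : ℕ) := ⟨(n - 1).toNat, by omega⟩
  have hx : PowerSeries.constantCoeff
      (PowerSeries.mk fun k => if k = 0 then (0 : A) else ((k : K)⁻¹) • p k) = 0 := by
    rw [← PowerSeries.coeff_zero_eq_constantCoeff_apply, PowerSeries.coeff_mk, if_pos rfl]
  have h1 := congrArg (PowerSeries.coeff N) (derivative_fexp (K := K) hx)
  rw [PowerSeries.coeff_derivative, mul_comm (fexp K _), PowerSeries.coeff_mul] at h1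
  have h2 : hSym K p ((N + 1 : ℕ) : ℤ) = PowerSeries.coeff (N + 1)
      (fexp K (PowerSeries.mk fun k => if k = 0 then 0 else ((k : K)⁻¹) • p k)) := by
    rw [hSym, if_pos (by omega), Int.toNat_natCast]
  rw [h2, Int.cast_natCast, mul_comm, Nat.cast_succ, h1,
    Finset.Nat.sum_antidiagonal_eq_sum_range_succ_mk]
  have h3 : Finset.Icc 1 B = (Finset.range B).image (· + 1) := by
    ext j
    simp only [Finset.mem_Icc, Finset.mem_image, Finset.mem_range]
    constructor
    · intro h; exact ⟨j - 1, by omega, by omega⟩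
    · rintro ⟨i, hi, rfl⟩; omega
  rw [h3, Finset.sum_image (by intro a _ b _ h; simpa using h)]
  refine Finset.sum_subset_zero_on_sdiff
    (Finset.range_mono (by omega)) (fun j hj => ?_) (fun j hj => ?_)
  · have : N < j := by simpa using (Finset.mem_sdiff.1 hj).2
    rw [hSym_neg K p (by push_cast; omega), mul_zero]
  · have hj' : j ≤ N := by simpa [Nat.lt_succ_iff] using hj
    have hne : ((j + 1 : ℕ) : K) ≠ 0 := Nat.cast_ne_zero.2 (Nat.succ_ne_zero j)
    have e1 : PowerSeries.coeff j (PowerSeries.derivative A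
        (PowerSeries.mk fun k => if k = 0 then (0 : A) else ((k : K)⁻¹) • p k)) = p (j + 1) := by
      rw [PowerSeries.coeff_derivative, PowerSeries.coeff_mk, if_neg (Nat.succ_ne_zero j),
        ← Nat.cast_succ, ← map_natCast (algebraMap K A), mul_comm, ← Algebra.smul_def, smul_smul,
        mul_inv_cancel₀ hne, one_smul]
    rw [e1, hSym, if_pos (by push_cast; omega)]
    congr 3
    push_cast
    omega

end Homogeneous

/-! ### Squarefree coefficients of multivariate power series -/

section Squarefree

open Finset

variable {σ B : Type*} [DecidableEq σ] [CommRing B]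

/-- The exponent of the squarefree monomial `∏_{i ∈ A} ε_i`. -/
def ind (A : Finset σ) : σ →₀ ℕ := Finsupp.indicator A fun _ _ => 1

theorem ind_apply (A : Finset σ) (i : σ) : ind A i = if i ∈ A then 1 else 0 := by
  simp [ind, Finsupp.indicator_apply]

theorem support_ind (A : Finset σ) : (ind A).support = A := by
  ext i; simp [ind_apply]

@[simp]
theorem ind_empty : ind (∅ : Finset σ) = 0 := by
  ext i; simp [ind_apply]

theorem ind_add_ind_sdiff {A I : Finset σ} (h : A ⊆ I) : ind A + ind (I \ A) = ind I := by
  ext i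
  simp only [Finsupp.add_apply, ind_apply, mem_sdiff]
  by_cases hA : i ∈ A
  · simp [hA, h hA]
  · simp [hA]

theorem ind_insert {i : σ} {I : Finset σ} (h : i ∉ I) :
    ind I + Finsupp.single i 1 = ind (insert i I) := by
  ext j
  simp only [Finsupp.add_apply, ind_apply, mem_insert, Finsupp.single_apply]
  by_cases hj : i = j
  · subst hj; simp [h]
  · simp [hj, Ne.symm hj]

/-- The generating function `∑_A f(A) ∏_{i ∈ A} ε_i` of a set function. -/
def hat (f : Finset σ → B) : MvPowerSeries σ B := fun d =>
  if ind d.support = d then f d.support else 0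

theorem coeff_ind_hat (f : Finset σ → B) (A : Finset σ) :
    MvPowerSeries.coeff (ind A) (hat f) = f A := by
  change (if ind (ind A).support = ind A then f (ind A).support else 0) = f A
  rw [support_ind, if_pos rfl]

theorem ind_support_of_le {d : σ →₀ ℕ} (h : ∀ i, d i ≤ 1) : ind d.support = d := by
  ext i
  have := h i
  rw [ind_apply]
  split_ifs with hi
  · have := Finsupp.mem_support_iff.1 hi; omega
  · exact (Finsupp.notMem_support_iff.1 hi).symm

/-- Squarefree coefficients multiply by subset convolution. -/
theorem coeff_ind_mul (f g : MvPowerSeries σ B) (I : Finset σ) :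
    MvPowerSeries.coeff (ind I) (f * g) = ∑ A ∈ I.powerset,
      MvPowerSeries.coeff (ind A) f * MvPowerSeries.coeff (ind (I \ A)) g := by
  rw [MvPowerSeries.coeff_mul]
  have key : ∀ q ∈ antidiagonal (ind I), ind q.1.support = q.1 ∧ q.1.support ⊆ I ∧
      ind (I \ q.1.support) = q.2 := by
    rintro ⟨a, b⟩ hq
    have hq : a + b = ind I := by simpa using hq
    have hle : ∀ i, a i + b i = if i ∈ I then 1 else 0 := fun i => by
      rw [← ind_apply, ← hq, Finsupp.add_apply]
    have h1 : ind a.support = a := ind_support_of_le fun i => by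
      have := hle i; split_ifs at this <;> omega
    have h2 : a.support ⊆ I := fun i hi => by
      by_contra hI
      have := hle i
      rw [if_neg hI] at this
      exact Finsupp.mem_support_iff.1 hi (by omega)
    refine ⟨h1, h2, ?_⟩
    have h3 := ind_add_ind_sdiff h2
    rw [h1, ← hq] at h3
    exact add_left_cancel h3
  refine sum_nbij' (fun q => q.1.support) (fun A => (ind A, ind (I \ A))) ?_ ?_ ?_ ?_ ?_
  · intro q hq; exact mem_powerset.2 (key q hq).2.1
  · intro A hA
    simpa using ind_add_ind_sdiff (mem_powerset.1 hA)
  · intro q hq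
    obtain ⟨h1, -, h3⟩ := key q hq
    exact Prod.ext h1 h3
  · intro A _; exact support_ind A
  · intro q hq
    obtain ⟨h1, -, h3⟩ := key q hq
    rw [h1, h3]

theorem coeff_ind_pderiv (f : MvPowerSeries σ B) {i : σ} {I : Finset σ} (h : i ∉ I) :
    MvPowerSeries.coeff (ind I) (MvPowerSeries.pderiv B i f) =
      MvPowerSeries.coeff (ind (insert i I)) f := by
  rw [MvPowerSeries.coeff_pderiv, ind_insert h, ind_apply, if_neg h]
  simp

/-- The top squarefree coefficient of a product of `l` factors is a sum over ordered partitions of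
the set of variables into `l` possibly empty parts. -/
theorem coeff_ind_univ_prod {n l : ℕ} (f : Fin l → MvPowerSeries (Fin n) B) :
    MvPowerSeries.coeff (ind univ) (∏ i, f i) = ∑ g : Fin n → Fin l,
      ∏ i, MvPowerSeries.coeff (ind (univ.filter fun j => g j = i)) (f i) := by
  classical
  rw [MvPowerSeries.coeff_prod]
  symm
  have hsum : ∀ g : Fin n → Fin l,
      ∑ i, ind (univ.filter fun j => g j = i) = ind (univ : Finset (Fin n)) := by
    intro g
    ext j
    simp [Finsupp.finsetSum_apply, ind_apply]
  refine sum_bij (fun g _ => Finsupp.equivFunOnFinite.symm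
    fun i => ind (univ.filter fun j => g j = i)) ?_ ?_ ?_ ?_
  · intro g _
    rw [mem_finsuppAntidiag]
    exact ⟨hsum g, subset_univ _⟩
  · intro g _ g' _ h
    ext1 j
    have h1 := DFunLike.congr_fun (DFunLike.congr_fun h (g j)) j
    simp only [Finsupp.equivFunOnFinite_symm_apply_apply, ind_apply, mem_filter, mem_univ,
      true_and, if_true] at h1
    by_contra hne
    rw [if_neg (Ne.symm hne)] at h1
    exact one_ne_zero h1
  · intro L hL
    have hL1 : ∑ i, L i = ind univ := (mem_finsuppAntidiag.1 hL).1
    have hcol : ∀ j, ∑ i, L i j = 1 := fun j => by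
      rw [← Finsupp.finsetSum_apply, hL1, ind_apply, if_pos (mem_univ j)]
    have hex : ∀ j, ∃ i, L i j = 1 ∧ ∀ i', i' ≠ i → L i' j = 0 := by
      intro j
      obtain ⟨i, -, hi⟩ : ∃ i ∈ univ, L i j ≠ 0 := by
        by_contra! hno
        have := hcol j
        rw [sum_eq_zero hno] at this
        omega
      have h1 := hcol j
      rw [← add_sum_erase univ (fun i => L i j) (mem_univ i)] at h1
      have h2 : ∑ i' ∈ univ.erase i, L i' j = 0 := by omega
      exact ⟨i, by omega, fun i' hne => sum_eq_zero_iff.1 h2 i' (mem_erase.2 ⟨hne, mem_univ _⟩)⟩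
    choose g hg1 hg2 using hex
    refine ⟨g, mem_univ _, ?_⟩
    ext i j
    simp only [Finsupp.equivFunOnFinite_symm_apply_apply, ind_apply, mem_filter, mem_univ,
      true_and]
    split_ifs with hi
    · rw [← hi, hg1]
    · rw [hg2 j i (Ne.symm hi)]
  · intro g _
    exact prod_congr rfl fun i _ => rfl

end Squarefree

/-! ### Maya diagrams -/

theorem Maya.ext_set {S T : Maya} (h : S.set = T.set) : S = T := by
  cases S; cases T; cases h; rfl

theorem Maya.mem_move {S : Maya} {i j k : ℤ} :
    k ∈ (S.move i j).set ↔ k = j ∨ (k ∈ S.set ∧ k ≠ i) := by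
  simp [Maya.move]

theorem Maya.move_move {S : Maya} {i j : ℤ} (hi : i ∈ S.set) (hj : j ∉ S.set) :
    (S.move i j).move j i = S := by
  apply Maya.ext_set
  ext k
  rw [Maya.mem_move, Maya.mem_move]
  grind

/-- All places below `-B` are occupied and all places from `B` on are empty. -/
def Maya.IsBound (S : Maya) (B : ℤ) : Prop :=
  0 ≤ B ∧ (∀ k < -B, k ∈ S.set) ∧ ∀ k, B ≤ k → k ∉ S.set

theorem Maya.exists_isBound (S : Maya) : ∃ B, S.IsBound B := by
  obtain ⟨a, ha⟩ := S.finite_pos.bddAbove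
  obtain ⟨b, hb⟩ := S.finite_neg.bddBelow
  refine ⟨|a| + |b| + 1, by positivity, fun k hk => ?_, fun k hk hS => ?_⟩
  · by_contra hS
    have h0 : k < 0 := by have := abs_nonneg a; have := abs_nonneg b; omega
    have := hb (⟨h0, hS⟩ : k ∈ Set.Iio 0 \ S.set)
    have := neg_abs_le b; have := abs_nonneg a; omega
  · have h0 : 0 ≤ k := by have := abs_nonneg a; have := abs_nonneg b; omega
    have := ha (⟨hS, h0⟩ : k ∈ S.set ∩ Set.Ici 0)
    have := le_abs_self a; have := abs_nonneg b; omega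

theorem Maya.IsBound.move {S : Maya} {B a k : ℤ} (h : S.IsBound B) (hi : k - a ∈ S.set)
    (hk : k ∉ S.set) : (S.move (k - a) k).IsBound (B + |a|) := by
  have h1 : k - a < B := by by_contra hn; exact h.2.2 _ (by omega) hi
  have h2 : -B ≤ k := by by_contra hn; exact hk (h.2.1 _ (by omega))
  have h3 := le_abs_self a
  have h4 := neg_abs_le a
  have h5 := h.1
  refine ⟨by omega, fun l hl => ?_, fun l hl hS => ?_⟩
  · exact Maya.mem_move.2 (Or.inr ⟨h.2.1 _ (by omega), by omega⟩)
  · rcases Maya.mem_move.1 hS with rfl | ⟨hS, -⟩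
    · omega
    · exact h.2.2 _ (by omega) hS

theorem Maya.IsBound.occ_eq_zero {S : Maya} {B k : ℤ} (h : S.IsBound B)
    (hk : k ∉ Finset.Ico (-B) B) : occ k S = 0 := by
  have h0 := h.1
  simp only [Finset.mem_Ico, not_and_or, not_le, not_lt] at hk
  rcases hk with hk | hk
  · simp [occ, h.2.1 k hk, show k < 0 by omega]
  · simp [occ, h.2.2 k hk, show ¬ k < 0 by omega]

theorem occ_move {S : Maya} {i j : ℤ} (hi : i ∈ S.set) (hj : j ∉ S.set) (k : ℤ) :
    occ k (S.move i j) = occ k S - (if k = i then 1 else 0) + (if k = j then 1 else 0) := by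
  have hij : i ≠ j := fun h => hj (h ▸ hi)
  have hm := Maya.mem_move (S := S) (i := i) (j := j) (k := k)
  unfold occ
  by_cases h1 : k = i
  · subst h1
    have : k ∉ (S.move k j).set := by rw [hm]; simp [hij]
    simp [hi, hij, this]
  · by_cases h2 : k = j
    · subst h2
      have : k ∈ (S.move i k).set := by rw [hm]; simp
      simp only [this, hj, if_true, if_false, h1]; ring
    · by_cases hk : k ∈ S.set
      · have : k ∈ (S.move i j).set := by rw [hm]; simp [hk, h1]
        simp [hk, h1, h2, this]
      · have : k ∉ (S.move i j).set := by rw [hm]; simp [hk, h2]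
        simp [hk, h1, h2, this]

/-- The eigenvalue on `v_S` of the diagonal operator `∑_k φ_k Ê_{k,k}`. -/
def occSum {A : Type*} [CommRing A] (φ : ℤ → A) (S : Maya) : A :=
  ∑ᶠ k : ℤ, (occ k S : A) * φ k

theorem occSum_eq_sum {A : Type*} [CommRing A] (φ : ℤ → A) {S : Maya} {T : Finset ℤ}
    (h : ∀ k, k ∉ T → occ k S = 0) : occSum φ S = ∑ k ∈ T, (occ k S : A) * φ k := by
  refine finsum_eq_sum_of_support_subset _ fun k hk => ?_
  by_contra hT
  exact hk (by simp [h k hT])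

/-- A move shifts the eigenvalue by the difference of the two places. -/
theorem occSum_move {A : Type*} [CommRing A] (φ : ℤ → A) {S : Maya} {i j : ℤ}
    (hi : i ∈ S.set) (hj : j ∉ S.set) :
    occSum φ (S.move i j) = occSum φ S - φ i + φ j := by
  obtain ⟨B, hB⟩ := S.exists_isBound
  set T : Finset ℤ := insert i (insert j (Finset.Ico (-B) B)) with hT
  have h1 : ∀ k, k ∉ T → occ k S = 0 := fun k hk => hB.occ_eq_zero fun h => hk (by simp [T, h])
  have h2 : ∀ k, k ∉ T → occ k (S.move i j) = 0 := fun k hk => by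
    have hki : k ≠ i := fun h => hk (by simp [T, h])
    have hkj : k ≠ j := fun h => hk (by simp [T, h])
    rw [occ_move hi hj, h1 k hk, if_neg hki, if_neg hkj]; rfl
  rw [occSum_eq_sum φ h1, occSum_eq_sum φ h2]
  simp only [occ_move hi hj, Int.cast_add, Int.cast_sub, add_mul, sub_mul,
    Finset.sum_add_distrib, Finset.sum_sub_distrib]
  simp [T]

@[simp]
theorem occ_vac (k : ℤ) : occ k Maya.vac = 0 := by
  simp [occ, Maya.vac]

@[simp]
theorem occSum_vac {A : Type*} [CommRing A] (φ : ℤ → A) : occSum φ Maya.vac = 0 := by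
  simp [occSum]

/-- The charge of a Maya diagram. -/
def Maya.charge (S : Maya) : ℤ := occSum (fun _ => 1) S

/-- The energy of a Maya diagram, shifted so as to be integral; for charge zero it is the size of
the corresponding partition. -/
def Maya.energy (S : Maya) : ℤ := occSum (fun k => k + 1) S

theorem occ_mul_nonneg (k : ℤ) (S : Maya) : 0 ≤ occ k S * (k + 1) := by
  unfold occ
  by_cases h : k ∈ S.set <;> by_cases h' : k < 0 <;> simp [h, h'] <;> omega

theorem Maya.le_energy (S : Maya) (k : ℤ) : occ k S * (k + 1) ≤ S.energy := by
  obtain ⟨B, hB⟩ := S.exists_isBound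
  have h1 : S.energy = ∑ l ∈ insert k (Finset.Ico (-B) B), occ l S * (l + 1) := by
    exact occSum_eq_sum (A := ℤ) _ fun l hl => hB.occ_eq_zero fun h => hl (by simp [h])
  rw [h1]
  exact Finset.single_le_sum (f := fun l => occ l S * (l + 1))
    (fun l _ => occ_mul_nonneg l S) (Finset.mem_insert_self _ _)

theorem Maya.energy_nonneg (S : Maya) : 0 ≤ S.energy :=
  (occ_mul_nonneg 0 S).trans (S.le_energy 0)

theorem Maya.isBound_energy (S : Maya) : S.IsBound (S.energy + 1) := by
  have h0 := S.energy_nonneg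
  refine ⟨by omega, fun k hk => ?_, fun k hk hS => ?_⟩
  · by_contra hS
    have := S.le_energy k
    simp only [occ, hS, show k < 0 by omega, if_true] at this
    simp at this
    omega
  · have := S.le_energy k
    simp [occ, hS, show ¬ k < 0 by omega] at this
    omega

/-- A diagram of energy `N` is determined by its places in the window `[-N-1, N+1]`. -/
theorem Maya.finite_energy_eq (N : ℤ) : {S : Maya | S.energy = N}.Finite := by
  have : Set.InjOn (fun S : Maya => S.set ∩ Set.Icc (-(N + 1)) (N + 1))
      {S : Maya | S.energy = N} := by
    intro S hS T hT h
    apply Maya.ext_set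
    have hS1 := S.isBound_energy
    have hT1 := T.isBound_energy
    rw [show S.energy = N from hS] at hS1
    rw [show T.energy = N from hT] at hT1
    ext k
    by_cases hk : k ∈ Set.Icc (-(N + 1)) (N + 1)
    · have := Set.ext_iff.1 h k
      simp only [Set.mem_inter_iff, hk, and_true] at this
      exact this
    · simp only [Set.mem_Icc, not_and_or, not_le] at hk
      rcases hk with hk | hk
      · exact ⟨fun _ => hT1.2.1 k hk, fun _ => hS1.2.1 k hk⟩
      · exact ⟨fun h => absurd h (hS1.2.2 k hk.le), fun h => absurd h (hT1.2.2 k hk.le)⟩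
  refine Set.Finite.of_finite_image ?_ this
  refine ((Set.finite_Icc (-(N + 1)) (N + 1)).finite_subsets).subset ?_
  rintro _ ⟨S, -, rfl⟩
  exact Set.inter_subset_right

theorem Maya.charge_eq_sum {S : Maya} {B : ℤ} (hB : S.IsBound B) (k : ℤ) :
    S.charge = ∑ l ∈ Insert.insert k (Finset.Ico (-B) B), occ l S := by
  refine (occSum_eq_sum (A := ℤ) _ (T := Insert.insert k (Finset.Ico (-B) B)) fun l hl =>
    hB.occ_eq_zero fun h => hl (by simp [h])).trans ?_
  exact Finset.sum_congr rfl fun l _ => by rw [mul_one, Int.cast_id]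

theorem Maya.eq_vac_of_occ_eq_zero {S : Maya} (hall : ∀ k, occ k S = 0) : S = Maya.vac := by
  apply Maya.ext_set
  ext k
  have := hall k
  unfold occ at this
  simp only [Maya.vac, Set.mem_Iio]
  by_cases h : k ∈ S.set <;> by_cases h' : k < 0 <;> simp [h, h'] at this ⊢

theorem Maya.eq_vac_of_occ_nonpos {S : Maya} (hc : S.charge = 0) (h : ∀ k, occ k S ≤ 0) :
    S = Maya.vac := by
  obtain ⟨B, hB⟩ := S.exists_isBound
  refine Maya.eq_vac_of_occ_eq_zero fun k => ?_
  have h1 := Maya.charge_eq_sum hB k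
  rw [hc] at h1
  exact (Finset.sum_eq_zero_iff_of_nonpos fun l _ => h l).1 h1.symm k (Finset.mem_insert_self _ _)

theorem Maya.eq_vac_of_occ_nonneg {S : Maya} (hc : S.charge = 0) (h : ∀ k, 0 ≤ occ k S) :
    S = Maya.vac := by
  obtain ⟨B, hB⟩ := S.exists_isBound
  refine Maya.eq_vac_of_occ_eq_zero fun k => ?_
  have h1 := Maya.charge_eq_sum hB k
  rw [hc] at h1
  exact (Finset.sum_eq_zero_iff_of_nonneg fun l _ => h l).1 h1.symm k (Finset.mem_insert_self _ _)

theorem Maya.occ_nonpos {S : Maya} {k : ℤ} (h : 0 ≤ k → k ∉ S.set) : occ k S ≤ 0 := by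
  unfold occ
  by_cases h0 : k < 0
  · rw [if_pos h0]; split_ifs <;> simp
  · rw [if_neg h0, if_neg (h (by omega))]; simp

theorem Maya.occ_nonneg {S : Maya} {k : ℤ} (h : k < 0 → k ∈ S.set) : 0 ≤ occ k S := by
  unfold occ
  by_cases h0 : k < 0
  · rw [if_pos h0, if_pos (h h0)]; simp
  · rw [if_neg h0]; split_ifs <;> simp

theorem Maya.eq_vac {S : Maya} (hc : S.charge = 0) (he : S.energy = 0) : S = Maya.vac := by
  refine Maya.eq_vac_of_occ_nonpos hc fun k => Maya.occ_nonpos fun hk hS => ?_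
  have h1 := S.le_energy k
  have h2 : occ k S = 1 := by simp [occ, hS, show ¬ k < 0 by omega]
  rw [he, h2] at h1
  omega

theorem Maya.charge_move {S : Maya} {i j : ℤ} (hi : i ∈ S.set) (hj : j ∉ S.set) :
    (S.move i j).charge = S.charge := by
  rw [Maya.charge, occSum_move _ hi hj, Maya.charge]; ring

theorem Maya.energy_move {S : Maya} {i j : ℤ} (hi : i ∈ S.set) (hj : j ∉ S.set) :
    (S.move i j).energy = S.energy + (j - i) := by
  rw [Maya.energy, occSum_move _ hi hj, Maya.energy]; ring

/-! ### The Heisenberg algebra -/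

section Heisenberg

variable {R : Type*} [CommRing R]

/-- Off the diagonal, a band operator at `S` sees only the vectors reached by the moves
that `S` admits. -/
theorem band_congr {m : ℤ} (hm : m ≠ 0) (c : ℤ → R) {f g : Fock R} {S : Maya}
    (h : ∀ k, k - m ∈ S.set → k ∉ S.set → f (S.move (k - m) k) = g (S.move (k - m) k)) :
    band m c f S = band m c g S := by
  refine finsum_congr fun k => ?_
  have hne : k - m ≠ k := by omega
  unfold Ehat
  rw [if_neg hne, if_neg hne]
  by_cases hk : k - m ∈ S.set ∧ k ∉ S.set
  · rw [if_pos hk, if_pos hk, h k hk.1 hk.2]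
  · rw [if_neg hk, if_neg hk]

theorem band_eq_sum (m : ℤ) (c : ℤ → R) (f : Fock R) {S : Maya} {B C : ℤ} (hS : S.IsBound B)
    (hC : B + |m| ≤ C) :
    band m c f S = ∑ k ∈ Finset.Icc (-C) C, c k * Ehat (k - m) k f S := by
  refine finsum_eq_sum_of_support_subset _ fun k hk => ?_
  by_contra hT
  apply hk
  have h3 := le_abs_self m
  have h4 := neg_abs_le m
  simp only [Finset.coe_Icc, Set.mem_Icc, not_and_or, not_le] at hT
  by_cases hm : m = 0
  · subst hm
    have : occ k S = 0 := hS.occ_eq_zero (by simp only [Finset.mem_Ico]; omega)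
    simp [Ehat, this]
  · have : ¬ (k - m ∈ S.set ∧ k ∉ S.set) := by
      rintro ⟨h1, h2⟩
      have h5 : k - m < B := by by_contra hn; exact hS.2.2 _ (by omega) h1
      have h6 : -B ≤ k := by by_contra hn; exact h2 (hS.2.1 _ (by omega))
      omega
    simp [Ehat, this, hm]

theorem Ehat_add (i j : ℤ) (f g : Fock R) (S : Maya) :
    Ehat i j (f + g) S = Ehat i j f S + Ehat i j g S := by
  unfold Ehat; split_ifs <;> simp [mul_add]

theorem Ehat_smul (i j : ℤ) (c : R) (f : Fock R) (S : Maya) :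
    Ehat i j (c • f) S = c * Ehat i j f S := by
  unfold Ehat; split_ifs <;> simp [mul_left_comm]

/-- The operator `J_m` as a linear map. -/
def Jlin (m : ℤ) : Module.End R (Fock R) where
  toFun := Jop m
  map_add' f g := by
    ext S
    rw [Pi.add_apply, Jop, band, band, band,
      ← finsum_add_distrib (finite_support_band m _ f S) (finite_support_band m _ g S)]
    exact finsum_congr fun k => by rw [Ehat_add, mul_add]
  map_smul' c f := by
    ext S
    rw [RingHom.id_apply, Pi.smul_apply, Jop, band, band, smul_eq_mul,
      mul_finsum' (fun k => 1 * Ehat (k - m) k f S) c (finite_support_band m _ f S)]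
    exact finsum_congr fun k => by rw [Ehat_smul, mul_left_comm]

theorem Jlin_apply (m : ℤ) (f : Fock R) : Jlin m f = Jop m f := rfl

theorem Jop_zero (f : Fock R) (S : Maya) : Jop 0 f S = (S.charge : R) * f S := by
  obtain ⟨B, hB⟩ := S.exists_isBound
  have h1 := occSum_eq_sum (A := ℤ) (fun _ => 1) (T := Finset.Icc (-B) B)
    fun k hk => hB.occ_eq_zero (S := S) fun h => hk (by
      simp only [Finset.mem_Ico, Finset.mem_Icc] at h ⊢; omega)
  rw [Jop, band_eq_sum 0 _ f hB (C := B) (by simp), Maya.charge, h1, Int.cast_sum, Finset.sum_mul]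
  refine Finset.sum_congr rfl fun k _ => ?_
  simp [Ehat]

/-- The sign `(-1)^{#{l ∈ S : l > k}}` picked up by moving the factor `k` to the front. -/
def Maya.sgn (k : ℤ) (S : Maya) : ℤ := (-1) ^ (S.set ∩ Set.Ioi k).ncard

theorem Maya.finite_Ioi (S : Maya) (k : ℤ) : (S.set ∩ Set.Ioi k).Finite := by
  obtain ⟨B, hB⟩ := S.exists_isBound
  refine (Set.finite_Ioo k B).subset fun l hl => ⟨hl.2, ?_⟩
  by_contra h
  exact hB.2.2 l (by omega) hl.1

/-- Remove the place `k`. -/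
def Maya.erase (S : Maya) (k : ℤ) : Maya where
  set := S.set \ {k}
  finite_pos := S.finite_pos.subset fun _ h => ⟨h.1.1, h.2⟩
  finite_neg := (S.finite_neg.insert k).subset fun x hx => by
    by_cases h : x = k
    · exact Or.inl h
    · exact Or.inr ⟨hx.1, fun hS => hx.2 ⟨hS, h⟩⟩

/-- Occupy the place `k`. -/
def Maya.insert (S : Maya) (k : ℤ) : Maya where
  set := Insert.insert k S.set
  finite_pos := (S.finite_pos.insert k).subset (by
    rintro x ⟨rfl | h, h0⟩
    · exact Or.inl rfl
    · exact Or.inr ⟨h, h0⟩)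
  finite_neg := S.finite_neg.subset fun _ h => ⟨h.1, fun hS => h.2 (Or.inr hS)⟩

theorem Maya.mem_erase {S : Maya} {k l : ℤ} : l ∈ (S.erase k).set ↔ l ∈ S.set ∧ l ≠ k := Iff.rfl

theorem Maya.mem_insert {S : Maya} {k l : ℤ} : l ∈ (S.insert k).set ↔ l = k ∨ l ∈ S.set := Iff.rfl

theorem Maya.sgn_mul_self (k : ℤ) (S : Maya) : S.sgn k * S.sgn k = 1 := by
  rw [Maya.sgn, ← pow_add, ← two_mul, pow_mul]; simp

theorem Maya.sgn_erase {S : Maya} {i : ℤ} (hi : i ∈ S.set) (j : ℤ) :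
    (S.erase i).sgn j = if j < i then -S.sgn j else S.sgn j := by
  unfold Maya.sgn
  split_ifs with h
  · have h1 : (S.erase i).set ∩ Set.Ioi j = (S.set ∩ Set.Ioi j) \ {i} := by
      ext l; simp only [Set.mem_inter_iff, Maya.mem_erase, Set.mem_sdiff, Set.mem_singleton_iff]
      tauto
    have h2 := Set.ncard_sdiff_singleton_add_one (s := S.set ∩ Set.Ioi j) (a := i) ⟨hi, h⟩
      (S.finite_Ioi j)
    rw [h1, ← h2, pow_succ]; ring
  · congr 2
    ext l
    simp only [Set.mem_inter_iff, Maya.mem_erase, Set.mem_Ioi]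
    constructor
    · tauto
    · rintro ⟨h1, h2⟩; exact ⟨⟨h1, by omega⟩, h2⟩

theorem Maya.sgn_insert {S : Maya} {i : ℤ} (hi : i ∉ S.set) (j : ℤ) :
    (S.insert i).sgn j = if j < i then -S.sgn j else S.sgn j := by
  have h1 : (S.insert i).erase i = S := by
    apply Maya.ext_set; ext l; rw [Maya.mem_erase, Maya.mem_insert]; grind
  have h2 := Maya.sgn_erase (S := S.insert i) (Or.inl rfl) j
  rw [h1] at h2
  rw [h2]
  split_ifs <;> simp

open Classical in
/-- The creation operator `ψ_k`, on coefficients. -/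
def psi (k : ℤ) : Module.End R (Fock R) where
  toFun f S := if k ∈ S.set then (S.sgn k : R) * f (S.erase k) else 0
  map_add' f g := by ext S; dsimp; split_ifs <;> simp [mul_add]
  map_smul' c f := by ext S; dsimp; split_ifs <;> simp [mul_left_comm]

open Classical in
/-- The annihilation operator `ψ_k^*`, on coefficients. -/
def psiStar (k : ℤ) : Module.End R (Fock R) where
  toFun f S := if k ∈ S.set then 0 else (S.sgn k : R) * f (S.insert k)
  map_add' f g := by ext S; dsimp; split_ifs <;> simp [mul_add]
  map_smul' c f := by ext S; dsimp; split_ifs <;> simp [mul_left_comm]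

theorem psi_apply {k : ℤ} {S : Maya} (h : k ∈ S.set) (f : Fock R) :
    psi k f S = (S.sgn k : R) * f (S.erase k) := if_pos h

theorem psi_apply_of_notMem {k : ℤ} {S : Maya} (h : k ∉ S.set) (f : Fock R) :
    psi k f S = 0 := if_neg h

theorem psiStar_apply {k : ℤ} {S : Maya} (h : k ∉ S.set) (f : Fock R) :
    psiStar k f S = (S.sgn k : R) * f (S.insert k) := if_neg h

theorem psiStar_apply_of_mem {k : ℤ} {S : Maya} (h : k ∈ S.set) (f : Fock R) :
    psiStar k f S = 0 := if_pos h

theorem psi_mul_psi (i j : ℤ) : (psi i * psi j : Module.End R (Fock R)) = -(psi j * psi i) := by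
  ext f S
  simp only [Module.End.mul_apply, LinearMap.neg_apply, Pi.neg_apply]
  rcases eq_or_ne i j with rfl | hij
  · have : psi i (psi i f) S = 0 := by
      by_cases hi : i ∈ S.set
      · rw [psi_apply hi, psi_apply_of_notMem (fun h => (Maya.mem_erase.1 h).2 rfl), mul_zero]
      · exact psi_apply_of_notMem hi _
    rw [this, neg_zero]
  by_cases hi : i ∈ S.set
  · by_cases hj : j ∈ S.set
    · rw [psi_apply hi, psi_apply hj, psi_apply (Maya.mem_erase.2 ⟨hj, hij.symm⟩),
        psi_apply (Maya.mem_erase.2 ⟨hi, hij⟩), Maya.sgn_erase hi, Maya.sgn_erase hj]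
      have h1 : (S.erase i).erase j = (S.erase j).erase i := by
        apply Maya.ext_set; ext l; simp only [Maya.mem_erase]; tauto
      rw [h1]
      rcases lt_or_gt_of_ne hij with h | h
      · rw [if_neg h.not_gt, if_pos h]; push_cast; ring
      · rw [if_neg h.not_gt, if_pos h]; push_cast; ring
    · rw [psi_apply_of_notMem hj, psi_apply hi,
        psi_apply_of_notMem (fun h => hj (Maya.mem_erase.1 h).1), mul_zero, neg_zero]
  · rw [psi_apply_of_notMem hi]
    by_cases hj : j ∈ S.set
    · rw [psi_apply hj, psi_apply_of_notMem (fun h => hi (Maya.mem_erase.1 h).1), mul_zero,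
        neg_zero]
    · rw [psi_apply_of_notMem hj, neg_zero]

theorem psiStar_mul_psiStar (i j : ℤ) :
    (psiStar i * psiStar j : Module.End R (Fock R)) = -(psiStar j * psiStar i) := by
  ext f S
  simp only [Module.End.mul_apply, LinearMap.neg_apply, Pi.neg_apply]
  rcases eq_or_ne i j with rfl | hij
  · have : psiStar i (psiStar i f) S = 0 := by
      by_cases hi : i ∈ S.set
      · exact psiStar_apply_of_mem hi _
      · rw [psiStar_apply hi, psiStar_apply_of_mem (Maya.mem_insert.2 (Or.inl rfl)), mul_zero]
    rw [this, neg_zero]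
  by_cases hi : i ∈ S.set
  · rw [psiStar_apply_of_mem hi]
    by_cases hj : j ∈ S.set
    · rw [psiStar_apply_of_mem hj, neg_zero]
    · rw [psiStar_apply hj, psiStar_apply_of_mem (Maya.mem_insert.2 (Or.inr hi)), mul_zero,
        neg_zero]
  · by_cases hj : j ∈ S.set
    · rw [psiStar_apply_of_mem hj, psiStar_apply hi,
        psiStar_apply_of_mem (Maya.mem_insert.2 (Or.inr hj)), mul_zero, neg_zero]
    · rw [psiStar_apply hi, psiStar_apply hj,
        psiStar_apply (fun h => (Maya.mem_insert.1 h).elim hij.symm hj),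
        psiStar_apply (fun h => (Maya.mem_insert.1 h).elim hij hi),
        Maya.sgn_insert hi, Maya.sgn_insert hj]
      have h1 : (S.insert i).insert j = (S.insert j).insert i := by
        apply Maya.ext_set; ext l; simp only [Maya.mem_insert]; tauto
      rw [h1]
      rcases lt_or_gt_of_ne hij with h | h
      · rw [if_neg h.not_gt, if_pos h]; push_cast; ring
      · rw [if_neg h.not_gt, if_pos h]; push_cast; ring

theorem psi_psiStar_self (k : ℤ) (f : Fock R) (S : Maya) (h : k ∈ S.set) :
    psi k (psiStar k f) S = f S := by
  have h1 : (S.erase k).insert k = S := by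
    apply Maya.ext_set; ext l; rw [Maya.mem_insert, Maya.mem_erase]; grind
  have h2 : (S.sgn k : R) * S.sgn k = 1 := by rw [← Int.cast_mul, S.sgn_mul_self]; simp
  rw [psi_apply h, psiStar_apply (fun h => (Maya.mem_erase.1 h).2 rfl), Maya.sgn_erase h,
    if_neg (lt_irrefl k), h1, ← mul_assoc, h2, one_mul]

/-- The canonical anticommutation relation `ψ_j^* ψ_i + ψ_i ψ_j^* = δ_{ij}`. -/
theorem psiStar_mul_psi (i j : ℤ) : (psiStar j * psi i : Module.End R (Fock R)) =
    (if i = j then 1 else 0) - psi i * psiStar j := by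
  ext f S
  split_ifs with hij
  · subst hij
    simp only [Module.End.mul_apply, LinearMap.sub_apply, Pi.sub_apply, Module.End.one_apply]
    by_cases hi : i ∈ S.set
    · rw [psi_psiStar_self i f S hi, psiStar_apply_of_mem hi, sub_self]
    · have h1 : (S.insert i).erase i = S := by
        apply Maya.ext_set; ext l; rw [Maya.mem_erase, Maya.mem_insert]; grind
      have h2 : (S.sgn i : R) * S.sgn i = 1 := by rw [← Int.cast_mul, S.sgn_mul_self]; simp
      rw [psiStar_apply hi, psi_apply (Maya.mem_insert.2 (Or.inl rfl)), psi_apply_of_notMem hi,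
        Maya.sgn_insert hi, if_neg (lt_irrefl i), h1, ← mul_assoc, h2, one_mul, sub_zero]
  · simp only [Module.End.mul_apply, LinearMap.sub_apply, Pi.sub_apply, LinearMap.zero_apply,
      Pi.zero_apply]
    by_cases hj : j ∈ S.set
    · rw [psiStar_apply_of_mem hj]
      by_cases hi : i ∈ S.set
      · rw [psi_apply hi, psiStar_apply_of_mem (Maya.mem_erase.2 ⟨hj, Ne.symm hij⟩), mul_zero,
          sub_zero]
      · rw [psi_apply_of_notMem hi, sub_zero]
    · rw [psiStar_apply hj]
      by_cases hi : i ∈ S.set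
      · rw [psi_apply hi, psi_apply (Maya.mem_insert.2 (Or.inr hi)),
          psiStar_apply (fun h => hj (Maya.mem_erase.1 h).1), Maya.sgn_erase hi,
          Maya.sgn_insert hj]
        have h1 : (S.insert j).erase i = (S.erase i).insert j := by
          apply Maya.ext_set; ext l; simp only [Maya.mem_insert, Maya.mem_erase]; grind
        rw [h1]
        rcases lt_or_gt_of_ne hij with h | h
        · rw [if_neg h.not_gt, if_pos h]; push_cast; ring
        · rw [if_neg h.not_gt, if_pos h]; push_cast; ring
      · rw [psi_apply_of_notMem hi,
          psi_apply_of_notMem (fun h => (Maya.mem_insert.1 h).elim hij hi), mul_zero, sub_zero]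

end Heisenberg

/-! ### The commutators of the currents -/

section Commutator

variable {R : Type*} [CommRing R]

theorem Ehat_eq_psi_mul_psiStar {i j : ℤ} (hij : i ≠ j) (f : Fock R) (S : Maya) :
    Ehat i j f S = (psi i * psiStar j : Module.End R (Fock R)) f S := by
  rw [Module.End.mul_apply]
  unfold Ehat
  rw [if_neg hij]
  by_cases hi : i ∈ S.set
  · rw [psi_apply hi]
    by_cases hj : j ∈ S.set
    · rw [psiStar_apply_of_mem (Maya.mem_erase.2 ⟨hj, hij.symm⟩), if_neg (fun h => h.2 hj),
        mul_zero]
    · have h1 : (S.erase i).insert j = S.move i j := rfl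
      rw [psiStar_apply (fun h => hj (Maya.mem_erase.1 h).1), if_pos ⟨hi, hj⟩, h1,
        Maya.sgn_erase hi, ← mul_assoc]
      congr 1
      -- the places above both `i` and `j` are counted twice
      have hcount : ∀ a b : ℤ, a < b → b ∉ S.set ∨ a ∉ S.set →
          (S.set ∩ Set.Ioi a).ncard = (S.set ∩ Set.Ioo a b).ncard + (S.set ∩ Set.Ioi b).ncard +
            (S.set ∩ {b}).ncard := by
        intro a b hab _
        have e : S.set ∩ Set.Ioi a =
            (S.set ∩ Set.Ioo a b) ∪ (S.set ∩ Set.Ioi b) ∪ (S.set ∩ {b}) := by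
          ext l
          simp only [Set.mem_inter_iff, Set.mem_Ioi, Set.mem_union, Set.mem_Ioo,
            Set.mem_singleton_iff]
          constructor
          · rintro ⟨h1, h2⟩
            rcases lt_trichotomy l b with h | h | h
            · exact Or.inl (Or.inl ⟨h1, h2, h⟩)
            · exact Or.inr ⟨h1, h⟩
            · exact Or.inl (Or.inr ⟨h1, h⟩)
          · rintro ((⟨h1, h2, h3⟩ | ⟨h1, h2⟩) | ⟨h1, h2⟩)
            · exact ⟨h1, h2⟩
            · exact ⟨h1, by omega⟩
            · exact ⟨h1, by omega⟩
        have f1 : (S.set ∩ Set.Ioo a b).Finite := (Set.finite_Ioo a b).inter_of_right _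
        have f2 := S.finite_Ioi b
        have f3 : (S.set ∩ {b}).Finite := (Set.finite_singleton b).inter_of_right _
        rw [e, Set.ncard_union_eq _ (f1.union f2) f3, Set.ncard_union_eq _ f1 f2]
        · rw [Set.disjoint_left]
          rintro l ⟨-, h2⟩ ⟨-, h3⟩
          simp only [Set.mem_Ioo, Set.mem_Ioi] at h2 h3; omega
        · rw [Set.disjoint_left]
          rintro l (⟨-, h2⟩ | ⟨-, h2⟩) ⟨-, h3⟩ <;>
            simp only [Set.mem_Ioo, Set.mem_Ioi, Set.mem_singleton_iff] at h2 h3 <;> omega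
      rcases lt_or_gt_of_ne hij with h | h
      · have h2 := hcount i j h (Or.inl hj)
        have h3 : S.set ∩ {j} = ∅ := by
          rw [Set.inter_singleton_eq_empty]; exact hj
        rw [h3, Set.ncard_empty, add_zero] at h2
        rw [if_neg h.not_gt, min_eq_left h.le, max_eq_right h.le]
        simp only [Maya.sgn, h2, pow_add]
        push_cast
        rw [mul_assoc, ← pow_add, ← two_mul, pow_mul]
        simp
      · have h2 := hcount j i h (Or.inr hj)
        have h3 : S.set ∩ {i} = {i} := by
          rw [Set.inter_eq_right]; exact Set.singleton_subset_iff.2 hi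
        rw [h3, Set.ncard_singleton] at h2
        rw [if_pos h, min_eq_right h.le, max_eq_left h.le]
        simp only [Maya.sgn, h2, pow_add]
        push_cast
        have h4 : ((-1 : R) ^ (S.set ∩ Set.Ioi i).ncard) *
            (-1) ^ (S.set ∩ Set.Ioi i).ncard = 1 := by
          rw [← pow_add, ← two_mul, pow_mul]; simp
        linear_combination (-(-1 : R) ^ (S.set ∩ Set.Ioo j i).ncard) * h4
  · rw [psi_apply_of_notMem hi, if_neg (fun h => hi h.1)]

/-- The truncation `∑_{|k| ≤ C} ψ_{k-a} ψ_k^*` of `J_a`. -/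
def Jtrunc (R : Type*) [CommRing R] (C a : ℤ) : Module.End R (Fock R) :=
  ∑ k ∈ Finset.Icc (-C) C, psi (k - a) * psiStar k

theorem Jop_eq_Jtrunc {a : ℤ} (ha : a ≠ 0) (f : Fock R) {S : Maya} {B C : ℤ} (hS : S.IsBound B)
    (hC : B + |a| ≤ C) : Jop a f S = Jtrunc R C a f S := by
  rw [Jop, band_eq_sum a _ f hS hC, Jtrunc, LinearMap.sum_apply, Finset.sum_apply]
  exact Finset.sum_congr rfl fun k _ => by
    rw [one_mul, Ehat_eq_psi_mul_psiStar (by omega)]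

/-- At a fixed diagram, a product of two currents is a product of finite sums of products of
fermions. -/
theorem Jop_Jop_eq_Jtrunc {a b : ℤ} (ha : a ≠ 0) (hb : b ≠ 0) (f : Fock R) {S : Maya} {B C : ℤ}
    (hS : S.IsBound B) (hC : B + |a| + |b| ≤ C) :
    Jop a (Jop b f) S = (Jtrunc R C a * Jtrunc R C b) f S := by
  have h1 : Jop a (Jop b f) S = Jop a (Jtrunc R C b f) S :=
    band_congr ha _ fun k h1 h2 => Jop_eq_Jtrunc hb f (hS.move h1 h2) hC
  rw [h1, Jop_eq_Jtrunc ha _ hS (C := C) (by have := abs_nonneg b; omega)]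
  rfl

theorem psi_psiStar_commutator (i j k l : ℤ) :
    (psi i * psiStar j * (psi k * psiStar l) - psi k * psiStar l * (psi i * psiStar j) :
      Module.End R (Fock R)) =
    (if k = j then psi i * psiStar l else 0) - (if i = l then psi k * psiStar j else 0) := by
  have e1 : (psi i * psiStar j * (psi k * psiStar l) : Module.End R (Fock R)) =
      (if k = j then psi i * psiStar l else 0) - psi i * psi k * (psiStar j * psiStar l) := by
    rw [mul_assoc, ← mul_assoc (psiStar j), psiStar_mul_psi]
    split_ifs <;> simp only [sub_mul, mul_sub, mul_assoc, one_mul, zero_mul, mul_zero]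
  have e2 : (psi k * psiStar l * (psi i * psiStar j) : Module.End R (Fock R)) =
      (if i = l then psi k * psiStar j else 0) - psi i * psi k * (psiStar j * psiStar l) := by
    have e3 : (psi i * psi k * (psiStar j * psiStar l) : Module.End R (Fock R)) =
        psi k * psi i * (psiStar l * psiStar j) := by
      rw [psi_mul_psi i k, psiStar_mul_psiStar j l]
      exact neg_mul_neg (psi k * psi i : Module.End R (Fock R)) (psiStar l * psiStar j)
    rw [mul_assoc, ← mul_assoc (psiStar l), psiStar_mul_psi, e3]
    split_ifs <;> simp only [sub_mul, mul_sub, mul_assoc, one_mul, zero_mul, mul_zero]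
  rw [e1, e2]
  abel

/-- The two cut-offs cancel in the bulk, so that only terms near the ends of the interval
survive; these produce the central term. -/
theorem Jtrunc_commutator (C a b : ℤ) :
    (Jtrunc R C a * Jtrunc R C b - Jtrunc R C b * Jtrunc R C a : Module.End R (Fock R)) =
      ∑ k ∈ Finset.Icc (-C) C, ((if k - b ∈ Finset.Icc (-C) C then 1 else 0) -
        (if k - a ∈ Finset.Icc (-C) C then 1 else 0) : ℤ) • (psi (k - a - b) * psiStar k) := by
  have e1 : (Jtrunc R C a * Jtrunc R C b - Jtrunc R C b * Jtrunc R C a) =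
      ∑ k ∈ Finset.Icc (-C) C, ∑ l ∈ Finset.Icc (-C) C,
        ((if l - b = k then psi (k - a) * psiStar l else 0) -
          (if k - a = l then psi (l - b) * psiStar k else 0) : Module.End R (Fock R)) := by
    have e2 : (Jtrunc R C b * Jtrunc R C a) = ∑ k ∈ Finset.Icc (-C) C,
        ∑ l ∈ Finset.Icc (-C) C, (psi (l - b) * psiStar l * (psi (k - a) * psiStar k) :
          Module.End R (Fock R)) := by
      rw [Jtrunc, Jtrunc, Finset.sum_mul_sum, Finset.sum_comm]
    rw [e2, Jtrunc, Jtrunc, Finset.sum_mul_sum, ← Finset.sum_sub_distrib]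
    refine Finset.sum_congr rfl fun k _ => ?_
    rw [← Finset.sum_sub_distrib]
    exact Finset.sum_congr rfl fun l _ => psi_psiStar_commutator _ _ _ _
  rw [e1]
  simp only [Finset.sum_sub_distrib, sub_smul]
  congr 1
  · rw [Finset.sum_comm]
    refine Finset.sum_congr rfl fun l _ => ?_
    rw [Finset.sum_ite_eq]
    split_ifs
    · rw [one_smul, sub_right_comm]
    · rw [zero_smul]
  · refine Finset.sum_congr rfl fun k _ => ?_
    rw [Finset.sum_ite_eq]
    split_ifs
    · rw [one_smul]
    · rw [zero_smul]

theorem Jop_commutator_zero (b : ℤ) (f : Fock R) : Jop 0 (Jop b f) = Jop b (Jop 0 f) := by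
  ext S
  rcases eq_or_ne b 0 with rfl | hb
  · rfl
  have h1 : Jop b (Jop 0 f) S = Jop b ((S.charge : R) • f) S :=
    band_congr hb _ fun k h1 h2 => by
      rw [Jop_zero, Maya.charge_move h1 h2]; rfl
  rw [h1, Jop_zero, ← Jlin_apply, ← Jlin_apply, map_smul]
  rfl

theorem Jop_commutator_aux {a b : ℤ} (ha : a ≠ 0) (hb : b ≠ 0) (hab : a + b ≠ 0 ∨ 0 < a)
    (f : Fock R) :
    Jop a (Jop b f) - Jop b (Jop a f) = if a + b = 0 then (a : R) • f else 0 := by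
  ext S
  obtain ⟨B, hB⟩ := S.exists_isBound
  set C := B + |a| + |b| with hC
  have h3 := le_abs_self a
  have h4 := neg_abs_le a
  have h5 := le_abs_self b
  have h6 := neg_abs_le b
  have hB0 := hB.1
  rw [Pi.sub_apply, Jop_Jop_eq_Jtrunc ha hb f hB (C := C) le_rfl,
    Jop_Jop_eq_Jtrunc hb ha f hB (C := C) (by omega), ← Pi.sub_apply, ← LinearMap.sub_apply,
    Jtrunc_commutator, LinearMap.sum_apply, Finset.sum_apply]
  split_ifs with h0
  · obtain rfl : b = -a := by omega
    replace ha : 0 < a := hab.resolve_left fun h => h h0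
    have key : ∀ k ∈ Finset.Icc (-C) C,
        (((if k - -a ∈ Finset.Icc (-C) C then 1 else 0) -
          (if k - a ∈ Finset.Icc (-C) C then 1 else 0) : ℤ) •
            (psi (k - a - -a) * psiStar k : Module.End R (Fock R))) f S =
          if k ∈ Finset.Ico (-C) (-C + a) then f S else 0 := by
      intro k hk
      rw [Finset.mem_Icc] at hk
      rw [show k - a - -a = k by ring, LinearMap.smul_apply, Pi.smul_apply, Module.End.mul_apply]
      by_cases hS : k ∈ S.set
      · have hkB : k < B := by by_contra h; exact hB.2.2 k (by omega) hS
        rw [psi_psiStar_self k f S hS, if_pos (Finset.mem_Icc.2 ⟨by omega, by omega⟩)]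
        by_cases h : k < -C + a
        · rw [if_neg (by rw [Finset.mem_Icc]; omega),
            if_pos (Finset.mem_Ico.2 ⟨hk.1, h⟩), sub_zero, one_smul]
        · rw [if_pos (Finset.mem_Icc.2 ⟨by omega, by omega⟩),
            if_neg (by rw [Finset.mem_Ico]; omega), sub_self, zero_smul]
      · rw [psi_apply_of_notMem hS, smul_zero, if_neg]
        rw [Finset.mem_Ico]
        intro h
        exact hS (hB.2.1 k (by omega))
    rw [Finset.sum_congr rfl key, ← Finset.sum_filter, Finset.sum_const]
    have : (Finset.Icc (-C) C).filter (· ∈ Finset.Ico (-C) (-C + a)) =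
        Finset.Ico (-C) (-C + a) := by
      ext k; simp only [Finset.mem_filter, Finset.mem_Icc, Finset.mem_Ico]; omega
    rw [this, Int.card_Ico, Pi.smul_apply, nsmul_eq_mul, smul_eq_mul]
    congr 1
    rw [show -C + a - -C = a by ring, ← Int.cast_natCast, Int.toNat_of_nonneg ha.le]
  · refine Finset.sum_eq_zero fun k hk => ?_
    rw [LinearMap.smul_apply, Pi.smul_apply, Module.End.mul_apply]
    by_cases hk' : k - a - b ∈ S.set ∧ k ∉ S.set
    · have h1 : k - a - b < B := by by_contra h; exact hB.2.2 _ (by omega) hk'.1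
      have h2 : -B ≤ k := by by_contra h; exact hk'.2 (hB.2.1 _ (by omega))
      rw [if_pos (Finset.mem_Icc.2 ⟨by omega, by omega⟩),
        if_pos (Finset.mem_Icc.2 ⟨by omega, by omega⟩), sub_self, zero_smul]
    · by_cases hS : k - a - b ∈ S.set
      · rw [psi_apply hS, psiStar_apply_of_mem, mul_zero, smul_zero]
        refine Maya.mem_erase.2 ⟨?_, by omega⟩
        by_contra h
        exact hk' ⟨hS, h⟩
      · rw [psi_apply_of_notMem hS, smul_zero]

/-- The Heisenberg relations `[J_a, J_b] = a δ_{a+b,0}`. -/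
theorem Jop_commutator (a b : ℤ) (f : Fock R) :
    Jop a (Jop b f) = Jop b (Jop a f) + if a + b = 0 then (a : R) • f else 0 := by
  rcases eq_or_ne b 0 with rfl | hb
  · rw [Jop_commutator_zero]
    split_ifs with h
    · obtain rfl : a = 0 := by omega
      simp
    · simp
  rcases eq_or_ne a 0 with rfl | ha
  · rw [Jop_commutator_zero, if_neg (by omega), add_zero]
  by_cases hab : a + b ≠ 0 ∨ 0 < a
  · rw [← sub_eq_iff_eq_add', Jop_commutator_aux ha hb hab]
  · obtain rfl : b = -a := by omega
    rw [← sub_eq_iff_eq_add', ← neg_sub, Jop_commutator_aux hb ha (by omega),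
      if_pos (by ring), if_pos (by ring)]
    simp

end Commutator

/-! ### Jacobi–Trudi determinants and Maya diagrams -/

section JacobiTrudi

variable (K : Type*) [Field K] {A : Type*} [CommRing A] [Algebra K A]

/-- The Jacobi–Trudi determinant `det (h_{s_i + 1 + j})` of a sequence of places `s`. -/
def jt (p : ℕ → A) {N : ℕ} (s : Fin N → ℤ) : A :=
  Matrix.det (Matrix.of fun i j : Fin N => hSym K p (s i + 1 + (j : ℤ)))

/-- The sign of the permutation that sorts `s` decreasingly; it vanishes if `s` is not injective. -/
def sgnSeq {N : ℕ} (s : Fin N → ℤ) : ℤ :=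
  ∏ i, ∏ j ∈ Finset.Ioi i, Int.sign (s i - s j)

theorem jt_comp_perm (p : ℕ → A) {N : ℕ} (s : Fin N → ℤ) (σ : Equiv.Perm (Fin N)) :
    jt K p (s ∘ σ) = (Equiv.Perm.sign σ : ℤ) * jt K p s :=
  Matrix.det_permute σ (Matrix.of fun i j : Fin N => hSym K p (s i + 1 + (j : ℤ)))

theorem sgnSeq_comp_perm {N : ℕ} (s : Fin N → ℤ) (σ : Equiv.Perm (Fin N)) :
    sgnSeq (s ∘ σ) = (Equiv.Perm.sign σ : ℤ) * sgnSeq s := by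
  have := Equiv.Perm.prod_Ioi_comp_eq_sign_mul_prod (R := ℤ) σ
    (f := fun i j => Int.sign (s i - s j)) (fun i j => by rw [← Int.sign_neg, neg_sub])
  simpa [sgnSeq] using this

theorem sgnSeq_of_strictAnti {N : ℕ} {s : Fin N → ℤ} (hs : StrictAnti s) : sgnSeq s = 1 :=
  Finset.prod_eq_one fun _ _ => Finset.prod_eq_one fun _ hj =>
    Int.sign_eq_one_of_pos (sub_pos.2 (hs (Finset.mem_Ioi.1 hj)))

/-- The number of places of `s` strictly between `b` and `s_i` measures the change of sign when
`s_i` is replaced by `b`. -/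
theorem sgnSeq_update {N : ℕ} {s : Fin N → ℤ} (hs : Function.Injective s) (i : Fin N) {b : ℤ}
    (hb : ∀ k, s k ≠ b) (hbi : b < s i) :
    sgnSeq (Function.update s i b) =
      sgnSeq s * (-1) ^ (Finset.univ.filter fun k => b < s k ∧ s k < s i).card := by
  set g : Fin N → ℤ := fun k => if b < s k ∧ s k < s i then -1 else 1 with hg
  have hg' : ∀ k, k ≠ i → Int.sign (b - s k) = Int.sign (s i - s k) * g k := by
    intro k hk
    have h1 : s k ≠ s i := fun h => hk (hs h)
    have h2 := hb k
    simp only [hg]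
    split_ifs with h
    · rw [Int.sign_eq_neg_one_of_neg (by omega), Int.sign_eq_one_of_pos (by omega)]; rfl
    · rcases lt_or_gt_of_ne h1 with h3 | h3
      · rw [Int.sign_eq_one_of_pos (by omega), Int.sign_eq_one_of_pos (by omega)]; rfl
      · rw [Int.sign_eq_neg_one_of_neg (by omega), Int.sign_eq_neg_one_of_neg (by omega)]; rfl
  have hpair : ∀ a c : Fin N, a < c → Int.sign (Function.update s i b a - Function.update s i b c) =
      Int.sign (s a - s c) * ((if a = i then g c else 1) * (if c = i then g a else 1)) := by
    intro a c hac
    by_cases ha : a = i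
    · subst ha
      rw [Function.update_self, Function.update_of_ne hac.ne', hg' c hac.ne', if_pos rfl,
        if_neg hac.ne', mul_one]
    · by_cases hc : c = i
      · subst hc
        rw [Function.update_self, Function.update_of_ne ha, if_neg ha, if_pos rfl, one_mul,
          ← neg_sub, Int.sign_neg, hg' a ha, ← neg_sub (s c), Int.sign_neg, neg_mul]
      · rw [Function.update_of_ne ha, Function.update_of_ne hc, if_neg ha, if_neg hc, one_mul,
          mul_one]
  have h1 : sgnSeq (Function.update s i b) = sgnSeq s *
      ∏ a, ∏ c ∈ Finset.Ioi a, ((if a = i then g c else 1) * (if c = i then g a else 1)) := by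
    simp only [sgnSeq, ← Finset.prod_mul_distrib]
    refine Finset.prod_congr rfl fun a _ => Finset.prod_congr rfl fun c hc => ?_
    rw [hpair a c (Finset.mem_Ioi.1 hc)]
  rw [h1]
  congr 1
  simp only [Finset.prod_mul_distrib]
  have h2 : ∏ a, ∏ c ∈ Finset.Ioi a, (if a = i then g c else 1) = ∏ c ∈ Finset.Ioi i, g c := by
    rw [Finset.prod_eq_single i]
    · simp
    · intro a _ ha; simp [ha]
    · simp
  have h3 : ∏ a, ∏ c ∈ Finset.Ioi a, (if c = i then g a else 1) = ∏ a ∈ Finset.Iio i, g a := by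
    simp only [Finset.prod_ite_eq', Finset.mem_Ioi]
    rw [← Finset.prod_filter]
    congr 1
    ext a; simp
  have h4 : Finset.univ.filter (fun k => b < s k ∧ s k < s i) =
      (Finset.Ioi i).filter (fun k => b < s k ∧ s k < s i) ∪
        (Finset.Iio i).filter (fun k => b < s k ∧ s k < s i) := by
    ext k
    simp only [Finset.mem_filter, Finset.mem_univ, true_and, Finset.mem_union, Finset.mem_Ioi,
      Finset.mem_Iio]
    constructor
    · intro h
      rcases lt_trichotomy k i with h' | rfl | h'
      · exact Or.inr ⟨h', h⟩
      · exact absurd h.2 (lt_irrefl _)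
      · exact Or.inl ⟨h', h⟩
    · tauto
  rw [h2, h3, h4, Finset.card_union_of_disjoint, pow_add]
  · simp only [hg, Finset.prod_ite, Finset.prod_const, one_pow, mul_one]
  · rw [Finset.disjoint_left]
    intro k hk hk'
    simp only [Finset.mem_filter, Finset.mem_Ioi, Finset.mem_Iio] at hk hk'
    exact lt_asymm hk.1 hk'.1

/-- Euler's identity for Jacobi–Trudi determinants: each permutation contributes a product of
`h`'s of the same total degree, and Newton's identity lowers one row at a time. -/
theorem euler_jt [CharZero K] (p : ℕ → A) {N : ℕ} (s : Fin N → ℤ) {B : ℕ}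
    (hB : ∀ i, s i + N ≤ B) :
    ((∑ i : Fin N, (s i + 1 + (i : ℤ)) : ℤ) : A) * jt K p s =
      ∑ j ∈ Finset.Icc 1 B, p j * ∑ i, jt K p (Function.update s i (s i - j)) := by
  have h1 : ∀ i, ∑ j ∈ Finset.Icc 1 B, p j * jt K p (Function.update s i (s i - j)) =
      ∑ σ : Equiv.Perm (Fin N), ((Equiv.Perm.sign σ : ℤ) : A) *
        (((s i + 1 + (σ i : ℤ) : ℤ) : A) * ∏ k, hSym K p (s k + 1 + (σ k : ℤ))) := by
    intro i
    have e1 : ∀ j, jt K p (Function.update s i (s i - (j : ℕ))) =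
        ∑ σ : Equiv.Perm (Fin N), ((Equiv.Perm.sign σ : ℤ) : A) *
          (hSym K p (s i + 1 + (σ i : ℤ) - j) *
            ∏ k ∈ Finset.univ.erase i, hSym K p (s k + 1 + (σ k : ℤ))) := by
      intro j
      rw [jt, ← Matrix.det_transpose, Matrix.det_apply']
      refine Finset.sum_congr rfl fun σ _ => ?_
      rw [← Finset.mul_prod_erase _ _ (Finset.mem_univ i)]
      simp only [Matrix.transpose_apply, Matrix.of_apply, Function.update_self]
      congr 2
      · congr 1; ring
      · refine Finset.prod_congr rfl fun k hk => ?_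
        rw [Function.update_of_ne (Finset.ne_of_mem_erase hk)]
    simp only [e1, Finset.mul_sum]
    rw [Finset.sum_comm]
    refine Finset.sum_congr rfl fun σ _ => ?_
    rw [← Finset.mul_prod_erase Finset.univ (fun k => hSym K p (s k + 1 + (σ k : ℤ)))
      (Finset.mem_univ i), ← mul_assoc (((s i + 1 + (σ i : ℤ) : ℤ) : A)),
      intCast_mul_hSym K p (s i + 1 + (σ i : ℤ)) (B := B)
        (by have := hB i; have := (σ i).2; omega), Finset.sum_mul, Finset.mul_sum]
    exact Finset.sum_congr rfl fun j _ => by ring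
  have h2 : ∑ j ∈ Finset.Icc 1 B, p j * ∑ i, jt K p (Function.update s i (s i - j)) =
      ∑ i, ∑ j ∈ Finset.Icc 1 B, p j * jt K p (Function.update s i (s i - j)) := by
    rw [Finset.sum_comm]
    exact Finset.sum_congr rfl fun j _ => Finset.mul_sum _ _ _
  rw [h2]
  simp only [h1]
  rw [Finset.sum_comm, jt, ← Matrix.det_transpose, Matrix.det_apply', Finset.mul_sum]
  refine Finset.sum_congr rfl fun σ _ => ?_
  rw [← Finset.mul_sum, ← Finset.sum_mul, ← Int.cast_sum]
  have h3 : ∑ i : Fin N, (s i + 1 + (i : ℤ)) = ∑ i : Fin N, (s i + 1 + (σ i : ℤ)) := by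
    simp only [Finset.sum_add_distrib]
    rw [Equiv.sum_comp σ (fun i : Fin N => (i : ℤ))]
  rw [h3, mul_left_comm]
  rfl

/-- An empty row at the end does not change the determinant. -/
theorem jt_succ (p : ℕ → A) {N : ℕ} (s : Fin (N + 1) → ℤ) (h : s (Fin.last N) = -(N : ℤ) - 1) :
    jt K p s = jt K p (fun i : Fin N => s i.castSucc) := by
  rw [jt, Matrix.det_succ_row _ (Fin.last N), Finset.sum_eq_single (Fin.last N)]
  · rw [Matrix.of_apply, h, Fin.val_last, show -(N : ℤ) - 1 + 1 + N = 0 by ring, hSym_zero,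
      ← two_mul, pow_mul]
    simp only [neg_one_sq, one_pow, one_mul, Fin.succAbove_last]
    rfl
  · intro j _ hj
    have : (j : ℕ) < N := lt_of_le_of_ne (Nat.lt_succ_iff.1 j.2) fun hj' => hj (Fin.ext hj')
    rw [Matrix.of_apply, h, hSym_neg K p (by omega), mul_zero, zero_mul]
  · intro h; exact absurd (Finset.mem_univ _) h

theorem jt_eq_zero_of_lt (p : ℕ → A) {N : ℕ} {s : Fin N → ℤ} {i : Fin N} (h : s i < -(N : ℤ)) :
    jt K p s = 0 :=
  Matrix.det_eq_zero_of_row_eq_zero i fun j => hSym_neg K p (by omega)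

theorem jt_eq_zero_of_eq (p : ℕ → A) {N : ℕ} {s : Fin N → ℤ} {i k : Fin N} (hik : i ≠ k)
    (h : s i = s k) : jt K p s = 0 :=
  Matrix.det_zero_of_row_eq hik (by ext j; simp [h])

theorem schur_eq_jt (p : ℕ → A) (μ : YoungDiagram) {N : ℕ} (hN : μ.colLen 0 ≤ N) :
    schur K p μ = jt K p (fun i : Fin N => (μ.rowLen i : ℤ) - i - 1) := by
  induction N, hN using Nat.le_induction with
  | base =>
    unfold schur jt
    congr 1
    ext i j
    simp only [Matrix.of_apply]
    congr 1
    ring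
  | succ N hN ih =>
    have h0 : μ.rowLen N = 0 := by
      by_contra h
      have := YoungDiagram.mem_iff_lt_colLen.1
        (YoungDiagram.mem_iff_lt_rowLen.2 (Nat.pos_of_ne_zero h))
      omega
    rw [ih, jt_succ K p _ (by simp [h0])]
    rfl

end JacobiTrudi

/-! ### Partitions and Maya diagrams of charge zero -/

/-- The Maya diagram `{λ_i - i - 1/2 : i ≥ 1}` of a partition. -/
def mayaOf (μ : YoungDiagram) : Maya where
  set := Set.range fun i : ℕ => (μ.rowLen i : ℤ) - i - 1
  finite_pos := by
    refine (Set.finite_Ico (0 : ℤ) (μ.rowLen 0)).subset ?_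
    rintro _ ⟨⟨i, rfl⟩, h⟩
    have h1 := μ.rowLen_anti 0 i (Nat.zero_le i)
    simp only [Set.mem_Ici, Set.mem_Ico] at h ⊢
    omega
  finite_neg := by
    refine (Set.finite_Ico (-(μ.colLen 0 : ℤ)) 0).subset ?_
    rintro k ⟨hk, hk'⟩
    refine ⟨?_, hk⟩
    by_contra h
    apply hk'
    simp only [Set.mem_Iio, not_le] at hk h
    refine ⟨(-k - 1).toNat, ?_⟩
    have h0 : μ.rowLen (-k - 1).toNat = 0 := by
      by_contra h0
      have := YoungDiagram.mem_iff_lt_colLen.1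
        (YoungDiagram.mem_iff_lt_rowLen.2 (Nat.pos_of_ne_zero h0))
      omega
    simp only [h0]
    omega

theorem rowLen_eq_zero {μ : YoungDiagram} {i : ℕ} (h : μ.colLen 0 ≤ i) : μ.rowLen i = 0 := by
  by_contra h0
  have := YoungDiagram.mem_iff_lt_colLen.1
    (YoungDiagram.mem_iff_lt_rowLen.2 (Nat.pos_of_ne_zero h0))
  omega

theorem strictMono_row (μ : YoungDiagram) :
    StrictMono fun i : ℕ => OrderDual.toDual ((μ.rowLen i : ℤ) - i - 1) := by
  refine strictMono_nat_of_lt_succ fun i => OrderDual.toDual_lt_toDual.2 ?_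
  have := μ.rowLen_anti i (i + 1) (Nat.le_succ i)
  push_cast
  omega

theorem mayaOf_injective : Function.Injective mayaOf := by
  intro μ ν h
  have h1 := congrArg Maya.set h
  have h2 : (fun i : ℕ => OrderDual.toDual ((μ.rowLen i : ℤ) - i - 1)) =
      fun i : ℕ => OrderDual.toDual ((ν.rowLen i : ℤ) - i - 1) :=
    ((strictMono_row μ).range_inj (strictMono_row ν)).1 h1
  ext ⟨i, j⟩
  have h3 : (μ.rowLen i : ℤ) - i - 1 = (ν.rowLen i : ℤ) - i - 1 := congrFun h2 i
  rw [YoungDiagram.mem_cells, YoungDiagram.mem_cells, YoungDiagram.mem_iff_lt_rowLen,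
    YoungDiagram.mem_iff_lt_rowLen]
  omega

/-- `s` lists, in any order, the elements of `S` that are at least `-N`, and all places below `-N`
are occupied. -/
structure Maya.IsEnum (S : Maya) {N : ℕ} (s : Fin N → ℤ) : Prop where
  inj : Function.Injective s
  lower : ∀ i, -(N : ℤ) ≤ s i
  mem_iff : ∀ k, k ∈ S.set ↔ k < -(N : ℤ) ∨ k ∈ Set.range s

theorem Maya.isEnum_mayaOf (μ : YoungDiagram) {N : ℕ} (hN : μ.colLen 0 ≤ N) :
    (mayaOf μ).IsEnum (fun i : Fin N => (μ.rowLen i : ℤ) - i - 1) where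
  inj i j h := Fin.ext ((strictMono_row μ).injective h)
  lower i := by have := i.2; omega
  mem_iff k := by
    constructor
    · rintro ⟨i, rfl⟩
      rcases lt_or_ge i N with hi | hi
      · exact Or.inr ⟨⟨i, hi⟩, rfl⟩
      · left; simp only [rowLen_eq_zero (hN.trans hi)]; omega
    · rintro (h | ⟨i, rfl⟩)
      · refine ⟨(-k - 1).toNat, ?_⟩
        simp only [rowLen_eq_zero (μ := μ) (i := (-k - 1).toNat) (by omega)]
        omega
      · exact ⟨i, rfl⟩

theorem Maya.IsEnum.mem {S : Maya} {N : ℕ} {s : Fin N → ℤ} (h : S.IsEnum s) (i : Fin N) :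
    s i ∈ S.set := (h.mem_iff _).2 (Or.inr ⟨i, rfl⟩)

theorem Maya.IsEnum.move {S : Maya} {N : ℕ} {s : Fin N → ℤ} (h : S.IsEnum s) (i : Fin N) {b : ℤ}
    (hb : b ∉ S.set) : (S.move (s i) b).IsEnum (Function.update s i b) := by
  have hbN : -(N : ℤ) ≤ b := by by_contra hn; exact hb ((h.mem_iff b).2 (Or.inl (by omega)))
  have hbs : ∀ k, s k ≠ b := fun k hk => hb (hk ▸ h.mem k)
  refine ⟨fun j k hjk => ?_, fun j => ?_, fun k => ?_⟩
  · by_cases hj : j = i <;> by_cases hk : k = i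
    · rw [hj, hk]
    · subst hj; rw [Function.update_self, Function.update_of_ne hk] at hjk
      exact absurd hjk.symm (hbs k)
    · subst hk; rw [Function.update_self, Function.update_of_ne hj] at hjk
      exact absurd hjk (hbs j)
    · rw [Function.update_of_ne hj, Function.update_of_ne hk] at hjk
      exact h.inj hjk
  · by_cases hj : j = i
    · subst hj; rwa [Function.update_self]
    · rw [Function.update_of_ne hj]; exact h.lower j
  · rw [Maya.mem_move, h.mem_iff]
    constructor
    · rintro (rfl | ⟨hk | ⟨j, rfl⟩, hne⟩)
      · exact Or.inr ⟨i, Function.update_self _ _ _⟩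
      · exact Or.inl hk
      · exact Or.inr ⟨j, Function.update_of_ne (fun hj => hne (by rw [hj])) _ _⟩
    · rintro (hk | ⟨j, rfl⟩)
      · exact Or.inr ⟨Or.inl hk, by have := h.lower i; omega⟩
      · by_cases hj : j = i
        · subst hj; left; exact Function.update_self _ _ _
        · rw [Function.update_of_ne hj]
          exact Or.inr ⟨Or.inr ⟨j, rfl⟩, fun he => hj (h.inj he)⟩

theorem Maya.IsEnum.comp_perm {S : Maya} {N : ℕ} {s : Fin N → ℤ} (h : S.IsEnum s)
    (σ : Equiv.Perm (Fin N)) : S.IsEnum (s ∘ σ) where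
  inj := h.inj.comp σ.injective
  lower i := h.lower _
  mem_iff k := by rw [h.mem_iff, σ.surjective.range_comp]

theorem Maya.IsEnum.exists_sorted {S : Maya} {N : ℕ} {s : Fin N → ℤ} (h : S.IsEnum s) :
    ∃ σ : Equiv.Perm (Fin N), StrictAnti (s ∘ σ) := by
  refine ⟨Tuple.sort fun i => -s i, fun i j hij => ?_⟩
  have h1 := Tuple.monotone_sort (fun i => -s i) hij.le
  have h2 : s (Tuple.sort (fun i => -s i) j) ≠ s (Tuple.sort (fun i => -s i) i) := fun he =>
    hij.ne' ((Tuple.sort fun i => -s i).injective (h.inj he))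
  simp only [Function.comp_apply] at h1 ⊢
  omega

/-- A decreasing enumeration is the sequence `λ_i - i` of a partition. -/
theorem Maya.IsEnum.exists_young {S : Maya} {N : ℕ} {s : Fin N → ℤ} (h : S.IsEnum s)
    (hs : StrictAnti s) : ∃ μ : YoungDiagram, mayaOf μ = S ∧ μ.colLen 0 ≤ N ∧
      s = fun i : Fin N => (μ.rowLen i : ℤ) - i - 1 := by
  have hstep : ∀ d (i : ℕ) (hi : i + d < N),
      s ⟨i + d, hi⟩ + d ≤ s ⟨i, by omega⟩ := by
    intro d
    induction d with
    | zero => intro i hi; simp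
    | succ d ih =>
      intro i hi
      have h1 := ih i (by omega)
      have h2 : s ⟨i + (d + 1), hi⟩ < s ⟨i + d, by omega⟩ := hs (by simp [Fin.lt_def])
      push_cast
      omega
  have hnn : ∀ i (hi : i < N), 0 ≤ s ⟨i, hi⟩ + i + 1 := by
    intro i hi
    have h1 := hstep (N - 1 - i) i (by omega)
    have h2 := h.lower ⟨i + (N - 1 - i), by omega⟩
    omega
  set f : ℕ → ℕ := fun i => if hi : i < N then (s ⟨i, hi⟩ + i + 1).toNat else 0 with hf
  have hanti : ∀ i j, i ≤ j → f j ≤ f i := by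
    intro i j hij
    simp only [hf]
    split_ifs with hj hi
    · obtain ⟨d, rfl⟩ := Nat.exists_eq_add_of_le hij
      have := hstep d i hj
      push_cast
      omega
    · omega
    · omega
    · omega
  let μ : YoungDiagram :=
    { cells := (Finset.range N ×ˢ Finset.range (f 0)).filter fun c => c.2 < f c.1
      isLowerSet := by
        rintro ⟨i2, j2⟩ ⟨i1, j1⟩ ⟨hi : i1 ≤ i2, hj : j1 ≤ j2⟩ hc
        simp only [Finset.coe_filter, Finset.mem_product, Finset.mem_range, Set.mem_ofPred_eq]
          at hc ⊢
        have h1 := hanti i1 i2 hi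
        have h2 := hanti 0 i1 (Nat.zero_le _)
        omega }
  have hmem : ∀ i j, (i, j) ∈ μ ↔ j < f i := by
    intro i j
    rw [← YoungDiagram.mem_cells]
    simp only [μ, Finset.mem_filter, Finset.mem_product, Finset.mem_range]
    refine ⟨fun h => h.2, fun h => ⟨⟨?_, h.trans_le (hanti 0 i (Nat.zero_le _))⟩, h⟩⟩
    by_contra hi
    simp [hf, hi] at h
  have hrow : ∀ i, μ.rowLen i = f i := by
    intro i
    apply le_antisymm
    · by_contra hlt
      have := (hmem i (f i)).1 (YoungDiagram.mem_iff_lt_rowLen.2 (by omega))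
      omega
    · by_contra hlt
      have := YoungDiagram.mem_iff_lt_rowLen.1 ((hmem i (μ.rowLen i)).2 (by omega))
      omega
  have hcol : μ.colLen 0 ≤ N := by
    by_contra hlt
    have := (hmem N 0).1 (YoungDiagram.mem_iff_lt_colLen.2 (by omega))
    simp [hf] at this
  have hseq : s = fun i : Fin N => (μ.rowLen i : ℤ) - i - 1 := by
    funext i
    have h1 := hnn i i.2
    rw [hrow]
    simp only [hf, i.2, dif_pos]
    have h2 : ((s ⟨i, i.2⟩ + i + 1).toNat : ℤ) = s i + i + 1 := Int.toNat_of_nonneg h1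
    simp only [Fin.eta] at h2 ⊢
    omega
  refine ⟨μ, ?_, hcol, hseq⟩
  apply Maya.ext_set
  ext k
  rw [(Maya.isEnum_mayaOf μ hcol).mem_iff, h.mem_iff, hseq]

theorem Maya.IsEnum.occSum_eq {A : Type*} [CommRing A] {S : Maya} {N : ℕ} {s : Fin N → ℤ}
    (h : S.IsEnum s) (φ : ℤ → A) :
    occSum φ S = ∑ i, φ (s i) - ∑ i : Fin N, φ (-(i : ℤ) - 1) := by
  classical
  have e1 : ∑ i, φ (s i) = ∑ k ∈ Finset.univ.image s, φ k :=
    (Finset.sum_image fun i _ j _ hij => h.inj hij).symm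
  have e2 : ∑ i : Fin N, φ (-(i : ℤ) - 1) =
      ∑ k ∈ Finset.univ.image (fun i : Fin N => -(i : ℤ) - 1), φ k :=
    (Finset.sum_image fun i _ j _ hij => by
      exact Fin.ext (by omega)).symm
  have m1 : ∀ k, k ∈ Finset.univ.image s ↔ -(N : ℤ) ≤ k ∧ k ∈ S.set := by
    intro k
    rw [h.mem_iff]
    simp only [Finset.mem_image, Finset.mem_univ, true_and, Set.mem_range]
    constructor
    · rintro ⟨i, rfl⟩; exact ⟨h.lower i, Or.inr ⟨i, rfl⟩⟩
    · rintro ⟨hk, hk' | hk'⟩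
      · omega
      · exact hk'
  have m2 : ∀ k, k ∈ Finset.univ.image (fun i : Fin N => -(i : ℤ) - 1) ↔ -(N : ℤ) ≤ k ∧ k < 0 := by
    intro k
    simp only [Finset.mem_image, Finset.mem_univ, true_and]
    constructor
    · rintro ⟨i, rfl⟩; have := i.2; omega
    · rintro ⟨h1, h2⟩; exact ⟨⟨(-k - 1).toNat, by omega⟩, by simp only; omega⟩
  set T := Finset.univ.image s ∪ Finset.univ.image (fun i : Fin N => -(i : ℤ) - 1) with hT
  have hocc : ∀ k, k ∉ T → occ k S = 0 := by
    intro k hk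
    rw [hT, Finset.mem_union, m1, m2, not_or] at hk
    unfold occ
    by_cases hN : -(N : ℤ) ≤ k
    · have h1 : k ∉ S.set := fun hS => hk.1 ⟨hN, hS⟩
      have h2 : ¬ k < 0 := fun h0 => hk.2 ⟨hN, h0⟩
      simp [h1, h2]
    · have h1 : k ∈ S.set := (h.mem_iff k).2 (Or.inl (by omega))
      simp [h1, show k < 0 by omega]
  have e3 : ∀ U ⊆ T, ∑ k ∈ U, φ k = ∑ k ∈ T, if k ∈ U then φ k else 0 := fun U hU => by
    rw [Finset.sum_ite_mem, Finset.inter_eq_right.2 hU]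
  rw [occSum_eq_sum φ hocc, e1, e2, e3 _ Finset.subset_union_left,
    e3 _ Finset.subset_union_right, ← Finset.sum_sub_distrib]
  refine Finset.sum_congr rfl fun k hk => ?_
  have hN : -(N : ℤ) ≤ k := by
    rcases Finset.mem_union.1 hk with h' | h'
    · exact ((m1 k).1 h').1
    · exact ((m2 k).1 h').1
  unfold occ
  by_cases hS : k ∈ S.set <;> by_cases h0 : k < 0
  · rw [if_pos hS, if_pos h0, if_pos ((m1 k).2 ⟨hN, hS⟩), if_pos ((m2 k).2 ⟨hN, h0⟩)]; simp
  · rw [if_pos hS, if_neg h0, if_pos ((m1 k).2 ⟨hN, hS⟩),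
      if_neg (fun h' => h0 ((m2 k).1 h').2)]; simp
  · rw [if_neg hS, if_pos h0, if_neg (fun h' => hS ((m1 k).1 h').2),
      if_pos ((m2 k).2 ⟨hN, h0⟩)]; simp
  · rw [if_neg hS, if_neg h0, if_neg (fun h' => hS ((m1 k).1 h').2),
      if_neg (fun h' => h0 ((m2 k).1 h').2)]; simp

theorem Maya.IsEnum.charge_eq_zero {S : Maya} {N : ℕ} {s : Fin N → ℤ} (h : S.IsEnum s) :
    S.charge = 0 := by
  rw [Maya.charge, h.occSum_eq]; simp

theorem Maya.IsEnum.energy_eq {S : Maya} {N : ℕ} {s : Fin N → ℤ} (h : S.IsEnum s) :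
    S.energy = ∑ i : Fin N, (s i + 1 + (i : ℤ)) := by
  rw [Maya.energy, h.occSum_eq, ← Finset.sum_sub_distrib]
  exact Finset.sum_congr rfl fun i _ => by ring

theorem Maya.exists_isEnum {S : Maya} (hc : S.charge = 0) :
    ∃ (N : ℕ) (s : Fin N → ℤ), S.IsEnum s := by
  classical
  obtain ⟨B, hB⟩ := S.exists_isBound
  set T := (Finset.Ico (-B) B).filter (· ∈ S.set) with hT
  have h1 : S.charge = ∑ k ∈ Finset.Ico (-B) B, occ k S := by
    refine (occSum_eq_sum (A := ℤ) _ (T := Finset.Ico (-B) B) fun l hl =>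
      hB.occ_eq_zero hl).trans ?_
    exact Finset.sum_congr rfl fun l _ => by rw [mul_one, Int.cast_id]
  have h2 : T.card = B.toNat := by
    have e1 : ∑ k ∈ Finset.Ico (-B) B, (if k ∈ S.set then (1 : ℤ) else 0) = T.card := by
      rw [← Finset.sum_filter]; simp [hT]
    have e2 : ∑ k ∈ Finset.Ico (-B) B, (if k < 0 then (1 : ℤ) else 0) = B := by
      have : (Finset.Ico (-B) B).filter (· < 0) = Finset.Ico (-B) 0 := by
        ext k; have := hB.1; simp only [Finset.mem_filter, Finset.mem_Ico]; omega
      rw [← Finset.sum_filter, this]; simp [hB.1]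
    have e3 : S.charge = T.card - B := by
      calc S.charge = ∑ k ∈ Finset.Ico (-B) B, occ k S := h1
        _ = _ - _ := Finset.sum_sub_distrib _ _
        _ = T.card - B := by rw [e1, e2]
    omega
  refine ⟨B.toNat, fun i => T.orderEmbOfFin h2 i, fun i j hij => (T.orderEmbOfFin h2).injective hij,
    fun i => ?_, fun k => ?_⟩
  · have h3 := T.orderEmbOfFin_mem h2 i
    replace h3 := Finset.mem_Ico.1 (Finset.mem_filter.1 h3).1
    have := hB.1
    omega
  · have h3 : Set.range (fun i => T.orderEmbOfFin h2 i) = T := T.range_orderEmbOfFin h2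
    rw [h3, Finset.mem_coe, hT, Finset.mem_filter, Finset.mem_Ico, Int.toNat_of_nonneg hB.1]
    constructor
    · intro hk
      by_cases hk' : k < -B
      · exact Or.inl hk'
      · refine Or.inr ⟨⟨by omega, ?_⟩, hk⟩
        by_contra hn
        exact hB.2.2 k (by omega) hk
    · rintro (hk | hk)
      · exact hB.2.1 k hk
      · exact hk.2

/-! ### The vectors of Schur functions -/

section Tau

variable (K : Type*) [Field K] {A : Type*} [CommRing A] [Algebra K A]

open Classical in
/-- The vector `∑_λ s_λ(p) v_λ` of the completed Fock space. -/
def tau (p : ℕ → A) : Fock A := fun S =>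
  if h : ∃ μ, mayaOf μ = S then schur K p h.choose else 0

theorem tau_mayaOf (p : ℕ → A) (μ : YoungDiagram) : tau K p (mayaOf μ) = schur K p μ := by
  have h : ∃ ν, mayaOf ν = mayaOf μ := ⟨μ, rfl⟩
  rw [tau, dif_pos h, mayaOf_injective h.choose_spec]

/-- The coordinates of `tau` can be computed from any enumeration of the places, as the
determinant and the sign are both alternating. -/
theorem tau_eq_of_isEnum (p : ℕ → A) {S : Maya} {N : ℕ} {s : Fin N → ℤ} (h : S.IsEnum s) :
    tau K p S = (sgnSeq s : A) * jt K p s := by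
  obtain ⟨σ, hσ⟩ := h.exists_sorted
  obtain ⟨μ, rfl, hμ, hs⟩ := (h.comp_perm σ).exists_young hσ
  have h1 : sgnSeq (s ∘ σ) = 1 := sgnSeq_of_strictAnti hσ
  rw [tau_mayaOf, schur_eq_jt K p μ hμ, ← hs, jt_comp_perm]
  rw [sgnSeq_comp_perm] at h1
  congr 2
  have h2 : ((Equiv.Perm.sign σ : ℤˣ) : ℤ) * (Equiv.Perm.sign σ : ℤˣ) = 1 := by
    rw [← Units.val_mul, Int.units_mul_self]; rfl
  calc ((Equiv.Perm.sign σ : ℤˣ) : ℤ) =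
      (Equiv.Perm.sign σ : ℤˣ) * (((Equiv.Perm.sign σ : ℤˣ) : ℤ) * sgnSeq s) := by
        rw [h1, mul_one]
    _ = sgnSeq s := by rw [← mul_assoc, h2, one_mul]

theorem tau_eq_zero (p : ℕ → A) {S : Maya} (h : S.charge ≠ 0) : tau K p S = 0 := by
  refine dif_neg ?_
  rintro ⟨μ, rfl⟩
  exact h (Maya.isEnum_mayaOf μ le_rfl).charge_eq_zero

theorem Maya.isEnum_vac : Maya.vac.IsEnum (Fin.elim0 : Fin 0 → ℤ) where
  inj i := i.elim0
  lower i := i.elim0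
  mem_iff k := by simp [Maya.vac]

theorem tau_vac (p : ℕ → A) : tau K p Maya.vac = 1 := by
  rw [tau_eq_of_isEnum K p Maya.isEnum_vac]
  simp [sgnSeq, jt]

variable {R : Type*} [CommRing R]

theorem Jop_eq_zero {a : ℤ} (ha : a ≠ 0) {f : Fock R} {S : Maya}
    (h : ∀ k, k - a ∈ S.set → k ∉ S.set → f (S.move (k - a) k) = 0) : Jop a f S = 0 := by
  have h1 : Jop a f S = Jop a 0 S := band_congr ha _ h
  rw [h1, ← Jlin_apply, map_zero]
  rfl

theorem Jop_eq_zero_of_energy_lt {j : ℤ} (hj : 0 < j) (f : Fock R) {S : Maya}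
    (h : S.energy < j) : Jop (-j) f S = 0 :=
  Jop_eq_zero (by omega) fun k h1 h2 => by
    have h3 := Maya.energy_move h1 h2
    have h4 := (S.move (k - -j) k).energy_nonneg
    omega

theorem Jop_neg_of_isEnum {j : ℤ} (hj : 0 < j) (f : Fock R) {S : Maya} {N : ℕ} {s : Fin N → ℤ}
    (h : S.IsEnum s) : Jop (-j) f S = ∑ i, open Classical in
      if s i - j ∈ S.set then 0 else
        (-1) ^ (Finset.univ.filter fun k => s i - j < s k ∧ s k < s i).card *
          f (S.move (s i) (s i - j)) := by
  classical
  have hsub : (Function.support fun k : ℤ => (1 : R) * Ehat (k - -j) k f S) ⊆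
      ↑(Finset.univ.image fun i => s i - j) := by
    intro k hk
    by_contra hT
    apply hk
    have hne : k - -j ≠ k := by omega
    have : ¬ (k - -j ∈ S.set ∧ k ∉ S.set) := by
      rintro ⟨h1, h2⟩
      rcases (h.mem_iff _).1 h1 with h3 | ⟨i, hi⟩
      · exact h2 ((h.mem_iff _).2 (Or.inl (by omega)))
      · exact hT (by simp only [Finset.coe_image, Finset.coe_univ, Set.image_univ]
                     exact ⟨i, by simp only [hi]; omega⟩)
    change (1 : R) * Ehat (k - -j) k f S = 0
    unfold Ehat
    rw [if_neg hne, if_neg this, mul_zero]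
  rw [Jop, band, finsum_eq_sum_of_support_subset _ hsub,
    Finset.sum_image fun i _ k _ hik => h.inj (by simpa using hik)]
  refine Finset.sum_congr rfl fun i _ => ?_
  rw [one_mul, sub_neg_eq_add, sub_add_cancel]
  unfold Ehat
  rw [if_neg (by omega)]
  by_cases hS : s i - j ∈ S.set
  · rw [if_pos hS, if_neg fun h' => h'.2 hS]
  · rw [if_neg hS, if_pos ⟨h.mem i, hS⟩, min_eq_right (by omega), max_eq_left (by omega)]
    congr 2
    have e1 : S.set ∩ Set.Ioo (s i - j) (s i) =
        ↑((Finset.univ.filter fun k => s i - j < s k ∧ s k < s i).image s) := by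
      ext k
      simp only [Set.mem_inter_iff, Set.mem_Ioo, Finset.coe_image, Set.mem_image,
        Finset.coe_filter, Finset.mem_univ, true_and, Set.mem_ofPred_eq]
      constructor
      · rintro ⟨h1, h2, h3⟩
        rcases (h.mem_iff _).1 h1 with h4 | ⟨l, rfl⟩
        · exact absurd ((h.mem_iff _).2 (Or.inl (by omega))) hS
        · exact ⟨l, ⟨h2, h3⟩, rfl⟩
      · rintro ⟨l, ⟨h2, h3⟩, rfl⟩
        exact ⟨h.mem l, h2, h3⟩
    rw [e1, Set.ncard_coe_finset, Finset.card_image_of_injective _ h.inj]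

/-- Moves to an occupied place do not occur in `J_{-j}`; the corresponding determinants have two
equal rows or a zero row, so the sum extends over all places. -/
theorem Jop_neg_tau (p : ℕ → A) {j : ℕ} (hj : 0 < j) {S : Maya} {N : ℕ} {s : Fin N → ℤ}
    (h : S.IsEnum s) : Jop (-(j : ℤ)) (tau K p) S =
      (sgnSeq s : A) * ∑ i, jt K p (Function.update s i (s i - j)) := by
  classical
  rw [Jop_neg_of_isEnum (by omega) _ h, Finset.mul_sum]
  refine Finset.sum_congr rfl fun i _ => ?_
  split_ifs with hS
  · rcases (h.mem_iff _).1 hS with hk | ⟨k, hk⟩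
    · rw [jt_eq_zero_of_lt K p (i := i) (by rwa [Function.update_self]), mul_zero]
    · have hki : k ≠ i := fun e => by subst e; omega
      rw [jt_eq_zero_of_eq K p hki (by
        rw [Function.update_self, Function.update_of_ne hki, hk]), mul_zero]
  · rw [tau_eq_of_isEnum K p (h.move i hS), sgnSeq_update h.inj i (b := s i - j)
      (fun k hk => hS (hk ▸ h.mem k)) (by omega), ← mul_assoc]
    congr 1
    push_cast
    rw [mul_left_comm, ← pow_add, ← two_mul, pow_mul]
    simp

/-- Euler's identity: `|λ| s_λ` is the sum of `p_j` times the signed sum over removals of ribbons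
of length `j`. -/
theorem energy_mul_tau [CharZero K] (p : ℕ → A) (S : Maya) {B : ℕ} (hB : S.energy ≤ B) :
    (S.energy : A) * tau K p S =
      ∑ j ∈ Finset.Icc 1 B, p j * Jop (-(j : ℤ)) (tau K p) S := by
  by_cases hc : S.charge = 0
  · obtain ⟨N, s, h⟩ := Maya.exists_isEnum hc
    set C : ℕ := B + ∑ i, (s i + N).toNat with hC
    have h1 : ∀ i, s i + N ≤ C := by
      intro i
      have := Finset.single_le_sum (f := fun i => (s i + N).toNat)
        (fun _ _ => Nat.zero_le _) (Finset.mem_univ i)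
      omega
    have h2 : ∑ j ∈ Finset.Icc 1 B, p j * Jop (-(j : ℤ)) (tau K p) S =
        ∑ j ∈ Finset.Icc 1 C, p j * Jop (-(j : ℤ)) (tau K p) S := by
      refine Finset.sum_subset (Finset.Icc_subset_Icc_right (by omega)) fun j hj hj' => ?_
      simp only [Finset.mem_Icc] at hj hj'
      rw [Jop_eq_zero_of_energy_lt (by omega) _ (by omega), mul_zero]
    rw [h2, tau_eq_of_isEnum K p h, h.energy_eq, mul_left_comm, euler_jt K p s h1, Finset.mul_sum]
    refine Finset.sum_congr rfl fun j hj => ?_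
    rw [Jop_neg_tau K p (Finset.mem_Icc.1 hj).1 h]
    ring
  · rw [tau_eq_zero K p hc, mul_zero]
    refine (Finset.sum_eq_zero fun j hj => ?_).symm
    have hj1 := (Finset.mem_Icc.1 hj).1
    rw [Jop_eq_zero (by omega) (fun k h1 h2 => tau_eq_zero K p (by
      rwa [Maya.charge_move h1 h2])), mul_zero]

end Tau

/-! ### The pairing with the vectors of Schur functions -/

section Pairing

variable {R : Type*} [CommRing R] {A : Type*} [CommRing A] [Algebra R A]

/-- The finite set of Maya diagrams of given energy. -/
def Maya.ofEnergy (N : ℤ) : Finset Maya := (Maya.finite_energy_eq N).toFinset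

theorem Maya.mem_ofEnergy {N : ℤ} {S : Maya} : S ∈ Maya.ofEnergy N ↔ S.energy = N := by
  simp [Maya.ofEnergy]

open Classical in
theorem Jop_eq_sum_ite {a : ℤ} (ha : a ≠ 0) (f : Fock R) {S : Maya} {B C : ℤ} (hS : S.IsBound B)
    (hC : B + |a| ≤ C) : Jop a f S = ∑ k ∈ Finset.Icc (-C) C,
      if k - a ∈ S.set ∧ k ∉ S.set then
        (-1) ^ (S.set ∩ Set.Ioo (min (k - a) k) (max (k - a) k)).ncard * f (S.move (k - a) k)
      else 0 := by
  rw [Jop, band_eq_sum a _ f hS hC]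
  refine Finset.sum_congr rfl fun k _ => ?_
  rw [one_mul]
  unfold Ehat
  rw [if_neg (by omega)]

/-- `J_{-a}` is adjoint to `J_a`. -/
theorem sum_smul_Jop_neg {a : ℤ} (ha : 0 < a) (N : ℤ) (v : Fock R) (f : Fock A) :
    ∑ S ∈ Maya.ofEnergy N, v S • Jop (-a) f S =
      ∑ S ∈ Maya.ofEnergy (N - a), Jop a v S • f S := by
  classical
  have habs : |a| = a := abs_of_pos ha
  have habs' : |-a| = a := by rw [abs_neg, habs]
  set C := N + 1 + a with hC
  have hL : ∀ S ∈ Maya.ofEnergy N, v S • Jop (-a) f S = ∑ k ∈ Finset.Icc (-C) C,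
      if k - -a ∈ S.set ∧ k ∉ S.set then v S •
        ((-1) ^ (S.set ∩ Set.Ioo (min (k - -a) k) (max (k - -a) k)).ncard *
          f (S.move (k - -a) k)) else 0 := by
    intro S hS
    have hB := S.isBound_energy
    rw [Maya.mem_ofEnergy.1 hS] at hB
    rw [Jop_eq_sum_ite (by omega) f hB (C := C) (by omega), Finset.smul_sum]
    exact Finset.sum_congr rfl fun k _ => by rw [smul_ite, smul_zero]
  have hR : ∀ S ∈ Maya.ofEnergy (N - a), Jop a v S • f S = ∑ k ∈ Finset.Icc (-C) C,
      if k - a ∈ S.set ∧ k ∉ S.set then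
        ((-1) ^ (S.set ∩ Set.Ioo (min (k - a) k) (max (k - a) k)).ncard *
          v (S.move (k - a) k)) • f S else 0 := by
    intro S hS
    have hB := S.isBound_energy
    rw [Maya.mem_ofEnergy.1 hS] at hB
    rw [Jop_eq_sum_ite (by omega) v hB (C := C) (by omega), Finset.sum_smul]
    exact Finset.sum_congr rfl fun k _ => by rw [ite_smul, zero_smul]
  rw [Finset.sum_congr rfl hL, Finset.sum_congr rfl hR, ← Finset.sum_product',
    ← Finset.sum_product', ← Finset.sum_filter, ← Finset.sum_filter]
  refine Finset.sum_nbij' (fun q => (q.1.move (q.2 - -a) q.2, q.2 + a))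
    (fun q => (q.1.move (q.2 - a) q.2, q.2 - a)) ?_ ?_ ?_ ?_ ?_
  · rintro ⟨S, k⟩ hq
    simp only [Finset.mem_filter, Finset.mem_product, Finset.mem_Icc, Maya.mem_ofEnergy] at hq ⊢
    obtain ⟨⟨hS, h1, h2⟩, h3, h4⟩ := hq
    have hB := S.isBound_energy
    have h5 : k - -a < S.energy + 1 := by by_contra hn; exact hB.2.2 _ (by omega) h3
    refine ⟨⟨?_, by omega, by omega⟩, ?_, ?_⟩
    · rw [Maya.energy_move h3 h4, hS]; ring
    · rw [Maya.mem_move]; left; ring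
    · rw [Maya.mem_move]; rintro (h | ⟨-, h⟩)
      · omega
      · exact h (by ring)
  · rintro ⟨S, k⟩ hq
    simp only [Finset.mem_filter, Finset.mem_product, Finset.mem_Icc, Maya.mem_ofEnergy] at hq ⊢
    obtain ⟨⟨hS, h1, h2⟩, h3, h4⟩ := hq
    have hB := S.isBound_energy
    have h5 : -(S.energy + 1) ≤ k := by by_contra hn; exact h4 (hB.2.1 _ (by omega))
    refine ⟨⟨?_, by omega, by omega⟩, ?_, ?_⟩
    · rw [Maya.energy_move h3 h4, hS]; ring
    · rw [Maya.mem_move]; left; ring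
    · rw [Maya.mem_move]; rintro (h | ⟨-, h⟩)
      · omega
      · exact h rfl
  · rintro ⟨S, k⟩ hq
    simp only [Finset.mem_filter] at hq
    have e : k + a - a = k := by ring
    have e' : k - -a = k + a := by ring
    rw [e'] at hq
    simp only [e, e', Maya.move_move hq.2.1 hq.2.2]
  · rintro ⟨S, k⟩ hq
    simp only [Finset.mem_filter] at hq
    have e : k - a - -a = k := by ring
    simp only [e, Maya.move_move hq.2.1 hq.2.2, sub_add_cancel]
  · rintro ⟨S, k⟩ hq
    simp only [Finset.mem_filter] at hq
    have e : k + a - a = k := by ring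
    have e' : k - -a = k + a := by ring
    rw [e'] at hq
    simp only [e, e', Maya.move_move hq.2.1 hq.2.2]
    have hset : (S.move (k + a) k).set ∩ Set.Ioo (min k (k + a)) (max k (k + a)) =
        S.set ∩ Set.Ioo (min (k + a) k) (max (k + a) k) := by
      rw [min_comm k, max_comm k]
      ext l
      simp only [Set.mem_inter_iff, Maya.mem_move, Set.mem_Ioo, min_lt_iff, lt_max_iff]
      constructor
      · rintro ⟨rfl | ⟨h1, -⟩, h2⟩
        · omega
        · exact ⟨h1, h2⟩
      · rintro ⟨h1, h2⟩; exact ⟨Or.inr ⟨h1, by omega⟩, h2⟩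
    rw [hset, mul_smul, Algebra.smul_def, Algebra.smul_def, Algebra.smul_def]
    simp only [map_pow, map_neg, map_one]
    ring

end Pairing

section SchurPair

variable (K : Type*) [Field K] {R : Type*} [CommRing R] {A : Type*} [CommRing A] [Algebra K A]
  [Algebra R A]

/-- The homogeneous part `∑_{|λ| = N} s_λ(p) v_λ` of weight `N` of the bosonic image of the charge
zero part of a vector `v`. -/
def schurPair (p : ℕ → A) (N : ℤ) : Fock R →ₗ[R] A where
  toFun v := ∑ S ∈ Maya.ofEnergy N, v S • tau K p S
  map_add' v w := by simp [add_smul, Finset.sum_add_distrib]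
  map_smul' c v := by simp [mul_smul, Finset.smul_sum]

theorem schurPair_apply (p : ℕ → A) (N : ℤ) (v : Fock R) :
    schurPair K p N v = ∑ S ∈ Maya.ofEnergy N, v S • tau K p S := rfl

/-- The recursion that determines the bosonic image. -/
theorem natCast_mul_schurPair [CharZero K] (p : ℕ → A) (N : ℕ) (v : Fock R) :
    (N : A) * schurPair K p N v =
      ∑ a ∈ Finset.Icc 1 N, p a * schurPair K p ((N : ℤ) - a) (Jop a v) := by
  have h1 : (N : A) * schurPair K p N v = ∑ S ∈ Maya.ofEnergy N,
      ∑ a ∈ Finset.Icc 1 N, p a * (v S • Jop (-(a : ℤ)) (tau K p) S) := by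
    rw [schurPair_apply, Finset.mul_sum]
    refine Finset.sum_congr rfl fun S hS => ?_
    have hE := Maya.mem_ofEnergy.1 hS
    have h2 := energy_mul_tau K p S (B := N) hE.le
    rw [hE, Int.cast_natCast] at h2
    rw [mul_smul_comm, h2, Finset.smul_sum]
    exact Finset.sum_congr rfl fun a _ => (mul_smul_comm _ _ _).symm
  rw [h1, Finset.sum_comm]
  refine Finset.sum_congr rfl fun a ha => ?_
  rw [← Finset.mul_sum, sum_smul_Jop_neg (by have := (Finset.mem_Icc.1 ha).1; omega)]
  rfl

theorem schurPair_of_neg (p : ℕ → A) {N : ℤ} (hN : N < 0) (v : Fock R) :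
    schurPair K p N v = 0 := by
  refine Finset.sum_eq_zero fun S hS => ?_
  have := Maya.mem_ofEnergy.1 hS
  have := S.energy_nonneg
  omega

@[simp]
theorem Maya.energy_vac : Maya.vac.energy = 0 := by simp [Maya.energy]

theorem schurPair_zero (p : ℕ → A) (v : Fock R) :
    schurPair K p 0 v = algebraMap R A (v Maya.vac) := by
  rw [schurPair_apply, Finset.sum_eq_single Maya.vac]
  · rw [tau_vac, Algebra.algebraMap_eq_smul_one]
  · intro S hS hne
    rw [tau_eq_zero K p (fun hc => hne (Maya.eq_vac hc (Maya.mem_ofEnergy.1 hS))), smul_zero]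
  · intro h; exact absurd (Maya.mem_ofEnergy.2 Maya.energy_vac) h

end SchurPair

/-! ### Schur functions at `p_a = q^a - q^{-a}` -/

section Hook

variable (K : Type*) [Field K] [CharZero K] {A : Type*} [CommRing A] [Algebra K A]

/-- The generating function of the `h_n` at `p_a = q^a - q'^a` is `(1 - q' t) / (1 - q t)`. -/
theorem hSym_geometric (q q' : A) (n : ℕ) :
    hSym K (fun a => q ^ a - q' ^ a) ((n + 1 : ℕ) : ℤ) = q ^ n * (q - q') := by
  induction n using Nat.strong_induction_on with
  | _ n ih =>
  refine eq_of_natCast_mul_eq K (Nat.succ_ne_zero n) ?_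
  have h1 := intCast_mul_hSym K (fun a => q ^ a - q' ^ a) ((n + 1 : ℕ) : ℤ) (B := n + 1) le_rfl
  rw [Int.cast_natCast] at h1
  have h2 : ∀ m : ℕ, Finset.Icc 1 (m + 1) = (Finset.range (m + 1)).image (· + 1) := by
    intro m
    ext j
    simp only [Finset.mem_Icc, Finset.mem_image, Finset.mem_range]
    constructor
    · intro h; exact ⟨j - 1, by omega, by omega⟩
    · rintro ⟨i, hi, rfl⟩; omega
  rw [h1, h2, Finset.sum_image (by intro a _ b _ h; simpa using h), Finset.sum_range_succ,
    sub_self, hSym_zero, mul_one]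
  have h3 : ∀ i ∈ Finset.range n, (q ^ (i + 1) - q' ^ (i + 1)) *
      hSym K (fun a => q ^ a - q' ^ a) (((n + 1 : ℕ) : ℤ) - ((i + 1 : ℕ) : ℤ)) =
        q ^ n * (q - q') - (q' ^ (i + 1) * q ^ (n - i) - q' ^ (i + 1 + 1) * q ^ (n - (i + 1))) := by
    intro i hi
    have hi := Finset.mem_range.1 hi
    obtain ⟨d, rfl⟩ : ∃ d, n = i + 1 + d := ⟨n - i - 1, by omega⟩
    have e1 : (((i + 1 + d + 1 : ℕ) : ℤ) - ((i + 1 : ℕ) : ℤ)) = ((d + 1 : ℕ) : ℤ) := by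
      push_cast; ring
    rw [e1, ih d (by omega), show i + 1 + d - i = d + 1 by omega,
      show i + 1 + d - (i + 1) = d by omega]
    ring
  rw [Finset.sum_congr rfl h3, Finset.sum_sub_distrib,
    Finset.sum_range_sub' (fun i => q' ^ (i + 1) * q ^ (n - i))]
  simp only [Finset.sum_const, Finset.card_range, nsmul_eq_mul, zero_add, pow_one, Nat.sub_zero,
    Nat.sub_self, pow_zero, mul_one]
  push_cast
  ring

/-- Row of the Jacobi–Trudi matrix at `p_a = q^a - q'^a`, after subtraction from each column of `q`
times the preceding one. -/
def reducedRow (q q' : A) (k : ℤ) : ℕ → A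
  | 0 => hSym K (fun a => q ^ a - q' ^ a) (k + 1)
  | j + 1 => if k + 1 + j = 0 then -q' else if k + 1 + j = -1 then 1 else 0

theorem jt_eq_det_reducedRow (q q' : A) {N : ℕ} (s : Fin N → ℤ) :
    jt K (fun a => q ^ a - q' ^ a) s =
      Matrix.det (Matrix.of fun i j : Fin N => reducedRow K q q' (s i) j) := by
  cases N with
  | zero => simp [jt]
  | succ N =>
    refine Matrix.det_eq_of_forall_col_eq_smul_add_pred (fun _ => q) (fun i => ?_) (fun i j => ?_)
    · simp only [Matrix.of_apply, Fin.val_zero, reducedRow]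
      simp
    · simp only [Matrix.of_apply, Fin.val_succ, Fin.val_castSucc, reducedRow]
      have e : s i + 1 + ((j + 1 : ℕ) : ℤ) = s i + 1 + j + 1 := by push_cast; ring
      rw [e]
      generalize s i + 1 + (j : ℤ) = n
      rcases lt_trichotomy n 0 with hn | rfl | hn
      · rw [if_neg hn.ne, hSym_neg K _ hn]
        by_cases h1 : n = -1
        · subst h1; simp [hSym_zero]
        · rw [if_neg h1, hSym_neg K _ (by omega)]; simp
      · rw [if_pos rfl, hSym_zero]
        have := hSym_geometric K q q' 0
        simp only [zero_add, Nat.cast_one, pow_zero, one_mul] at this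
        rw [zero_add, this]; ring
      · obtain ⟨m, rfl⟩ : ∃ m : ℕ, n = ((m + 1 : ℕ) : ℤ) := ⟨(n - 1).toNat, by omega⟩
        have e2 : ((m + 1 : ℕ) : ℤ) + 1 = ((m + 1 + 1 : ℕ) : ℤ) := by push_cast; ring
        rw [if_neg hn.ne', if_neg (by omega), e2, hSym_geometric, hSym_geometric]
        ring

/-- Only hooks contribute at `p_a = q^a - q'^a`. -/
theorem jt_eq_zero_of_nonneg (q q' : A) {N : ℕ} {s : Fin N → ℤ} {i k : Fin N} (hik : i ≠ k)
    (hi : 0 ≤ s i) (hk : 0 ≤ s k) : jt K (fun a => q ^ a - q' ^ a) s = 0 := by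
  have hrow : ∀ l : Fin N, 0 ≤ s l → ∀ j : Fin N, (j : ℕ) ≠ 0 → reducedRow K q q' (s l) j = 0 := by
    intro l hl j hj
    obtain ⟨m, hm⟩ := Nat.exists_eq_succ_of_ne_zero hj
    rw [hm]
    simp only [reducedRow]
    rw [if_neg (by omega), if_neg (by omega)]
  rw [jt_eq_det_reducedRow, ← Matrix.det_transpose, Matrix.det_apply']
  refine Finset.sum_eq_zero fun σ _ => ?_
  -- both rows are supported in the first column
  have : ∃ l, 0 ≤ s l ∧ (σ l : ℕ) ≠ 0 := by
    by_contra! hno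
    exact hik (σ.injective (Fin.ext (by rw [hno i hi, hno k hk])))
  obtain ⟨l, hl, hσ⟩ := this
  rw [Finset.prod_eq_zero (Finset.mem_univ l), mul_zero]
  rw [Matrix.transpose_apply, Matrix.of_apply, hrow l hl _ hσ]

/-- The places of the hook with arm `k` and leg `r`. -/
def hookSeq (k r : ℕ) (i : Fin (r + 1)) : ℤ := if (i : ℕ) = 0 then k else -(i : ℤ)

theorem isEnum_hook (k r : ℕ) : (Maya.vac.move (-(r : ℤ) - 1) k).IsEnum (hookSeq k r) where
  inj i j h := by
    unfold hookSeq at h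
    apply Fin.ext
    split_ifs at h <;> omega
  lower i := by
    have := i.2
    unfold hookSeq
    split_ifs <;> push_cast <;> omega
  mem_iff l := by
    have hv : l ∈ Maya.vac.set ↔ l < 0 := Iff.rfl
    rw [Maya.mem_move, hv]
    constructor
    · rintro (rfl | ⟨h1, h2⟩)
      · exact Or.inr ⟨0, by simp [hookSeq]⟩
      · by_cases hl : l < -((r + 1 : ℕ) : ℤ)
        · exact Or.inl hl
        · refine Or.inr ⟨⟨(-l).toNat, by omega⟩, ?_⟩
          unfold hookSeq
          rw [if_neg (by simp only; omega)]
          simp only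
          omega
    · rintro (hl | ⟨i, rfl⟩)
      · right; push_cast at hl; constructor <;> omega
      · have := i.2
        unfold hookSeq
        split_ifs with h
        · exact Or.inl rfl
        · right; constructor <;> omega

theorem strictAnti_hookSeq (k r : ℕ) : StrictAnti (hookSeq k r) := by
  intro i j hij
  have h : (i : ℕ) < j := hij
  unfold hookSeq
  rw [if_neg (show ¬ (j : ℕ) = 0 by omega)]
  split_ifs <;> omega

/-- After the column operations the matrix of a hook is triangular. -/
theorem tau_hook (q q' : A) (k r : ℕ) :
    tau K (fun a => q ^ a - q' ^ a) (Maya.vac.move (-(r : ℤ) - 1) k) =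
      q ^ k * (q - q') * (-q') ^ r := by
  rw [tau_eq_of_isEnum K _ (isEnum_hook k r), sgnSeq_of_strictAnti (strictAnti_hookSeq k r),
    jt_eq_det_reducedRow, Matrix.det_of_isLowerTriangular]
  · rw [Fin.prod_univ_succ, Int.cast_one, one_mul]
    congr 1
    · simp only [Matrix.of_apply, Fin.val_zero, reducedRow, hookSeq, if_true]
      exact hSym_geometric K q q' k
    · have : ∀ i : Fin r, Matrix.of (fun i j : Fin (r + 1) =>
          reducedRow K q q' (hookSeq k r i) j) i.succ i.succ = -q' := by
        intro i
        simp only [Matrix.of_apply, Fin.val_succ, reducedRow, hookSeq]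
        rw [if_neg (Nat.succ_ne_zero _), if_pos (by push_cast; ring)]
      rw [Finset.prod_congr rfl fun i _ => this i]
      simp
  · intro i j hij
    have h : (i : ℕ) < j := hij
    rw [Matrix.of_apply]
    obtain ⟨m, hm⟩ := Nat.exists_eq_succ_of_ne_zero (show (j : ℕ) ≠ 0 by omega)
    rw [hm]
    simp only [reducedRow, hookSeq]
    split_ifs <;> first | rfl | (exfalso; omega)

theorem tau_eq_zero_of_not_hook (q q' : A) {N : ℕ} {S : Maya} (hN : S.energy = N)
    (hpos : 0 < N) (h : ∀ k < N, S ≠ Maya.vac.move ((k : ℤ) - N) k) :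
    tau K (fun a => q ^ a - q' ^ a) S = 0 := by
  by_cases hc : S.charge = 0
  swap; · exact tau_eq_zero K _ hc
  have hvac : S ≠ Maya.vac := fun e => by
    rw [e, Maya.energy_vac] at hN; omega
  obtain ⟨k, hk0, hkS⟩ : ∃ k, 0 ≤ k ∧ k ∈ S.set := by
    by_contra! hno
    exact hvac (Maya.eq_vac_of_occ_nonpos hc fun k => Maya.occ_nonpos (hno k))
  obtain ⟨b, hb0, hbS⟩ : ∃ b < 0, b ∉ S.set := by
    by_contra! hno
    exact hvac (Maya.eq_vac_of_occ_nonneg hc fun k => Maya.occ_nonneg (hno k))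
  -- a single occupied place above the vacuum would make the diagram a hook
  obtain ⟨l, hl0, hlS, hlk⟩ : ∃ l, 0 ≤ l ∧ l ∈ S.set ∧ l ≠ k := by
    by_contra! hno
    have h1 : S.move k b = Maya.vac := by
      refine Maya.eq_vac_of_occ_nonpos (by rw [Maya.charge_move hkS hbS, hc])
        fun l => Maya.occ_nonpos fun hl hlS => ?_
      rcases Maya.mem_move.1 hlS with e | ⟨h2, h3⟩
      · omega
      · exact h3 (hno l hl h2)
    have h2 : S = Maya.vac.move b k := by rw [← h1, Maya.move_move hkS hbS]
    have h3 := Maya.energy_move hkS hbS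
    rw [h1, Maya.energy_vac] at h3
    refine h k.toNat (by omega) ?_
    rw [h2]
    congr 1 <;> omega
  obtain ⟨M, s, hs⟩ := Maya.exists_isEnum hc
  have hidx : ∀ l, 0 ≤ l → l ∈ S.set → ∃ i, s i = l := fun l hl hlS => by
    rcases (hs.mem_iff l).1 hlS with h' | h'
    · omega
    · exact h'
  obtain ⟨i, hi⟩ := hidx k hk0 hkS
  obtain ⟨j, hj⟩ := hidx l hl0 hlS
  rw [tau_eq_of_isEnum K _ hs, jt_eq_zero_of_nonneg K q q' (i := i) (k := j)
    (fun e => hlk (by rw [← hj, ← hi, e])) (by omega) (by omega), mul_zero]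

theorem schurPair_geometric {R : Type*} [CommRing R] [Algebra R A] (q q' : A) {N : ℕ}
    (hN : 0 < N) (v : Fock R) :
    schurPair K (fun a => q ^ a - q' ^ a) N v = ∑ k ∈ Finset.range N,
      v (Maya.vac.move ((k : ℤ) - N) k) • (q ^ k * (q - q') * (-q') ^ (N - 1 - k)) := by
  classical
  have hv : ∀ l : ℤ, l ∈ Maya.vac.set ↔ l < 0 := fun l => Iff.rfl
  have hsub : (Finset.range N).image (fun k : ℕ => Maya.vac.move ((k : ℤ) - N) k) ⊆
      Maya.ofEnergy N := by
    intro S hS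
    obtain ⟨k, hk, rfl⟩ := Finset.mem_image.1 hS
    have hk := Finset.mem_range.1 hk
    rw [Maya.mem_ofEnergy, Maya.energy_move ((hv _).2 (by omega)) (fun h => by
      have := (hv _).1 h; omega), Maya.energy_vac]
    ring
  rw [schurPair_apply, ← Finset.sum_subset hsub, Finset.sum_image]
  · refine Finset.sum_congr rfl fun k hk => ?_
    have hk := Finset.mem_range.1 hk
    have e : (k : ℤ) - N = -((N - 1 - k : ℕ) : ℤ) - 1 := by omega
    rw [e, tau_hook]
  · intro k hk l hl hkl
    have h1 : (k : ℤ) ∈ (Maya.vac.move ((l : ℤ) - N) l).set := by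
      rw [← show Maya.vac.move ((k : ℤ) - N) k = Maya.vac.move ((l : ℤ) - N) l from hkl,
        Maya.mem_move]
      exact Or.inl rfl
    rcases Maya.mem_move.1 h1 with e | ⟨e, -⟩
    · exact_mod_cast e
    · have := (hv _).1 e; omega
  · intro S hS hS'
    rw [tau_eq_zero_of_not_hook K q q' (Maya.mem_ofEnergy.1 hS) hN, smul_zero]
    intro k hk e
    exact hS' (Finset.mem_image.2 ⟨k, Finset.mem_range.2 hk, e.symm⟩)

end Hook

/-! ### The operator `ℰ_0` and the insertion at the first point -/

section Insertion

variable {K : Type*} [Field K]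

theorem hbar_ne_zero : hbar K ≠ 0 := HahnSeries.single_ne_zero one_ne_zero

/-- The action of `K` on Hahn series by coefficients agrees with the one of the algebra
`K → K⟦ħ⟧ → K((ħ))`. -/
theorem laurent_smul_def (a : K) (x : LaurentSeries K) :
    a • x = algebraMap K (LaurentSeries K) a * x := by
  rw [HahnSeries.algebraMap_apply', ← HahnSeries.C_mul_eq_smul]
  simp

theorem expAt_zero : expAt (0 : K) = 1 := by
  ext1 n
  rw [expAt, PowerSeries.coeff_mk, PowerSeries.coeff_one]
  rcases Nat.eq_zero_or_pos n with rfl | hn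
  · simp
  · rw [zero_pow hn.ne', zero_div, zero_smul, if_neg hn.ne']

theorem expAt_add [CharZero K] (a b : K) : expAt (a + b) = expAt a * expAt b := by
  ext1 n
  rw [PowerSeries.coeff_mul]
  simp only [expAt, PowerSeries.coeff_mk]
  have h1 : ∀ q ∈ Finset.HasAntidiagonal.antidiagonal n,
      (a ^ q.1 / (q.1.factorial : K)) • hbar K ^ q.1 *
        (b ^ q.2 / (q.2.factorial : K)) • hbar K ^ q.2 =
      ((n.choose q.1 : K) * (a ^ q.1 * b ^ q.2) / (n.factorial : K)) • hbar K ^ n := by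
    rintro ⟨i, j⟩ hq
    have hq : i + j = n := Finset.HasAntidiagonal.mem_antidiagonal.1 hq
    subst hq
    have f1 : (i.factorial : K) ≠ 0 := Nat.cast_ne_zero.2 (Nat.factorial_ne_zero _)
    have f2 : (j.factorial : K) ≠ 0 := Nat.cast_ne_zero.2 (Nat.factorial_ne_zero _)
    have f3 : ((i + j).factorial : K) ≠ 0 := Nat.cast_ne_zero.2 (Nat.factorial_ne_zero _)
    have f4 : ((i + j).choose i : K) * (i.factorial * j.factorial) = (i + j).factorial := by
      have := Nat.choose_mul_factorial_mul_factorial (Nat.le_add_right i j)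
      rw [Nat.add_sub_cancel_left, mul_assoc] at this
      exact_mod_cast this
    rw [laurent_smul_def, laurent_smul_def, laurent_smul_def, mul_mul_mul_comm, ← pow_add,
      ← map_mul]
    congr 2
    rw [div_mul_div_comm, div_eq_div_iff (mul_ne_zero f1 f2) f3, ← f4]
    ring
  rw [Finset.sum_congr rfl h1, ← Finset.sum_smul, ← Finset.sum_div, (Commute.all a b).add_pow']
  congr 2
  exact Finset.sum_congr rfl fun q _ => nsmul_eq_mul _ _

theorem expAt_natCast_mul [CharZero K] (n : ℕ) (a : K) : expAt (n * a) = expAt a ^ n := by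
  induction n with
  | zero => simp [expAt_zero]
  | succ n ih => rw [Nat.cast_succ, add_mul, one_mul, expAt_add, ih, pow_succ]

/-- `a · uħ𝒮(a uħ) = e^{a uħ/2} - e^{-a uħ/2}`. -/
theorem natCast_mul_uh_mul_sAt [CharZero K] (a : ℕ) :
    (a : Scal K) * (uh K * sAt (a : K)) = expAt (1 / 2 : K) ^ a - expAt (-(1 / 2) : K) ^ a := by
  rw [← expAt_natCast_mul, ← expAt_natCast_mul]
  ext1 n
  have hC : (a : Scal K) = PowerSeries.C (a : LaurentSeries K) := (map_natCast _ a).symm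
  rw [uh, hC, mul_assoc (PowerSeries.C _), PowerSeries.coeff_C_mul, PowerSeries.coeff_C_mul,
    map_sub]
  simp only [expAt, PowerSeries.coeff_mk]
  cases n with
  | zero => simp
  | succ n =>
    rw [PowerSeries.coeff_succ_X_mul, sAt, PowerSeries.coeff_mk, ← sub_smul, pow_succ' (hbar K)]
    have h1 := congrArg (PowerSeries.coeff (n + 1)) (X_mul_sSeries K)
    rw [PowerSeries.coeff_succ_X_mul, map_sub, PowerSeries.coeff_mk, PowerSeries.coeff_mk] at h1
    have h2 : (((a : K) * (1 / 2)) ^ (n + 1) / ((n + 1).factorial : K) -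
        ((a : K) * -(1 / 2)) ^ (n + 1) / ((n + 1).factorial : K)) =
        (a : K) * (PowerSeries.coeff n (sSeries K) * (a : K) ^ n) := by
      rw [h1, mul_pow, mul_pow, neg_div]
      ring
    rw [h2, laurent_smul_def, laurent_smul_def, map_mul (algebraMap K (LaurentSeries K)) (a : K),
      map_natCast]
    ring

theorem E0_apply (v : Fock (Scal K)) (S : Maya) :
    E0 K v S = occSum (fun k : ℤ => expAt ((k : K) + 1 / 2)) S * v S := by
  have hfin : (Function.support fun k : ℤ =>
      (occ k S : Scal K) * expAt ((k : K) + 1 / 2)).Finite := by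
    obtain ⟨B, hB⟩ := S.exists_isBound
    refine (Finset.Ico (-B) B).finite_toSet.subset fun k hk => ?_
    by_contra hn
    exact hk (by simp [hB.occ_eq_zero (k := k) (by simpa using hn)])
  rw [E0, band, occSum, finsum_mul' _ _ hfin]
  refine finsum_congr fun k => ?_
  unfold Ehat
  rw [if_pos (sub_zero k), sub_zero]
  ring

/-- The value of `J_N ℰ_0` at the vacuum is a signed sum over hooks. -/
theorem Jop_E0_vac (N : ℕ) (hN : 0 < N) (v : Fock (Scal K)) :
    Jop N (E0 K v) Maya.vac = ∑ k ∈ Finset.range N, (-1) ^ (N - 1 - k) *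
      ((expAt ((k : K) + 1 / 2) - expAt ((k : K) - N + 1 / 2)) *
        v (Maya.vac.move ((k : ℤ) - N) k)) := by
  classical
  have hv : ∀ l : ℤ, l ∈ Maya.vac.set ↔ l < 0 := fun l => Iff.rfl
  have hB : Maya.vac.IsBound 0 := ⟨le_rfl, fun k hk => by rw [hv]; omega,
    fun k hk => by rw [hv]; omega⟩
  rw [Jop_eq_sum_ite (by omega) _ hB (C := N) (by simp), ← Finset.sum_filter]
  symm
  refine Finset.sum_bij (fun k _ => (k : ℤ)) ?_ ?_ ?_ ?_
  · intro k hk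
    have := Finset.mem_range.1 hk
    simp only [Finset.mem_filter, Finset.mem_Icc, hv]
    omega
  · intro k _ l _ h; exact_mod_cast h
  · intro k hk
    simp only [Finset.mem_filter, Finset.mem_Icc, hv] at hk
    exact ⟨k.toNat, Finset.mem_range.2 (by omega), by omega⟩
  · intro k hk
    have hk := Finset.mem_range.1 hk
    have h1 : Maya.vac.set ∩ Set.Ioo (min ((k : ℤ) - N) k) (max ((k : ℤ) - N) k) =
        ↑(Finset.Ioo ((k : ℤ) - N) 0) := by
      ext l
      rw [Set.mem_inter_iff, hv, min_eq_left (by omega), max_eq_right (by omega), Set.mem_Ioo,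
        Finset.mem_coe, Finset.mem_Ioo]
      omega
    rw [h1, Set.ncard_coe_finset, Int.card_Ioo, E0_apply,
      occSum_move _ ((hv _).2 (by omega)) (fun h => by have := (hv _).1 h; omega), occSum_vac]
    congr 1
    · congr 1; omega
    · push_cast; ring

/-- The value of `J_N ℰ_0` at the vacuum and the specialization of the bosonic image at
`p_a = q^a - q^{-a}`, `q = e^{uħ/2}`, are both sums over the hooks of size `N`, with proportional
coefficients. -/
theorem Jop_E0_vac_eq_schurPair [CharZero K] (N : ℕ) (hN : 0 < N) (v : Fock (Scal K)) :
    (expAt (1 / 2 : K) - expAt (-(1 / 2) : K)) * Jop N (E0 K v) Maya.vac =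
      (expAt (1 / 2 : K) ^ N - expAt (-(1 / 2) : K) ^ N) *
        schurPair K (fun a => expAt (1 / 2 : K) ^ a - expAt (-(1 / 2) : K) ^ a) N v := by
  rw [Jop_E0_vac N hN, schurPair_geometric K _ _ hN, Finset.mul_sum, Finset.mul_sum]
  refine Finset.sum_congr rfl fun k hk => ?_
  obtain ⟨r, rfl⟩ : ∃ r, N = k + 1 + r := ⟨N - k - 1, by have := Finset.mem_range.1 hk; omega⟩
  have e1 : expAt ((k : K) + 1 / 2) = expAt (1 / 2 : K) ^ (2 * k + 1) := by
    rw [← expAt_natCast_mul]; congr 1; push_cast; ring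
  have e2 : expAt ((k : K) - ((k + 1 + r : ℕ) : K) + 1 / 2) =
      expAt (-(1 / 2) : K) ^ (2 * r + 1) := by
    rw [← expAt_natCast_mul]; congr 1; push_cast; ring
  have hq : expAt (1 / 2 : K) * expAt (-(1 / 2) : K) = 1 := by
    rw [← expAt_add, add_neg_cancel, expAt_zero]
  rw [e1, e2, show k + 1 + r - 1 - k = r by omega, smul_eq_mul, neg_pow (expAt (-(1 / 2) : K))]
  generalize expAt (1 / 2 : K) = q at *
  generalize expAt (-(1 / 2) : K) = q' at *
  have h1 : q ^ r * q' ^ r = 1 := by rw [← mul_pow, hq, one_pow]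
  have h2 : q ^ k * q' ^ k = 1 := by rw [← mul_pow, hq, one_pow]
  have h3 : (q ^ (k + 1 + r) - q' ^ (k + 1 + r)) * q ^ k * q' ^ r =
      q ^ (2 * k + 1) - q' ^ (2 * r + 1) := by
    linear_combination q ^ (2 * k + 1) * h1 - q' ^ (2 * r + 1) * h2
  linear_combination
    (-(q - q') * (-1) ^ r * v (Maya.vac.move ((k : ℤ) - ((k + 1 + r : ℕ) : ℤ)) k)) * h3

theorem constantCoeff_sAt (a : K) : PowerSeries.constantCoeff (sAt a) = 1 := by
  rw [← PowerSeries.coeff_zero_eq_constantCoeff_apply, sAt, PowerSeries.coeff_mk, sSeries,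
    PowerSeries.coeff_mk]
  simp

/-- The vacuum value of the insertion is a specialization of the bosonic image. -/
theorem insertion_vac [CharZero K] (N : ℕ) (hN : 0 < N) (v : Fock (Scal K)) :
    insertion K N v Maya.vac = sAt (N : K) * PowerSeries.C (hbar K)⁻¹ * (sAt (1 : K))⁻¹ *
      schurPair K (fun a : ℕ => (a : Scal K) * (uh K * sAt (a : K))) N v := by
  have h1 := Jop_E0_vac_eq_schurPair N hN v
  have h2 := natCast_mul_uh_mul_sAt (K := K) 1
  rw [pow_one, pow_one, Nat.cast_one, Nat.cast_one, one_mul] at h2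
  rw [← h2, ← natCast_mul_uh_mul_sAt N] at h1
  simp only [← natCast_mul_uh_mul_sAt] at h1
  have huh : uh K ≠ 0 := mul_ne_zero (by
    rw [Ne, map_eq_zero_iff _ PowerSeries.C_injective]; exact hbar_ne_zero) PowerSeries.X_ne_zero
  have hs : sAt (1 : K) * (sAt (1 : K))⁻¹ = 1 :=
    PowerSeries.mul_inv_cancel _ (by rw [constantCoeff_sAt]; exact one_ne_zero)
  have h3 : sAt (1 : K) * Jop N (E0 K v) Maya.vac = N * (sAt (N : K) *
      schurPair K (fun a : ℕ => (a : Scal K) * (uh K * sAt (a : K))) N v) :=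
    mul_left_cancel₀ huh (by linear_combination h1)
  have h4 : Jop N (E0 K v) Maya.vac = N * ((sAt (1 : K))⁻¹ * sAt (N : K) *
      schurPair K (fun a : ℕ => (a : Scal K) * (uh K * sAt (a : K))) N v) := by
    linear_combination (sAt (1 : K))⁻¹ * h3 - (Jop N (E0 K v) Maya.vac) * hs
  refine eq_of_natCast_mul_eq K hN.ne' ?_
  unfold insertion
  have h5 : (N : Scal K) = algebraMap K (Scal K) N := (map_natCast _ _).symm
  have h6 : algebraMap K (Scal K) N * algebraMap K (Scal K) (((N : ℤ) : K)⁻¹) = 1 := by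
    rw [← map_mul, Int.cast_natCast, mul_inv_cancel₀ (Nat.cast_ne_zero.2 hN.ne'), map_one]
  rw [if_neg (by omega), Algebra.smul_def, h4, h5]
  linear_combination (PowerSeries.C (hbar K)⁻¹ * algebraMap K (Scal K) N *
    ((sAt (1 : K))⁻¹ * sAt (N : K) *
      schurPair K (fun a : ℕ => (a : Scal K) * (uh K * sAt (a : K))) N v)) * h6

end Insertion

/-! ### Creation operators and their exponentials -/

section Lowering

variable {R : Type*} [CommRing R]

/-- An operator on the completed Fock space is lowering if its value at a Maya diagram depends only
on the values of the vector at diagrams of smaller energy. -/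
def IsLowering (L : Module.End R (Fock R)) : Prop :=
  ∀ (f : Fock R) (S : Maya), (∀ T : Maya, T.energy < S.energy → f T = 0) → L f S = 0

theorem isLowering_Jlin {j : ℕ} (hj : 0 < j) : IsLowering (Jlin (R := R) (-(j : ℤ))) := by
  intro f S h
  refine Jop_eq_zero (by omega) fun k h1 h2 => h _ ?_
  rw [Maya.energy_move h1 h2]
  omega

theorem IsLowering.neg {L : Module.End R (Fock R)} (hL : IsLowering L) : IsLowering (-L) := by
  intro f S h
  rw [LinearMap.neg_apply, Pi.neg_apply, hL f S h, neg_zero]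

theorem IsLowering.congr {L : Module.End R (Fock R)} (hL : IsLowering L) {f g : Fock R} {S : Maya}
    (h : ∀ T : Maya, T.energy < S.energy → f T = g T) : L f S = L g S := by
  rw [← sub_eq_zero, ← Pi.sub_apply, ← map_sub]
  exact hL _ _ fun T hT => by rw [Pi.sub_apply, h T hT, sub_self]

theorem IsLowering.pow_congr {L : Module.End R (Fock R)} (hL : IsLowering L) (p : ℕ) :
    ∀ {f g : Fock R} {S : Maya}, (∀ T : Maya, T.energy ≤ S.energy → f T = g T) →
      (L ^ p) f S = (L ^ p) g S := by
  induction p with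
  | zero => intro f g S h; exact h S le_rfl
  | succ p ih =>
    intro f g S h
    rw [pow_succ', Module.End.mul_apply, Module.End.mul_apply]
    exact hL.congr fun T hT => ih fun U hU => h U (hU.trans hT.le)

/-- Powers of a lowering operator vanish at diagrams of small energy, so that its exponential is
a finite sum at each diagram. -/
theorem IsLowering.pow_eq_zero {L : Module.End R (Fock R)} (hL : IsLowering L) {p : ℕ} :
    ∀ {S : Maya}, S.energy < p → ∀ f : Fock R, (L ^ p) f S = 0 := by
  induction p with
  | zero => intro S h; have := S.energy_nonneg; push_cast at h; omega
  | succ p ih =>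
    intro S h f
    rw [pow_succ', Module.End.mul_apply]
    exact hL _ _ fun T hT => ih (by push_cast at h; omega) f

theorem sum_apply_fock {ι : Type*} (s : Finset ι) (F : ι → Fock R) (S : Maya) :
    (∑ i ∈ s, F i) S = ∑ i ∈ s, F i S := Finset.sum_apply _ _ _

/-- The operator `∑_{j ≥ 1} b_j J_{-j}`. -/
def raising (b : ℕ → R) : Module.End R (Fock R) where
  toFun f := fun S => ∑ j ∈ Finset.Icc 1 S.energy.toNat, b j * Jlin (-(j : ℤ)) f S
  map_add' f g := by
    ext S
    simp only [map_add, Pi.add_apply, mul_add, Finset.sum_add_distrib]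
  map_smul' c f := by
    ext S
    simp only [map_smul, Pi.smul_apply, smul_eq_mul, Finset.mul_sum, RingHom.id_apply,
      mul_left_comm]

theorem raising_apply (b : ℕ → R) (f : Fock R) {S : Maya} {B : ℕ} (hB : S.energy ≤ B) :
    raising b f S = ∑ j ∈ Finset.Icc 1 B, b j * Jlin (-(j : ℤ)) f S := by
  refine Finset.sum_subset (f := fun j : ℕ => b j * Jlin (-(j : ℤ)) f S)
    (Finset.Icc_subset_Icc_right (by omega)) fun j hj hj' => ?_
  rw [Finset.mem_Icc] at hj hj'
  rw [Jlin_apply, Jop_eq_zero_of_energy_lt (by omega) f (by omega), mul_zero]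

theorem isLowering_raising (b : ℕ → R) : IsLowering (raising b) := by
  intro f S h
  rw [raising_apply b f (Int.self_le_toNat _)]
  refine Finset.sum_eq_zero fun j hj => ?_
  rw [isLowering_Jlin (Finset.mem_Icc.1 hj).1 f S h, mul_zero]

theorem raising_raising_apply (b b' : ℕ → R) (f : Fock R) {S : Maya} {B : ℕ} (hB : S.energy ≤ B) :
    raising b (raising b' f) S = ∑ i ∈ Finset.Icc 1 B, ∑ j ∈ Finset.Icc 1 B,
      b i * (b' j * Jlin (-(i : ℤ)) (Jlin (-(j : ℤ)) f) S) := by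
  rw [raising_apply b _ hB]
  refine Finset.sum_congr rfl fun i hi => ?_
  have h1 : Jlin (-(i : ℤ)) (raising b' f) S =
      Jlin (-(i : ℤ)) (∑ j ∈ Finset.Icc 1 B, b' j • Jlin (-(j : ℤ)) f) S := by
    refine (isLowering_Jlin (Finset.mem_Icc.1 hi).1).congr fun T hT => ?_
    rw [raising_apply b' f (B := B) (by omega), sum_apply_fock]
    rfl
  rw [h1, map_sum, sum_apply_fock, Finset.mul_sum]
  refine Finset.sum_congr rfl fun j _ => ?_
  rw [map_smul, Pi.smul_apply, smul_eq_mul]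

theorem commute_raising (b b' : ℕ → R) : Commute (raising b) (raising b') := by
  refine LinearMap.ext fun f => funext fun S => ?_
  have hB : S.energy ≤ (S.energy.toNat : ℤ) := Int.self_le_toNat _
  rw [Module.End.mul_apply, Module.End.mul_apply, raising_raising_apply b b' f hB,
    raising_raising_apply b' b f hB, Finset.sum_comm]
  refine Finset.sum_congr rfl fun i hi => Finset.sum_congr rfl fun j hj => ?_
  rw [Finset.mem_Icc] at hi hj
  have := Jop_commutator (-(j : ℤ)) (-(i : ℤ)) f
  rw [if_neg (by omega), add_zero] at this
  simp only [Jlin_apply, this]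
  ring

/-- Multiplication by the energy. -/
def energyOp : Module.End R (Fock R) where
  toFun f := fun S => (S.energy : R) * f S
  map_add' f g := by ext S; simp [mul_add]
  map_smul' c f := by ext S; simp [mul_left_comm]

theorem energyOp_apply (f : Fock R) (S : Maya) : energyOp f S = (S.energy : R) * f S := rfl

theorem energyOp_Jlin {j : ℕ} (hj : 0 < j) (f : Fock R) (S : Maya) :
    energyOp (Jlin (-(j : ℤ)) f) S =
      Jlin (-(j : ℤ)) (energyOp f) S + j * Jlin (-(j : ℤ)) f S := by
  have h1 : Jlin (-(j : ℤ)) (energyOp f) S =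
      Jlin (-(j : ℤ)) (((S.energy : R) - j) • f) S := by
    refine band_congr (by omega) _ fun k hk hk' => ?_
    rw [energyOp_apply, Maya.energy_move hk hk', Pi.smul_apply, smul_eq_mul]
    push_cast
    ring
  rw [h1, map_smul, Pi.smul_apply, energyOp_apply, smul_eq_mul]
  ring

/-- The commutator of the energy with `∑ b_j J_{-j}` is `∑ j b_j J_{-j}`. -/
theorem energyOp_raising (b : ℕ → R) : energyOp * raising b =
    raising b * energyOp + raising fun j => j * b j := by
  refine LinearMap.ext fun f => funext fun S => ?_
  have hB : S.energy ≤ (S.energy.toNat : ℤ) := Int.self_le_toNat _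
  rw [Module.End.mul_apply, LinearMap.add_apply, Module.End.mul_apply, Pi.add_apply,
    energyOp_apply, raising_apply b _ hB, raising_apply _ _ hB, raising_apply _ _ hB,
    ← Finset.sum_add_distrib, Finset.mul_sum]
  refine Finset.sum_congr rfl fun j hj => ?_
  have := energyOp_Jlin (Finset.mem_Icc.1 hj).1 f S
  rw [energyOp_apply] at this
  rw [mul_left_comm, this]
  ring

theorem energyOp_raising_pow (b : ℕ → R) (p : ℕ) : energyOp * raising b ^ (p + 1) =
    raising b ^ (p + 1) * energyOp +
      (p + 1) • ((raising fun j => j * b j) * raising b ^ p) := by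
  have hc : Commute (raising fun j => j * b j) (raising b) := commute_raising _ _
  induction p with
  | zero => simpa using energyOp_raising b
  | succ p ih =>
    rw [pow_succ _ (p + 1), ← mul_assoc, ih, add_mul, mul_assoc, energyOp_raising, mul_add,
      ← mul_assoc, add_assoc]
    congr 1
    rw [← (hc.pow_right (p + 1)).eq, smul_mul_assoc, mul_assoc, ← pow_succ, ← succ_nsmul']

end Lowering

section ExpOp

variable {K : Type*} [Field K]

theorem expOp_apply {L : Module.End (Scal K) (Fock (Scal K))} (hL : IsLowering L)
    (f : Fock (Scal K)) {S : Maya} {N : ℕ} (hN : S.energy < N) :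
    expOp (⇑L) f S =
      ∑ p ∈ Finset.range N, algebraMap K (Scal K) (p.factorial : K)⁻¹ * (L ^ p) f S := by
  have h : ∀ p, (⇑L)^[p] f = (L ^ p) f := fun p => (Module.End.pow_apply L p f).symm
  simp only [expOp, h, Algebra.smul_def]
  refine finsum_eq_sum_of_support_subset _ fun p hp => ?_
  by_contra hn
  have hn' : N ≤ p := by simpa using hn
  have hz : (L ^ p) f S = 0 := hL.pow_eq_zero (by omega) f
  exact hp (by simp only [hz, mul_zero])

theorem expOp_vac {L : Module.End (Scal K) (Fock (Scal K))} (hL : IsLowering L)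
    (f : Fock (Scal K)) : expOp (⇑L) f Maya.vac = f Maya.vac := by
  rw [expOp_apply hL f (N := 1) (by simp), Finset.sum_range_one, Nat.factorial_zero, Nat.cast_one,
    inv_one, map_one, one_mul, pow_zero, Module.End.one_apply]

theorem pow_expOp_apply {L L' : Module.End (Scal K) (Fock (Scal K))} (hL : IsLowering L)
    (hL' : IsLowering L') (f : Fock (Scal K)) {S : Maya} {N : ℕ} (hN : S.energy < N) (p : ℕ) :
    (L' ^ p) (expOp (⇑L) f) S = ∑ q ∈ Finset.range N,
      algebraMap K (Scal K) (q.factorial : K)⁻¹ * (L' ^ p) ((L ^ q) f) S := by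
  have h1 : (L' ^ p) (expOp (⇑L) f) S = (L' ^ p) (∑ q ∈ Finset.range N,
      (algebraMap K (Scal K) (q.factorial : K)⁻¹) • (L ^ q) f) S := by
    refine hL'.pow_congr p fun T hT => ?_
    rw [expOp_apply hL f (N := N) (by omega), sum_apply_fock]
    exact Finset.sum_congr rfl fun q _ => rfl
  rw [h1, map_sum, sum_apply_fock]
  refine Finset.sum_congr rfl fun q _ => ?_
  rw [map_smul, Pi.smul_apply, smul_eq_mul]

/-- The binomial theorem for the exponential of a lowering operator. -/
theorem expOp_expOp_neg [CharZero K] {L : Module.End (Scal K) (Fock (Scal K))} (hL : IsLowering L)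
    (f : Fock (Scal K)) : expOp (⇑L) (expOp (⇑(-L)) f) = f := by
  funext S
  have hN : S.energy < ((S.energy.toNat + 1 : ℕ) : ℤ) := by
    have := Int.self_le_toNat S.energy; push_cast; omega
  set N := S.energy.toNat + 1 with hN'
  have hz : ∀ p q, N ≤ p + q → (L ^ (p + q)) f S = 0 := fun p q h =>
    hL.pow_eq_zero (by omega) f
  have h1 : expOp (⇑L) (expOp (⇑(-L)) f) S = ∑ p ∈ Finset.range N, ∑ q ∈ Finset.range (N - p),
      algebraMap K (Scal K) ((p.factorial : K)⁻¹ * ((-1) ^ q * (q.factorial : K)⁻¹)) *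
        (L ^ (p + q)) f S := by
    rw [expOp_apply hL _ hN]
    refine Finset.sum_congr rfl fun p hp => ?_
    rw [pow_expOp_apply hL.neg hL f hN, Finset.mul_sum]
    symm
    refine (Finset.sum_subset (Finset.range_mono (Nat.sub_le N p)) fun q _ hq => ?_).trans ?_
    · rw [hz p q (by simp at hq; omega), mul_zero]
    · refine Finset.sum_congr rfl fun q _ => ?_
      have h2 : (-L) ^ q = (algebraMap K (Scal K) ((-1) ^ q)) • L ^ q := by
        rw [neg_pow L, map_pow, map_neg, map_one]
        rcases Nat.even_or_odd q with h | h
        · rw [h.neg_one_pow, h.neg_one_pow, one_smul, one_mul]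
        · rw [h.neg_one_pow, h.neg_one_pow, neg_one_mul]
          exact (neg_one_smul (Scal K) (L ^ q)).symm
      rw [h2, LinearMap.smul_apply, map_smul, Pi.smul_apply, smul_eq_mul,
        ← Module.End.mul_apply, ← pow_add, map_mul, map_mul]
      ring
  rw [h1, ← Finset.sum_range_diag_flip N (fun p q => algebraMap K (Scal K) ((p.factorial : K)⁻¹ *
    ((-1) ^ q * (q.factorial : K)⁻¹)) * (L ^ (p + q)) f S)]
  have h3 : ∀ m ∈ Finset.range N, (∑ k ∈ Finset.range (m + 1),
      algebraMap K (Scal K) ((k.factorial : K)⁻¹ * ((-1) ^ (m - k) * ((m - k).factorial : K)⁻¹)) *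
        (L ^ (k + (m - k))) f S) = if m = 0 then f S else 0 := by
    intro m _
    have h4 : ∀ k ∈ Finset.range (m + 1), algebraMap K (Scal K) ((k.factorial : K)⁻¹ *
        ((-1) ^ (m - k) * ((m - k).factorial : K)⁻¹)) * (L ^ (k + (m - k))) f S =
        algebraMap K (Scal K) ((m.factorial : K)⁻¹ *
          (1 ^ k * (-1) ^ (m - k) * (m.choose k : K))) * (L ^ m) f S := by
      intro k hk
      have hk' : k ≤ m := by simpa [Nat.lt_succ_iff] using hk
      rw [Nat.add_sub_cancel' hk', Nat.cast_choose K hk', one_pow]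
      congr 2
      have f1 : (m.factorial : K) ≠ 0 := Nat.cast_ne_zero.2 (Nat.factorial_ne_zero _)
      field_simp
    rw [Finset.sum_congr rfl h4, ← Finset.sum_mul, ← map_sum, ← Finset.mul_sum, ← add_pow,
      add_neg_cancel]
    split_ifs with h
    · subst h; simp
    · rw [zero_pow h, mul_zero, map_zero, zero_mul]
  rw [Finset.sum_congr rfl h3, Finset.sum_ite_eq' (Finset.range N) 0 (fun _ => f S)]
  simp [hN']

end ExpOp

/-! ### The operator `G` -/

section GOperator

variable {K : Type*} [Field K]

/-- The coefficients `s_j / (j ħ)` of the creation operator. -/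
def creationCoeff (y : PowerSeries (PowerSeries K)) (j : ℕ) : Scal K :=
  algebraMap K (Scal K) (j : K)⁻¹ * PowerSeries.C (yOverH y j)

theorem creation_eq_raising (y : PowerSeries (PowerSeries K)) :
    creation y = ⇑(raising (creationCoeff y)) := by
  funext f S
  rw [raising_apply _ f (Int.self_le_toNat S.energy), creation,
    finsum_eq_sum_of_support_subset (s := Finset.Icc 1 S.energy.toNat)]
  · refine Finset.sum_congr rfl fun j hj => ?_
    rw [if_neg (by have := (Finset.mem_Icc.1 hj).1; omega), creationCoeff, Algebra.smul_def,
      mul_assoc, Jlin_apply]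
  · intro j hj
    by_contra hn
    apply hj
    rcases Nat.eq_zero_or_pos j with rfl | h0
    · exact if_pos rfl
    · have h1 : S.energy < j := by
        simp only [Finset.coe_Icc, Set.mem_Icc, not_and, not_le] at hn
        have := hn h0
        omega
      simp only [Jop_eq_zero_of_energy_lt (by omega) f h1, mul_zero, Algebra.smul_def, ite_self]

theorem neg_creation_eq (y : PowerSeries (PowerSeries K)) :
    (fun f => -creation y f) = ⇑(-raising (creationCoeff y)) := by
  rw [creation_eq_raising]; rfl

variable [CharZero K]

theorem constantCoeff_wAt {ψ : PowerSeries (PowerSeries K)}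
    (hψ : PowerSeries.constantCoeff ψ = 0) (x : K) :
    PowerSeries.constantCoeff (wAt ψ x) = 0 := by
  rw [← PowerSeries.coeff_zero_eq_constantCoeff_apply, wAt, PowerSeries.coeff_mk]
  simp [hψ]

theorem wEig_eq_occSum (ψ : PowerSeries (PowerSeries K)) (S : Maya) :
    wEig ψ S = occSum (fun k : ℤ => wAt ψ ((k : K) + 1 / 2)) S := rfl

theorem constantCoeff_wEig {ψ : PowerSeries (PowerSeries K)}
    (hψ : PowerSeries.constantCoeff ψ = 0) (S : Maya) :
    PowerSeries.constantCoeff (wEig ψ S) = 0 := by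
  rw [wEig_eq_occSum, occSum_eq_sum _ fun k hk => S.isBound_energy.occ_eq_zero hk, map_sum]
  exact Finset.sum_eq_zero fun k _ => by rw [map_mul, constantCoeff_wAt hψ, mul_zero]

theorem Dop_DopInv {ψ : PowerSeries (PowerSeries K)} (hψ : PowerSeries.constantCoeff ψ = 0)
    (f : Fock (Scal K)) : Dop ψ (DopInv ψ f) = f := by
  funext S
  rw [Dop, DopInv, ← mul_assoc, ← map_mul, toL, toL, ← map_mul,
    fexp_mul_fexp_neg (constantCoeff_wEig hψ S), map_one, map_one, one_mul]

theorem Gop_GopInv {ψ : PowerSeries (PowerSeries K)} (hψ : PowerSeries.constantCoeff ψ = 0)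
    (y : PowerSeries (PowerSeries K)) (f : Fock (Scal K)) : Gop ψ y (GopInv ψ y f) = f := by
  rw [Gop, GopInv, Function.comp_apply, Function.comp_apply, neg_creation_eq, creation_eq_raising,
    expOp_expOp_neg (isLowering_raising _), Dop_DopInv hψ]

theorem wEig_vac (ψ : PowerSeries (PowerSeries K)) : wEig ψ Maya.vac = 0 := by
  rw [wEig_eq_occSum, occSum_vac]

/-- The covacuum is invariant under `G⁻¹`. -/
theorem GopInv_vac (ψ y : PowerSeries (PowerSeries K)) (f : Fock (Scal K)) :
    GopInv ψ y f Maya.vac = f Maya.vac := by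
  rw [GopInv, Function.comp_apply, neg_creation_eq, expOp_vac (isLowering_raising _).neg, DopInv,
    wEig_vac, neg_zero, fexp_zero, toL, map_one, map_one, one_mul]

/-- Euler's identity for `exp(∑ b_j J_{-j})|0⟩`, to be compared with `energy_mul_tau`. -/
theorem expOp_raising_vac_energy (b : ℕ → Scal K) (S : Maya) {B : ℕ} (hB : S.energy ≤ B) :
    (S.energy : Scal K) * expOp (⇑(raising b)) (vacVec (Scal K)) S =
      ∑ j ∈ Finset.Icc 1 B, (j * b j) *
        Jop (-(j : ℤ)) (expOp (⇑(raising b)) (vacVec (Scal K))) S := by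
  have hL := isLowering_raising b
  have hN : S.energy < ((B + 1 : ℕ) : ℤ) := by push_cast; omega
  have hvac : energyOp (vacVec (Scal K)) = 0 := by
    funext T
    rw [energyOp_apply, vacVec]
    split_ifs with h
    · rw [h, Maya.energy_vac]; simp
    · simp
  have h1 : ∀ p, (S.energy : Scal K) * (raising b ^ (p + 1)) (vacVec (Scal K)) S =
      (p + 1 : ℕ) * (raising fun j => j * b j) ((raising b ^ p) (vacVec (Scal K))) S := by
    intro p
    have h2 := congrArg (fun A : Module.End (Scal K) (Fock (Scal K)) => A (vacVec (Scal K)) S)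
      (energyOp_raising_pow b p)
    simp only [LinearMap.add_apply, Module.End.mul_apply, hvac, map_zero, zero_add,
      LinearMap.smul_apply, energyOp_apply] at h2
    rw [h2, Pi.smul_apply, nsmul_eq_mul]
  have h3 := pow_expOp_apply hL (isLowering_raising fun j => j * b j) (vacVec (Scal K)) hN 1
  rw [pow_one, raising_apply _ _ hB] at h3
  simp only [Jlin_apply] at h3
  rw [h3, expOp_apply hL _ (N := B + 2) (by push_cast at hN ⊢; omega), Finset.sum_range_succ',
    pow_zero, Module.End.one_apply, mul_add, mul_left_comm (S.energy : Scal K), ← energyOp_apply,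
    hvac, Pi.zero_apply, mul_zero, add_zero, Finset.mul_sum]
  refine Finset.sum_congr rfl fun p _ => ?_
  have h4 : algebraMap K (Scal K) (((p + 1).factorial : K)⁻¹) * ((p + 1 : ℕ) : Scal K) =
      algebraMap K (Scal K) ((p.factorial : K)⁻¹) := by
    rw [← map_natCast (algebraMap K (Scal K)), ← map_mul]
    congr 1
    have f1 : (p.factorial : K) ≠ 0 := Nat.cast_ne_zero.2 (Nat.factorial_ne_zero _)
    have f2 : ((p + 1 : ℕ) : K) ≠ 0 := Nat.cast_ne_zero.2 (Nat.succ_ne_zero _)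
    rw [Nat.factorial_succ, Nat.cast_mul]
    field_simp
  rw [mul_left_comm, h1, ← mul_assoc, h4]

/-- `exp(∑ p_j J_{-j} / j)` sends the vacuum to `∑_λ s_λ(p) v_λ`. -/
theorem expOp_raising_vac (b p : ℕ → Scal K) (hb : ∀ j, 0 < j → j * b j = p j) :
    expOp (⇑(raising b)) (vacVec (Scal K)) = tau K p := by
  suffices h : ∀ (N : ℕ) (S : Maya), S.energy = N →
      expOp (⇑(raising b)) (vacVec (Scal K)) S = tau K p S from
    funext fun S => h S.energy.toNat S (Int.toNat_of_nonneg S.energy_nonneg).symm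
  intro N
  induction N using Nat.strong_induction_on with
  | _ N ih =>
  intro S hS
  rcases Nat.eq_zero_or_pos N with rfl | hN
  · rw [expOp_apply (isLowering_raising b) _ (N := 1) (by rw [hS]; simp), Finset.sum_range_one,
      Nat.factorial_zero, Nat.cast_one, inv_one, map_one, one_mul, pow_zero, Module.End.one_apply,
      vacVec]
    split_ifs with h
    · rw [h, tau_vac]
    · exact (tau_eq_zero K p fun hc => h (Maya.eq_vac hc (by simpa using hS))).symm
  · refine eq_of_natCast_mul_eq K hN.ne' ?_
    have h1 := expOp_raising_vac_energy b S hS.le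
    have h2 := energy_mul_tau K p S hS.le
    rw [hS, Int.cast_natCast] at h1 h2
    rw [h1, h2]
    refine Finset.sum_congr rfl fun j hj => ?_
    have hj := (Finset.mem_Icc.1 hj).1
    rw [hb j hj]
    congr 1
    refine (isLowering_Jlin hj).congr fun T hT => ?_
    have h0 := T.energy_nonneg
    exact ih T.energy.toNat (by omega) T (by omega)

theorem natCast_mul_creationCoeff (y : PowerSeries (PowerSeries K)) {j : ℕ} (hj : 0 < j) :
    j * creationCoeff y j = PowerSeries.C (yOverH y j) := by
  rw [creationCoeff, ← map_natCast (algebraMap K (Scal K)), ← mul_assoc, ← map_mul,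
    mul_inv_cancel₀ (Nat.cast_ne_zero.2 hj.ne'), map_one, one_mul]

theorem Gop_vac (ψ y : PowerSeries (PowerSeries K)) (S : Maya) :
    Gop ψ y (vacVec (Scal K)) S = PowerSeries.C (toL (fexp K (wEig ψ S))) *
      tau K (fun j => PowerSeries.C (yOverH y j)) S := by
  rw [Gop, Function.comp_apply, creation_eq_raising,
    expOp_raising_vac _ _ fun j hj => natCast_mul_creationCoeff y hj, Dop]

/-- The eigenvalue of `𝒟(ħ)` at a partition is given by the contents of its boxes. -/
theorem wEig_mayaOf (ψ : PowerSeries (PowerSeries K)) (μ : YoungDiagram) :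
    wEig ψ (mayaOf μ) = ∑ b ∈ μ.cells, psiAt ψ ((b.2 : K) - (b.1 : K)) := by
  rw [wEig_eq_occSum, (Maya.isEnum_mayaOf μ (le_refl (μ.colLen 0))).occSum_eq,
    ← Finset.sum_sub_distrib,
    Finset.sum_finset_product μ.cells (Finset.range (μ.colLen 0))
      (fun i => Finset.range (μ.rowLen i)), Finset.sum_range]
  · refine Finset.sum_congr rfl fun i _ => ?_
    -- the difference equation for `w` makes the sum over a row telescope
    have h1 : ∀ j : ℕ, psiAt ψ ((j : K) - ((i : ℕ) : K)) =
        wAt ψ (((j + 1 : ℕ) : K) - ((i : ℕ) : K) - 1 / 2) -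
          wAt ψ ((j : K) - ((i : ℕ) : K) - 1 / 2) := by
      intro j
      rw [← wAt_sub]
      congr 2
      push_cast; ring
    simp only [h1]
    rw [Finset.sum_range_sub (fun j : ℕ => wAt ψ ((j : K) - ((i : ℕ) : K) - 1 / 2))]
    congr 2 <;> push_cast <;> ring
  · rintro ⟨i, j⟩
    rw [YoungDiagram.mem_cells, Finset.mem_range, Finset.mem_range]
    refine ⟨fun h => ⟨?_, YoungDiagram.mem_iff_lt_rowLen.1 h⟩, fun h =>
      YoungDiagram.mem_iff_lt_rowLen.2 h.2⟩
    exact YoungDiagram.mem_iff_lt_colLen.1 (μ.up_left_mem le_rfl (Nat.zero_le _) h)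

end GOperator

/-! ### The boson–fermion correspondence -/

section Bosonization

variable (K : Type*) [Field K] {R : Type*} [CommRing R] {A : Type*} [CommRing A] [Algebra K A]
  [Algebra R A]

/-- The bosonic image only sees the charge zero part. -/
theorem schurPair_Jop_zero (p : ℕ → A) (N : ℤ) (v : Fock R) :
    schurPair K p N (Jop 0 v) = 0 := by
  rw [schurPair_apply]
  refine Finset.sum_eq_zero fun S _ => ?_
  by_cases hc : S.charge = 0
  · rw [Jop_zero, hc, Int.cast_zero, zero_mul, zero_smul]
  · rw [tau_eq_zero K p hc, smul_zero]

variable [CharZero K]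

theorem intCast_mul_schurPair (p : ℕ → A) (N : ℤ) (v : Fock R) {B : ℕ} (hB : N ≤ B) :
    (N : A) * schurPair K p N v =
      ∑ a ∈ Finset.Icc 1 B, p a * schurPair K p (N - a) (Jop a v) := by
  rcases lt_or_ge N 0 with hN | hN
  · rw [schurPair_of_neg K p hN, mul_zero, Finset.sum_eq_zero]
    intro a _
    rw [schurPair_of_neg K p (by omega), mul_zero]
  · obtain ⟨N, rfl⟩ := Int.eq_ofNat_of_zero_le hN
    rw [Int.cast_natCast, natCast_mul_schurPair]
    refine Finset.sum_subset (Finset.Icc_subset_Icc_right (by omega)) fun a ha ha' => ?_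
    rw [Finset.mem_Icc] at ha ha'
    rw [schurPair_of_neg K p (by omega), mul_zero]

/-- A creation operator acts on the bosonic side as the multiplication by a power sum. -/
theorem schurPair_Jop_neg (p : ℕ → A) {b : ℕ} (hb : 0 < b) (N : ℕ) :
    ∀ v : Fock R, schurPair K p N (Jop (-(b : ℤ)) v) = p b * schurPair K p ((N : ℤ) - b) v := by
  induction N using Nat.strong_induction_on with
  | _ N ih =>
  intro v
  rcases Nat.eq_zero_or_pos N with rfl | hN
  · rw [schurPair_of_neg K p (N := ((0 : ℕ) : ℤ) - b) (by push_cast; omega),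
      mul_zero, Nat.cast_zero, schurPair_zero,
      Jop_eq_zero_of_energy_lt (by omega) v (by simpa using hb), map_zero]
  refine eq_of_natCast_mul_eq K hN.ne' ?_
  rw [natCast_mul_schurPair]
  have h1 : ∀ a ∈ Finset.Icc 1 N, p a * schurPair K p ((N : ℤ) - a) (Jop a (Jop (-(b : ℤ)) v)) =
      p b * (p a * schurPair K p ((N : ℤ) - b - a) (Jop a v)) +
        if a = b then (b : A) * (p b * schurPair K p ((N : ℤ) - b) v) else 0 := by
    intro a ha
    rw [Finset.mem_Icc] at ha
    have h2 := ih (N - a) (by omega) (Jop a v)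
    rw [Nat.cast_sub ha.2] at h2
    rw [Jop_commutator, map_add, h2, sub_right_comm]
    split_ifs with h3 h4 h4
    · subst h4
      rw [map_smul, Int.cast_natCast, Algebra.smul_def, map_natCast]
      ring
    · omega
    · omega
    · rw [map_zero]; ring
  rw [Finset.sum_congr rfl h1, Finset.sum_add_distrib, Finset.sum_ite_eq', ← Finset.mul_sum,
    ← intCast_mul_schurPair K p _ v (by omega)]
  push_cast
  split_ifs with h
  · ring
  · rw [schurPair_of_neg K p (N := (N : ℤ) - b) (by
      simp only [Finset.mem_Icc, not_and, not_le] at h; have := h hb; omega)]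
    ring

end Bosonization

section Variables

variable (K : Type*) [Field K] [CharZero K] {R : Type*} [CommRing R] [Algebra K R]

/-- The derivation `b ∂ / ∂p_b`. -/
def annihil (R : Type*) [CommRing R] (b : ℕ) :
    Derivation R (MvPowerSeries ℕ R) (MvPowerSeries ℕ R) :=
  (b : R) • MvPowerSeries.pderiv R b

theorem coeff_annihil (b : ℕ) (f : MvPowerSeries ℕ R) (d : ℕ →₀ ℕ) :
    MvPowerSeries.coeff d (annihil R b f) =
      b * ((d b + 1) * MvPowerSeries.coeff (d + Finsupp.single b 1) f) := by
  rw [annihil, Derivation.smul_apply, MvPowerSeries.coeff_smul, MvPowerSeries.coeff_pderiv,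
    mul_comm (MvPowerSeries.coeff _ f)]

theorem annihil_X (a b : ℕ) : annihil R b (MvPowerSeries.X a) =
    if a = b then (b : MvPowerSeries ℕ R) else 0 := by
  rw [annihil, Derivation.smul_apply, MvPowerSeries.pderiv_X, Pi.single_apply, eq_comm]
  split_ifs with h
  · rw [Algebra.smul_def, map_natCast, mul_one]
  · rw [smul_zero]

/-- The homogeneous parts of the bosonic image of a vector, in the variables `p_k`. -/
abbrev bosonPart (N : ℤ) : Fock R →ₗ[R] MvPowerSeries ℕ R :=
  schurPair K (fun a => (MvPowerSeries.X a : MvPowerSeries ℕ R)) N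

/-- An annihilation operator acts on the bosonic side as a derivation. -/
theorem annihil_bosonPart {b : ℕ} (hb : 0 < b) (N : ℕ) : ∀ v : Fock R,
    annihil R b (bosonPart K N v) = bosonPart K ((N : ℤ) - b) (Jop b v) := by
  induction N using Nat.strong_induction_on with
  | _ N ih =>
  intro v
  rcases Nat.eq_zero_or_pos N with rfl | hN
  · rw [schurPair_of_neg K _ (N := ((0 : ℕ) : ℤ) - b) (by push_cast; omega), Nat.cast_zero,
      schurPair_zero, Derivation.map_algebraMap]
  refine eq_of_natCast_mul_eq K hN.ne' ?_
  have h0 := congrArg (annihil R b) (natCast_mul_schurPair K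
    (fun a => (MvPowerSeries.X a : MvPowerSeries ℕ R)) N v)
  rw [Derivation.leibniz, Derivation.map_natCast, smul_zero, add_zero, smul_eq_mul, map_sum] at h0
  rw [h0]
  have h1 : ∀ a ∈ Finset.Icc 1 N, annihil R b (MvPowerSeries.X a *
        schurPair K (fun a => (MvPowerSeries.X a : MvPowerSeries ℕ R)) ((N : ℤ) - a) (Jop a v)) =
      MvPowerSeries.X a * bosonPart K ((N : ℤ) - b - a) (Jop a (Jop b v)) +
        if a = b then (b : MvPowerSeries ℕ R) * bosonPart K ((N : ℤ) - b) (Jop b v) else 0 := by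
    intro a ha
    rw [Finset.mem_Icc] at ha
    have h2 := ih (N - a) (by omega) (Jop a v)
    rw [Nat.cast_sub ha.2] at h2
    rw [Derivation.leibniz, smul_eq_mul, smul_eq_mul, h2, annihil_X, Jop_commutator,
      if_neg (by omega), add_zero, sub_right_comm]
    split_ifs with h4
    · subst h4; ring
    · rw [mul_zero]
  rw [Finset.sum_congr rfl h1, Finset.sum_add_distrib, Finset.sum_ite_eq',
    ← intCast_mul_schurPair K _ _ (Jop b v) (by omega)]
  push_cast
  split_ifs with h
  · ring
  · rw [schurPair_of_neg K _ (N := (N : ℤ) - b) (by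
      simp only [Finset.mem_Icc, not_and, not_le] at h; have := h hb; omega)]
    ring

/-- The weight of a monomial in the `p_k`, where `p_k` has weight `k`. -/
def wt (d : ℕ →₀ ℕ) : ℕ := Finsupp.weight (fun a : ℕ => a) d

theorem wt_add (d e : ℕ →₀ ℕ) : wt (d + e) = wt d + wt e := map_add _ _ _

theorem wt_single (a : ℕ) : wt (Finsupp.single a 1) = a := by
  rw [wt, Finsupp.weight_single, one_smul]

@[simp]
theorem wt_zero : wt 0 = 0 := map_zero _

/-- The bosonic image `∑_λ v_λ s_λ(p)` of a vector `v` of the completed Fock space. -/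
def boson (v : Fock R) : MvPowerSeries ℕ R := fun d =>
  MvPowerSeries.coeff d (bosonPart K (wt d) v)

omit [CharZero K] in
theorem coeff_boson (v : Fock R) (d : ℕ →₀ ℕ) :
    MvPowerSeries.coeff d (boson K v) = MvPowerSeries.coeff d (bosonPart K (wt d) v) := rfl

theorem boson_Jop_pos {b : ℕ} (hb : 0 < b) (v : Fock R) :
    boson K (Jop b v) = annihil R b (boson K v) := by
  ext d
  have h1 := annihil_bosonPart K hb (wt d + b) v
  rw [Nat.cast_add, add_sub_cancel_right] at h1
  rw [coeff_boson, ← h1, coeff_annihil, coeff_annihil, coeff_boson, wt_add, wt_single,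
    Nat.cast_add]

omit [CharZero K] in
theorem boson_Jop_zero (v : Fock R) : boson K (Jop 0 v) = 0 := by
  ext d
  rw [coeff_boson, schurPair_Jop_zero, map_zero]

theorem coeff_X_mul (b : ℕ) (f : MvPowerSeries ℕ R) (d : ℕ →₀ ℕ) :
    MvPowerSeries.coeff d (MvPowerSeries.X b * f) =
      if Finsupp.single b 1 ≤ d then MvPowerSeries.coeff (d - Finsupp.single b 1) f else 0 := by
  rw [MvPowerSeries.X, MvPowerSeries.coeff_monomial_mul]
  simp

theorem boson_Jop_neg {b : ℕ} (hb : 0 < b) (v : Fock R) :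
    boson K (Jop (-(b : ℤ)) v) = MvPowerSeries.X b * boson K v := by
  ext d
  rw [coeff_boson, bosonPart, schurPair_Jop_neg K _ hb, coeff_X_mul, coeff_X_mul]
  split_ifs with h
  · rw [coeff_boson]
    have h1 := wt_add (d - Finsupp.single b 1) (Finsupp.single b 1)
    rw [tsub_add_cancel_of_le h, wt_single] at h1
    rw [h1, Nat.cast_add, add_sub_cancel_right]
  · rfl

omit [CharZero K] in
theorem constantCoeff_boson (v : Fock R) :
    MvPowerSeries.coeff 0 (boson K v) = v Maya.vac := by
  rw [coeff_boson, wt_zero, Nat.cast_zero, schurPair_zero]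
  simp [MvPowerSeries.algebraMap_apply]

end Variables

/-! ### The partition function as a bosonic image -/

section Homogeneity

variable (K : Type*) [Field K] {R : Type*} [CommRing R] [Algebra K R]

theorem coeff_Jop_neg_eq_zero {j : ℕ} (hj : 0 < j) {f : Fock (MvPowerSeries ℕ R)} {S : Maya}
    {d : ℕ →₀ ℕ} (h : ∀ T : Maya, T.energy = S.energy - j → MvPowerSeries.coeff d (f T) = 0) :
    MvPowerSeries.coeff d (Jop (-(j : ℤ)) f S) = 0 := by
  classical
  rw [Jop_eq_sum_ite (by omega) f S.isBound_energy le_rfl, map_sum]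
  refine Finset.sum_eq_zero fun k _ => ?_
  split_ifs with hk
  · have h1 := h (S.move (k - -(j : ℤ)) k) (by rw [Maya.energy_move hk.1 hk.2]; ring)
    rcases neg_one_pow_eq_or (MvPowerSeries ℕ R)
      (S.set ∩ Set.Ioo (min (k - -(j : ℤ)) k) (max (k - -(j : ℤ)) k)).ncard with h2 | h2
    · rw [h2, one_mul, h1]
    · rw [h2, neg_one_mul, map_neg, h1, neg_zero]
  · exact map_zero _

variable [CharZero K]

/-- The Schur function of a partition of `N` is homogeneous of weight `N`. -/
theorem coeff_tau_X_eq_zero (N : ℕ) : ∀ {S : Maya} {d : ℕ →₀ ℕ}, S.energy = N → wt d ≠ N →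
    MvPowerSeries.coeff d (tau K (fun a => (MvPowerSeries.X a : MvPowerSeries ℕ R)) S) = 0 := by
  induction N using Nat.strong_induction_on with
  | _ N ih =>
  intro S d hS hd
  rcases Nat.eq_zero_or_pos N with rfl | hN
  · by_cases hc : S.charge = 0
    · rw [Maya.eq_vac hc (by simpa using hS), tau_vac, MvPowerSeries.coeff_one, if_neg]
      rintro rfl
      exact hd wt_zero
    · rw [tau_eq_zero K _ hc, map_zero]
  · refine eq_of_natCast_mul_eq K hN.ne' ?_
    have h1 := congrArg (MvPowerSeries.coeff d) (energy_mul_tau K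
      (fun a => (MvPowerSeries.X a : MvPowerSeries ℕ R)) S hS.le)
    rw [hS, Int.cast_natCast, ← map_natCast (MvPowerSeries.C (σ := ℕ) (R := R)),
      MvPowerSeries.coeff_C_mul, map_sum] at h1
    rw [h1, mul_zero]
    refine Finset.sum_eq_zero fun j hj => ?_
    rw [Finset.mem_Icc] at hj
    rw [coeff_X_mul]
    split_ifs with hle
    · refine coeff_Jop_neg_eq_zero hj.1 fun T hT => ih (N - j) (by omega) (by omega) ?_
      have h2 := wt_add (d - Finsupp.single j 1) (Finsupp.single j 1)
      rw [tsub_add_cancel_of_le hle, wt_single] at h2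
      omega
    · rfl

end Homogeneity

section Schur

variable (K : Type*) [Field K] {A B : Type*} [CommRing A] [Algebra K A] [CommRing B] [Algebra K B]

theorem map_schur (φ : A →ₐ[K] B) (p : ℕ → A) (μ : YoungDiagram) :
    φ (schur K p μ) = schur K (fun k => φ (p k)) μ := by
  rw [schur, schur, AlgHom.map_det]
  congr 1
  ext i j
  exact map_hSym K φ p _

end Schur

section PartitionFunction

variable {K : Type*} [Field K]

/-- The coefficient embedding `K((ħ)) → K((ħ))⟦u⟧`. -/
def scalAlgHom (K : Type*) [Field K] : LaurentSeries K →ₐ[K] Scal K :=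
  { PowerSeries.C with commutes' := fun _ => (PowerSeries.algebraMap_apply).symm }

/-- The embedding of polynomials in the `p_k` over `K((ħ))` into power series over
`K((ħ))⟦u⟧`. -/
def polyAlgHom (K : Type*) [Field K] :
    MvPolynomial ℕ (LaurentSeries K) →ₐ[K] MvPowerSeries ℕ (Scal K) :=
  { (MvPowerSeries.map (σ := ℕ) (PowerSeries.C (R := LaurentSeries K))).comp
      (MvPolynomial.coeToMvPowerSeries.ringHom (σ := ℕ) (R := LaurentSeries K)) with
    commutes' := fun a => by
      change MvPowerSeries.map PowerSeries.C
        ((algebraMap K (MvPolynomial ℕ (LaurentSeries K)) a : MvPolynomial ℕ (LaurentSeries K)) :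
          MvPowerSeries ℕ (LaurentSeries K)) = _
      rw [MvPolynomial.algebraMap_apply, MvPolynomial.coe_C, MvPowerSeries.map_C,
        MvPowerSeries.algebraMap_apply, PowerSeries.algebraMap_apply] }

theorem coeff_polyAlgHom (f : MvPolynomial ℕ (LaurentSeries K)) (d : ℕ →₀ ℕ) :
    MvPowerSeries.coeff d (polyAlgHom K f) = PowerSeries.C (MvPolynomial.coeff d f) := rfl

theorem polyAlgHom_X (k : ℕ) : polyAlgHom K (MvPolynomial.X k) = MvPowerSeries.X k := by
  classical
  ext1 d
  rw [coeff_polyAlgHom, MvPolynomial.coeff_X, MvPowerSeries.coeff_X]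
  simp only [eq_comm]
  split_ifs <;> simp

variable [CharZero K]

/-- The partition function, regarded as a power series over `K((ħ))⟦u⟧`. -/
def partitionScal (ψ y : PowerSeries (PowerSeries K)) : MvPowerSeries ℕ (Scal K) :=
  MvPowerSeries.map PowerSeries.C (partitionFunction ψ y)

/-- The partition function is the bosonic image of `G` applied to the vacuum. -/
theorem boson_Gop_vac (ψ y : PowerSeries (PowerSeries K)) :
    boson K (Gop ψ y (vacVec (Scal K))) = partitionScal ψ y := by
  classical
  ext1 d
  set F : Maya → Scal K := fun S => Gop ψ y (vacVec (Scal K)) S * MvPowerSeries.coeff d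
    (tau K (fun a => (MvPowerSeries.X a : MvPowerSeries ℕ (Scal K))) S) with hF
  have h1 : ∀ μ : YoungDiagram, PowerSeries.C (MvPolynomial.coeff d
        (schur K (fun k => (MvPolynomial.X k : MvPolynomial ℕ (LaurentSeries K))) μ) *
      schur K (yOverH y) μ *
      toL (fexp K (∑ b ∈ μ.cells, psiAt ψ ((b.2 : K) - (b.1 : K))))) = F (mayaOf μ) := by
    intro μ
    have e1 := congrArg (MvPowerSeries.coeff d) (map_schur K (polyAlgHom K)
      (fun k => (MvPolynomial.X k : MvPolynomial ℕ (LaurentSeries K))) μ)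
    have e2 := map_schur K (scalAlgHom K) (yOverH y) μ
    rw [coeff_polyAlgHom] at e1
    simp only [polyAlgHom_X] at e1
    rw [hF]
    simp only [Gop_vac, tau_mayaOf, wEig_mayaOf]
    rw [map_mul, map_mul, e1]
    change _ * scalAlgHom K _ * _ = _
    rw [e2]
    change _ * schur K (fun k => PowerSeries.C (yOverH y k)) μ * _ = _
    ring
  have hzero : ∀ S, S ∉ Maya.ofEnergy (wt d) → F S = 0 := by
    intro S hS
    rw [Maya.mem_ofEnergy] at hS
    have h0 := S.energy_nonneg
    rw [hF]
    simp only
    rw [coeff_tau_X_eq_zero K S.energy.toNat (by omega) (by omega), mul_zero]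
  have hinj : Set.InjOn mayaOf (mayaOf ⁻¹' ↑(Maya.ofEnergy (wt d))) :=
    mayaOf_injective.injOn
  have hsupp : (Function.support fun μ : YoungDiagram => MvPolynomial.coeff d
        (schur K (fun k => (MvPolynomial.X k : MvPolynomial ℕ (LaurentSeries K))) μ) *
      schur K (yOverH y) μ *
      toL (fexp K (∑ b ∈ μ.cells, psiAt ψ ((b.2 : K) - (b.1 : K))))) ⊆
      ↑((Maya.ofEnergy (wt d)).preimage mayaOf hinj) := by
    intro μ hμ
    by_contra hn
    rw [Finset.mem_coe, Finset.mem_preimage] at hn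
    have h2 := h1 μ
    rw [hzero _ hn] at h2
    exact hμ ((map_eq_zero_iff _ PowerSeries.C_injective).1 h2)
  have h3 : MvPowerSeries.coeff d (partitionScal ψ y) =
      ∑ μ ∈ (Maya.ofEnergy (wt d)).preimage mayaOf hinj, F (mayaOf μ) := by
    rw [partitionScal, MvPowerSeries.coeff_map]
    change PowerSeries.C (partitionFunction ψ y d) = _
    rw [partitionFunction, finsum_eq_sum_of_support_subset _ hsupp, map_sum]
    exact Finset.sum_congr rfl fun μ _ => h1 μ
  rw [h3, Finset.sum_preimage mayaOf _ hinj F, coeff_boson, bosonPart, schurPair_apply, map_sum]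
  · exact Finset.sum_congr rfl fun S _ => MvPowerSeries.coeff_smul _ _ _
  -- a diagram that does not come from a partition has nonzero charge
  · intro S _ hS
    by_cases hc : S.charge = 0
    · obtain ⟨N, s, h⟩ := Maya.exists_isEnum hc
      obtain ⟨σ, hσ⟩ := h.exists_sorted
      obtain ⟨μ, hμ, -⟩ := (h.comp_perm σ).exists_young hσ
      exact absurd ⟨μ, hμ⟩ hS
    · rw [hF]
      simp only [tau_eq_zero K _ hc, map_zero, mul_zero]

theorem constantCoeff_partitionScal (ψ y : PowerSeries (PowerSeries K)) :
    MvPowerSeries.coeff 0 (partitionScal ψ y) = 1 := by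
  rw [← boson_Gop_vac, constantCoeff_boson, Gop_vac, tau_vac, wEig_vac, fexp_zero, toL, map_one,
    map_one, mul_one]

end PartitionFunction

/-! ### Logarithms and evaluation of power series in the `p_k` -/

section LogSeries

variable {K : Type*} [Field K] [CharZero K] {σ R : Type*} [CommRing R] [Algebra K R]

theorem coeff_pow_eq_zero_of_degree_lt {z : MvPowerSeries σ R}
    (hz : MvPowerSeries.coeff 0 z = 0) {q : ℕ} {d : σ →₀ ℕ} (h : d.degree < q) :
    MvPowerSeries.coeff d (z ^ q) = 0 := by
  refine MvPowerSeries.coeff_of_lt_order ?_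
  refine lt_of_lt_of_le ?_ (MvPowerSeries.le_order_pow_of_constantCoeff_eq_zero q hz)
  exact_mod_cast h

/-- The truncated logarithm `∑_{q=1}^M (-1)^{q+1} z^q / q`. -/
def logTrunc (K : Type*) [Field K] [Algebra K R] (M : ℕ) (z : MvPowerSeries σ R) :
    MvPowerSeries σ R :=
  ∑ q ∈ Finset.Icc 1 M, algebraMap K (MvPowerSeries σ R) ((-1 : K) ^ (q + 1) / (q : K)) * z ^ q

/-- The logarithm of `1 + z`, where `z` has zero constant term. -/
def logSeries (K : Type*) [Field K] [Algebra K R] (z : MvPowerSeries σ R) : MvPowerSeries σ R :=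
  fun d => MvPowerSeries.coeff d (logTrunc K d.degree z)

omit [CharZero K] in
theorem coeff_algebraMap_mul (a : K) (f : MvPowerSeries σ R) (d : σ →₀ ℕ) :
    MvPowerSeries.coeff d (algebraMap K (MvPowerSeries σ R) a * f) =
      algebraMap K R a * MvPowerSeries.coeff d f := by
  rw [MvPowerSeries.algebraMap_apply, MvPowerSeries.coeff_C_mul]

omit [CharZero K] in
theorem coeff_logTrunc {z : MvPowerSeries σ R} (hz : MvPowerSeries.coeff 0 z = 0)
    {d : σ →₀ ℕ} {M : ℕ} (hM : d.degree ≤ M) :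
    MvPowerSeries.coeff d (logTrunc K M z) = MvPowerSeries.coeff d (logSeries K z) := by
  change _ = MvPowerSeries.coeff d (logTrunc K d.degree z)
  rw [logTrunc, logTrunc, map_sum, map_sum]
  symm
  refine Finset.sum_subset (Finset.Icc_subset_Icc_right hM) fun q hq hq' => ?_
  rw [Finset.mem_Icc] at hq hq'
  rw [coeff_algebraMap_mul, coeff_pow_eq_zero_of_degree_lt hz (by omega), mul_zero]

theorem derivation_logTrunc (δ : Derivation R (MvPowerSeries σ R) (MvPowerSeries σ R)) (M : ℕ)
    (z : MvPowerSeries σ R) :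
    (1 + z) * δ (logTrunc K M z) = (1 - (-z) ^ M) * δ z := by
  have h0 : δ (logTrunc K M z) = (∑ q ∈ Finset.range M, (-z) ^ q) * δ z := by
    rw [logTrunc, map_sum, Finset.sum_mul, ← Finset.Ico_add_one_right_eq_Icc,
      Finset.sum_Ico_eq_sum_range]
    refine Finset.sum_congr (by simp) fun q _ => ?_
    have hq : ((1 + q : ℕ) : K) ≠ 0 := by exact_mod_cast (by omega : 1 + q ≠ 0)
    have e1 : δ (algebraMap K (MvPowerSeries σ R) ((-1 : K) ^ (1 + q + 1) / ((1 + q : ℕ) : K))) =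
        0 := by
      rw [MvPowerSeries.algebraMap_apply]
      exact δ.map_algebraMap _
    rw [Derivation.leibniz, e1, smul_zero, add_zero, Derivation.leibniz_pow, smul_eq_mul,
      nsmul_eq_mul, smul_eq_mul, add_tsub_cancel_left, ← mul_assoc,
      ← map_natCast (algebraMap K (MvPowerSeries σ R)), ← map_mul, div_mul_cancel₀ _ hq,
      add_comm 1 q, pow_add, pow_add, neg_pow z, map_mul, map_mul, map_pow]
    simp
    ring
  rw [h0, ← mul_assoc]
  congr 1
  have := mul_neg_geom_sum (-z) M
  rw [← this]; ring

theorem coeff_mul_congr_of_le {f f' g g' : MvPowerSeries σ R} {d : σ →₀ ℕ}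
    (hf : ∀ e ≤ d, MvPowerSeries.coeff e f = MvPowerSeries.coeff e f')
    (hg : ∀ e ≤ d, MvPowerSeries.coeff e g = MvPowerSeries.coeff e g') :
    MvPowerSeries.coeff d (f * g) = MvPowerSeries.coeff d (f' * g') := by
  classical
  rw [MvPowerSeries.coeff_mul, MvPowerSeries.coeff_mul]
  refine Finset.sum_congr rfl fun q hq => ?_
  have hq := Finset.HasAntidiagonal.mem_antidiagonal.1 hq
  rw [hf _ (hq ▸ le_self_add), hg _ (hq ▸ le_add_self)]

/-- The logarithmic derivative. -/
theorem pderiv_logSeries {z : MvPowerSeries σ R} (hz : MvPowerSeries.coeff 0 z = 0) (i : σ) :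
    (1 + z) * MvPowerSeries.pderiv R i (logSeries K z) = MvPowerSeries.pderiv R i z := by
  ext d
  have h1 : MvPowerSeries.coeff d ((1 + z) * MvPowerSeries.pderiv R i (logSeries K z)) =
      MvPowerSeries.coeff d ((1 + z) * MvPowerSeries.pderiv R i (logTrunc K (d.degree + 1) z)) := by
    refine coeff_mul_congr_of_le (fun _ _ => rfl) fun e he => ?_
    rw [MvPowerSeries.coeff_pderiv, MvPowerSeries.coeff_pderiv, coeff_logTrunc hz]
    rw [map_add, Finsupp.degree_single]
    exact Nat.add_le_add_right (Finsupp.degree_mono he) 1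
  rw [h1, derivation_logTrunc, sub_mul, one_mul, map_sub, sub_eq_self]
  have h2 : MvPowerSeries.coeff d ((-z) ^ (d.degree + 1) * MvPowerSeries.pderiv R i z) =
      MvPowerSeries.coeff d (0 * MvPowerSeries.pderiv R i z) := by
    refine coeff_mul_congr_of_le (fun e he => ?_) fun _ _ => rfl
    rw [coeff_pow_eq_zero_of_degree_lt (by rw [map_neg, hz, neg_zero])
      (Nat.lt_succ_of_le (Finsupp.degree_mono he)), map_zero]
  rw [h2, zero_mul, map_zero]

end LogSeries

section Evaluation

variable (K : Type*) [Field K] [CharZero K] {R : Type*} [CommRing R] [Algebra K R]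

/-- The coefficient of `X^N` of the substitution `p_a ↦ a α_a X^a`, `a ≥ 1`, and `p_0 ↦ 0`, given
by the recursion that the chain rule imposes on it. -/
def evalCoeff (α : ℕ → R) : ℕ → MvPowerSeries ℕ R → R
  | 0, f => MvPowerSeries.coeff 0 f
  | N + 1, f => algebraMap K R ((N + 1 : ℕ) : K)⁻¹ *
      ∑ a : Fin (N + 1), ((a : ℕ) + 1 : ℕ) * α (a + 1) * evalCoeff α (N - a) (annihil R (a + 1) f)
  termination_by N => N
  decreasing_by omega

/-- The substitution `p_a ↦ a α_a X^a`, `a ≥ 1`, and `p_0 ↦ 0`. -/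
def evalSeries (α : ℕ → R) (f : MvPowerSeries ℕ R) : PowerSeries R :=
  PowerSeries.mk fun N => evalCoeff K α N f

omit [CharZero K] in
theorem coeff_zero_evalSeries (α : ℕ → R) (f : MvPowerSeries ℕ R) :
    PowerSeries.coeff 0 (evalSeries K α f) = MvPowerSeries.coeff 0 f := by
  rw [evalSeries, PowerSeries.coeff_mk, evalCoeff]

/-- The chain rule. -/
theorem natCast_mul_coeff_evalSeries (α : ℕ → R) (f : MvPowerSeries ℕ R) (N : ℕ) :
    (N : R) * PowerSeries.coeff N (evalSeries K α f) = ∑ a ∈ Finset.Icc 1 N,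
      a * α a * PowerSeries.coeff (N - a) (evalSeries K α (annihil R a f)) := by
  cases N with
  | zero => simp
  | succ N =>
    simp only [evalSeries, PowerSeries.coeff_mk]
    rw [evalCoeff, ← mul_assoc, ← map_natCast (algebraMap K R), ← map_mul,
      mul_inv_cancel₀ (Nat.cast_ne_zero.2 (Nat.succ_ne_zero N)), map_one, one_mul,
      ← Finset.Ico_add_one_right_eq_Icc, Finset.sum_Ico_eq_sum_range, Finset.sum_range]
    refine Finset.sum_congr (by simp) fun a _ => ?_
    rw [add_comm 1 (a : ℕ), Nat.add_sub_add_right]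

variable {K}

/-- An identity between coefficients of evaluations follows from the chain rule. -/
theorem evalSeries_eq_of_recursion (α : ℕ → R) {f : MvPowerSeries ℕ R} {g : PowerSeries R}
    (h0 : PowerSeries.coeff 0 g = MvPowerSeries.coeff 0 f)
    (h : ∀ N : ℕ, 0 < N → (N : R) * PowerSeries.coeff N g = ∑ a ∈ Finset.Icc 1 N,
      a * α a * PowerSeries.coeff (N - a) (evalSeries K α (annihil R a f))) :
    evalSeries K α f = g := by
  ext N
  rcases Nat.eq_zero_or_pos N with rfl | hN
  · rw [coeff_zero_evalSeries, h0]
  · refine eq_of_natCast_mul_eq K hN.ne' ?_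
    rw [h N hN, natCast_mul_coeff_evalSeries]

theorem evalSeries_add (α : ℕ → R) (f g : MvPowerSeries ℕ R) :
    evalSeries K α (f + g) = evalSeries K α f + evalSeries K α g := by
  ext N
  induction N using Nat.strong_induction_on generalizing f g with
  | _ N ih =>
  rcases Nat.eq_zero_or_pos N with rfl | hN
  · rw [map_add, coeff_zero_evalSeries, coeff_zero_evalSeries, coeff_zero_evalSeries, map_add]
  · refine eq_of_natCast_mul_eq K hN.ne' ?_
    rw [map_add, mul_add, natCast_mul_coeff_evalSeries, natCast_mul_coeff_evalSeries,
      natCast_mul_coeff_evalSeries, ← Finset.sum_add_distrib]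
    refine Finset.sum_congr rfl fun a ha => ?_
    rw [Finset.mem_Icc] at ha
    rw [map_add, ih (N - a) (by omega), map_add, mul_add]

theorem evalSeries_C (α : ℕ → R) (c : R) :
    evalSeries K α (MvPowerSeries.C c) = PowerSeries.C c := by
  have hz : evalSeries K α (0 : MvPowerSeries ℕ R) = 0 := by
    have := evalSeries_add (K := K) α 0 0
    rwa [add_zero, left_eq_add] at this
  refine evalSeries_eq_of_recursion α (by simp) fun N hN => ?_
  rw [PowerSeries.coeff_C, if_neg hN.ne', mul_zero, Finset.sum_eq_zero]
  intro a _
  rw [show annihil R a (MvPowerSeries.C c) = 0 from (annihil R a).map_algebraMap c, hz, map_zero,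
    mul_zero]

/-- The reindexing behind the product rule for convolutions. -/
theorem sum_Icc_mul_coeff_mul (β : ℕ → R) (F : ℕ → PowerSeries R) (G : PowerSeries R) (N : ℕ) :
    ∑ a ∈ Finset.Icc 1 N, β a * PowerSeries.coeff (N - a) (F a * G) =
      ∑ q ∈ Finset.HasAntidiagonal.antidiagonal N,
        (∑ a ∈ Finset.Icc 1 q.1, β a * PowerSeries.coeff (q.1 - a) (F a)) *
          PowerSeries.coeff q.2 G := by
  simp only [PowerSeries.coeff_mul, Finset.mul_sum, Finset.sum_mul]
  rw [Finset.sum_sigma', Finset.sum_sigma']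
  refine Finset.sum_bij' (fun x _ => ⟨(x.1 + x.2.1, x.2.2), x.1⟩)
    (fun x _ => ⟨x.2, (x.1.1 - x.2, x.1.2)⟩) ?_ ?_ ?_ ?_ ?_
  · rintro ⟨a, i, j⟩ h
    simp only [Finset.mem_sigma, Finset.mem_Icc, Finset.HasAntidiagonal.mem_antidiagonal] at h ⊢
    omega
  · rintro ⟨⟨i, j⟩, a⟩ h
    simp only [Finset.mem_sigma, Finset.mem_Icc, Finset.HasAntidiagonal.mem_antidiagonal] at h ⊢
    omega
  · rintro ⟨a, i, j⟩ h
    simp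
  · rintro ⟨⟨i, j⟩, a⟩ h
    simp only [Finset.mem_sigma, Finset.mem_Icc, Finset.HasAntidiagonal.mem_antidiagonal] at h
    simp only [Nat.add_sub_cancel' h.2.2]
  · rintro ⟨a, i, j⟩ h
    simp only [add_tsub_cancel_left]
    ring

theorem evalSeries_mul (α : ℕ → R) (f g : MvPowerSeries ℕ R) :
    evalSeries K α (f * g) = evalSeries K α f * evalSeries K α g := by
  ext N
  induction N using Nat.strong_induction_on generalizing f g with
  | _ N ih =>
  rcases Nat.eq_zero_or_pos N with rfl | hN
  · have h0 : PowerSeries.coeff 0 (evalSeries K α f * evalSeries K α g) =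
        PowerSeries.coeff 0 (evalSeries K α f) * PowerSeries.coeff 0 (evalSeries K α g) := by
      simp only [PowerSeries.coeff_zero_eq_constantCoeff_apply, map_mul]
    rw [h0, coeff_zero_evalSeries, coeff_zero_evalSeries, coeff_zero_evalSeries]
    exact map_mul (MvPowerSeries.constantCoeff (σ := ℕ) (R := R)) f g
  · refine eq_of_natCast_mul_eq K hN.ne' ?_
    have h1 : ∀ a ∈ Finset.Icc 1 N,
        a * α a * PowerSeries.coeff (N - a) (evalSeries K α (annihil R a (f * g))) =
        a * α a * PowerSeries.coeff (N - a)
            (evalSeries K α (annihil R a f) * evalSeries K α g) +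
          a * α a * PowerSeries.coeff (N - a)
            (evalSeries K α (annihil R a g) * evalSeries K α f) := by
      intro a ha
      rw [Finset.mem_Icc] at ha
      rw [Derivation.leibniz, smul_eq_mul, smul_eq_mul, evalSeries_add, map_add,
        ih (N - a) (by omega), ih (N - a) (by omega), mul_comm (evalSeries K α f),
        mul_comm (evalSeries K α g)]
      ring
    rw [natCast_mul_coeff_evalSeries, Finset.sum_congr rfl h1, Finset.sum_add_distrib,
      sum_Icc_mul_coeff_mul (fun a => a * α a), sum_Icc_mul_coeff_mul (fun a => a * α a)]
    simp only [← natCast_mul_coeff_evalSeries]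
    rw [← Finset.Nat.sum_antidiagonal_swap (n := N) (f := fun q => q.1 *
      PowerSeries.coeff q.1 (evalSeries K α g) * PowerSeries.coeff q.2 (evalSeries K α f)),
      ← Finset.sum_add_distrib, PowerSeries.coeff_mul, Finset.mul_sum]
    refine Finset.sum_congr rfl fun q hq => ?_
    have hq := Finset.HasAntidiagonal.mem_antidiagonal.1 hq
    rw [← hq]
    simp only [Prod.fst_swap, Prod.snd_swap, Nat.cast_add]
    ring

/-- The substitution `p_a ↦ a α_a X^a`, `p_0 ↦ 0`, as a ring homomorphism. -/
def evalHom (K : Type*) [Field K] [CharZero K] [Algebra K R] (α : ℕ → R) :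
    MvPowerSeries ℕ R →+* PowerSeries R where
  toFun := evalSeries K α
  map_one' := by
    have := evalSeries_C (K := K) α 1
    rwa [map_one, map_one] at this
  map_mul' := evalSeries_mul α
  map_zero' := by
    have := evalSeries_C (K := K) α 0
    rwa [map_zero, map_zero] at this
  map_add' := evalSeries_add α

theorem evalHom_apply (α : ℕ → R) (f : MvPowerSeries ℕ R) :
    evalHom K α f = evalSeries K α f := rfl

theorem evalHom_C (α : ℕ → R) (c : R) : evalHom K α (MvPowerSeries.C c) = PowerSeries.C c :=
  evalSeries_C α c

theorem evalHom_X (α : ℕ → R) {b : ℕ} (hb : 0 < b) :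
    evalHom K α (MvPowerSeries.X b) = PowerSeries.monomial b (b * α b) := by
  refine evalSeries_eq_of_recursion α ?_ fun N hN => ?_
  · rw [PowerSeries.coeff_monomial, if_neg hb.ne, MvPowerSeries.coeff_zero_X]
  · have h1 : ∀ a ∈ Finset.Icc 1 N,
        a * α a * PowerSeries.coeff (N - a) (evalSeries K α (annihil R a (MvPowerSeries.X b))) =
        if b = a then b * α b * (if N = b then (b : R) else 0) else 0 := by
      intro a ha
      rw [annihil_X]
      split_ifs with h2 h3
      · subst h2 h3
        rw [Nat.sub_self, coeff_zero_evalSeries, ← map_natCast (MvPowerSeries.C (σ := ℕ) (R := R)),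
          MvPowerSeries.coeff_zero_C]
      · subst h2
        have hNb : N - b ≠ 0 := by rw [Finset.mem_Icc] at ha; omega
        rw [← map_natCast (MvPowerSeries.C (σ := ℕ) (R := R)), evalSeries_C, PowerSeries.coeff_C,
          if_neg hNb]
      · rw [← evalHom_apply, map_zero, map_zero, mul_zero]
    rw [Finset.sum_congr rfl h1, Finset.sum_ite_eq, PowerSeries.coeff_monomial]
    split_ifs with h2 h3
    · rw [h2]; ring
    · exact absurd (Finset.mem_Icc.2 ⟨hb, h2.ge⟩) h3
    · simp
    · simp

/-- Evaluation of a logarithm: if `f` solves the equations of `exp g`, so do the evaluations. -/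
theorem evalHom_eq_fexp (α : ℕ → R) {f g : MvPowerSeries ℕ R}
    (hf : MvPowerSeries.coeff 0 f = 1) (hg : MvPowerSeries.coeff 0 g = 0)
    (h : ∀ a, 0 < a → annihil R a f = f * annihil R a g) :
    evalHom K α f = fexp K (evalHom K α g) := by
  refine fexp_unique ?_ ?_ ?_
  · rw [← PowerSeries.coeff_zero_eq_constantCoeff_apply, evalHom_apply, coeff_zero_evalSeries, hg]
  · rw [← PowerSeries.coeff_zero_eq_constantCoeff_apply, evalHom_apply, coeff_zero_evalSeries, hf]
  · ext N
    have h1 : ∀ a ∈ Finset.Icc 1 (N + 1),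
        a * α a * PowerSeries.coeff (N + 1 - a) (evalSeries K α (annihil R a f)) =
        a * α a * PowerSeries.coeff (N + 1 - a)
          (evalSeries K α (annihil R a g) * evalSeries K α f) := by
      intro a ha
      rw [h a (Finset.mem_Icc.1 ha).1, evalSeries_mul, mul_comm (evalSeries K α f)]
    have h2 := natCast_mul_coeff_evalSeries K α f (N + 1)
    rw [Finset.sum_congr rfl h1, sum_Icc_mul_coeff_mul (fun a => a * α a)] at h2
    simp only [← natCast_mul_coeff_evalSeries] at h2
    rw [Finset.Nat.antidiagonal_succ, Finset.sum_cons, Nat.cast_zero, zero_mul, zero_mul, zero_add,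
      Finset.sum_map] at h2
    rw [PowerSeries.coeff_derivative, mul_comm (evalHom K α f),
      PowerSeries.coeff_mul]
    push_cast at h2
    rw [mul_comm, evalHom_apply, h2]
    refine Finset.sum_congr rfl fun q _ => ?_
    rw [PowerSeries.coeff_derivative]
    simp [evalHom_apply]
    ring

/-- The evaluation of a bosonic image is a specialization of the Schur functions. -/
theorem coeff_evalHom_boson (α : ℕ → R) (N : ℕ) : ∀ v : Fock R,
    PowerSeries.coeff N (evalHom K α (boson K v)) =
      schurPair K (fun a : ℕ => (a : R) * α a) N v := by
  induction N using Nat.strong_induction_on with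
  | _ N ih =>
  intro v
  rcases Nat.eq_zero_or_pos N with rfl | hN
  · rw [evalHom_apply, coeff_zero_evalSeries, constantCoeff_boson, Nat.cast_zero, schurPair_zero]
    rfl
  · refine eq_of_natCast_mul_eq K hN.ne' ?_
    rw [evalHom_apply, natCast_mul_coeff_evalSeries, natCast_mul_schurPair]
    refine Finset.sum_congr rfl fun a ha => ?_
    rw [Finset.mem_Icc] at ha
    have h1 := ih (N - a) (by omega) (Jop a v)
    rw [Nat.cast_sub ha.2, evalHom_apply, boson_Jop_pos K ha.1] at h1
    rw [h1]

end Evaluation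

/-! ### Taylor's formula for evaluations -/

section DiffMon

variable (K : Type*) [Field K]

/-- The factorial `∏_a e_a!` of an exponent. -/
def facts (e : ℕ →₀ ℕ) : K := e.prod fun _ k => (k.factorial : K)

/-- The product `∏_a a ^ {e_a}`. -/
def indexProd (e : ℕ →₀ ℕ) : K := e.prod fun a k => (a : K) ^ k

@[simp]
theorem facts_zero : facts K 0 = 1 := Finsupp.prod_zero_index

theorem facts_ne_zero [CharZero K] (e : ℕ →₀ ℕ) : facts K e ≠ 0 :=
  Finset.prod_ne_zero_iff.2 fun _ _ => Nat.cast_ne_zero.2 (Nat.factorial_ne_zero _)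

theorem facts_add_single (d : ℕ →₀ ℕ) (a : ℕ) :
    facts K (d + Finsupp.single a 1) = facts K d * (d a + 1) := by
  classical
  have h1 : ∀ e : ℕ →₀ ℕ, e.support ⊆ insert a d.support →
      facts K e = ∏ x ∈ insert a d.support, ((e x).factorial : K) := fun e he =>
    Finsupp.prod_of_support_subset e he _ fun _ _ => by simp
  have h2 : ∀ x ∈ insert a d.support, (((d + Finsupp.single a 1 : ℕ →₀ ℕ) x).factorial : K) =
      (d x).factorial * (if x = a then (d a : K) + 1 else 1) := by
    intro x _
    by_cases hx : x = a
    · subst hx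
      rw [Finsupp.add_apply, Finsupp.single_eq_same, Nat.factorial_succ, if_pos rfl]
      push_cast; ring
    · rw [Finsupp.add_apply, Finsupp.single_eq_of_ne hx, add_zero, if_neg hx, mul_one]
  rw [h1 d (Finset.subset_insert _ _), h1 _ ?_, Finset.prod_congr rfl h2, Finset.prod_mul_distrib,
    Finset.prod_ite_eq', if_pos (Finset.mem_insert_self _ _)]
  refine (Finsupp.support_add).trans ?_
  intro x hx
  rcases Finset.mem_union.1 hx with h | h
  · exact Finset.mem_insert_of_mem h
  · rw [Finset.mem_singleton.1 (Finsupp.support_single_subset h)]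
    exact Finset.mem_insert_self _ _

theorem indexProd_add (d e : ℕ →₀ ℕ) : indexProd K (d + e) = indexProd K d * indexProd K e :=
  Finsupp.prod_add_index' (fun _ => pow_zero _) fun _ _ _ => pow_add _ _ _

theorem indexProd_single (a : ℕ) : indexProd K (Finsupp.single a 1) = a := by
  exact (Finsupp.prod_single_index (h := fun (a k : ℕ) => (a : K) ^ k) (pow_zero _)).trans
    (pow_one _)

theorem indexProd_sum {ι : Type*} (s : Finset ι) (g : ι → ℕ) :
    indexProd K (∑ i ∈ s, Finsupp.single (g i) 1) = ∏ i ∈ s, (g i : K) := by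
  classical
  induction s using Finset.induction_on with
  | empty => simp [indexProd]
  | insert i s hi ih => rw [Finset.sum_insert hi, Finset.prod_insert hi, indexProd_add, ih,
      indexProd_single]

variable {R : Type*} [CommRing R] [Algebra K R]

/-- The differential operator `∏_a (a ∂/∂p_a)^{e_a}`, on coefficients. -/
def diffMon (e : ℕ →₀ ℕ) (f : MvPowerSeries ℕ R) : MvPowerSeries ℕ R := fun d =>
  algebraMap K R (indexProd K e * (facts K d)⁻¹ * facts K (d + e)) * MvPowerSeries.coeff (d + e) f

theorem coeff_diffMon (e : ℕ →₀ ℕ) (f : MvPowerSeries ℕ R) (d : ℕ →₀ ℕ) :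
    MvPowerSeries.coeff d (diffMon K e f) =
      algebraMap K R (indexProd K e * (facts K d)⁻¹ * facts K (d + e)) *
        MvPowerSeries.coeff (d + e) f := rfl

theorem coeff_zero_diffMon (e : ℕ →₀ ℕ) (f : MvPowerSeries ℕ R) :
    MvPowerSeries.coeff 0 (diffMon K e f) =
      algebraMap K R (indexProd K e * facts K e) * MvPowerSeries.coeff e f := by
  rw [coeff_diffMon, facts_zero, inv_one, mul_one, zero_add]

variable [CharZero K]

theorem diffMon_zero (f : MvPowerSeries ℕ R) : diffMon K 0 f = f := by
  ext d
  rw [coeff_diffMon, add_zero, mul_assoc, inv_mul_cancel₀ (facts_ne_zero K d), indexProd,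
    Finsupp.prod_zero_index, mul_one, map_one, one_mul]

theorem diffMon_single (a : ℕ) (f : MvPowerSeries ℕ R) :
    diffMon K (Finsupp.single a 1) f = annihil R a f := by
  ext d
  rw [coeff_diffMon, coeff_annihil, facts_add_single, indexProd_single, mul_assoc,
    inv_mul_cancel_left₀ (facts_ne_zero K d), map_mul, map_add, map_natCast, map_natCast, map_one,
    mul_assoc]

theorem diffMon_add (d e : ℕ →₀ ℕ) (f : MvPowerSeries ℕ R) :
    diffMon K (d + e) f = diffMon K d (diffMon K e f) := by
  ext c
  rw [coeff_diffMon, coeff_diffMon, coeff_diffMon, ← mul_assoc, ← map_mul, add_assoc]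
  congr 2
  have := facts_ne_zero K (c + d)
  rw [indexProd_add]
  field_simp

end DiffMon

section Taylor

variable (K : Type*) [Field K] [CharZero K] {R : Type*} [CommRing R] [Algebra K R]

/-- The iterated derivative at the origin in the directions `a_i`, for positive `a_i`. -/
def taylorCoeff {k : ℕ} (a : Fin k → ℕ) (f : MvPowerSeries ℕ R) : R :=
  if ∀ i, 0 < a i then MvPowerSeries.coeff 0 (diffMon K (∑ i, Finsupp.single (a i) 1) f) else 0

theorem taylorCoeff_cons {k : ℕ} (b : ℕ) (a : Fin k → ℕ) (f : MvPowerSeries ℕ R) :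
    taylorCoeff K (Fin.cons b a : Fin (k + 1) → ℕ) f =
      if 0 < b then taylorCoeff K a (annihil R b f) else 0 := by
  unfold taylorCoeff
  rw [Fin.sum_univ_succ]
  simp only [Fin.forall_fin_succ, Fin.cons_zero, Fin.cons_succ]
  rw [add_comm, diffMon_add, diffMon_single]
  split_ifs <;> first | rfl | tauto

omit [CharZero K] in
theorem taylorCoeff_comp_perm {k : ℕ} (a : Fin k → ℕ) (σ : Equiv.Perm (Fin k))
    (f : MvPowerSeries ℕ R) : taylorCoeff K (a ∘ σ) f = taylorCoeff K a f := by
  unfold taylorCoeff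
  rw [show ∑ i, Finsupp.single ((a ∘ σ) i) 1 = ∑ i, Finsupp.single (a i) 1 from
    Equiv.sum_comp σ fun i => Finsupp.single (a i) 1]
  congr 1
  exact propext ⟨fun h i => by simpa using h (σ.symm i), fun h i => h _⟩

/-- The contribution of the derivatives of order `k` to the coefficient of `X ^ N` of the
evaluation. -/
def taylorTerm (α : ℕ → R) (k N : ℕ) (f : MvPowerSeries ℕ R) : R :=
  ∑ a ∈ Finset.Nat.antidiagonalTuple k N, (∏ i, α (a i)) * taylorCoeff K a f

theorem sum_antidiagonalTuple_succ {M : Type*} [AddCommMonoid M] (k N : ℕ)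
    (h : (Fin (k + 1) → ℕ) → M) :
    ∑ a ∈ Finset.Nat.antidiagonalTuple (k + 1) N, h a =
      ∑ q ∈ Finset.HasAntidiagonal.antidiagonal N,
        ∑ b ∈ Finset.Nat.antidiagonalTuple k q.2, h (Fin.cons q.1 b) := by
  rw [Finset.sum_sigma']
  refine Finset.sum_bij' (fun a _ => ⟨(a 0, ∑ i : Fin k, a i.succ), Fin.tail a⟩)
    (fun x _ => Fin.cons x.1.1 x.2) ?_ ?_ ?_ ?_ ?_
  · intro a ha
    rw [Finset.Nat.mem_antidiagonalTuple, Fin.sum_univ_succ] at ha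
    simp only [Finset.mem_sigma, Finset.HasAntidiagonal.mem_antidiagonal,
      Finset.Nat.mem_antidiagonalTuple]
    exact ⟨ha, rfl⟩
  · rintro ⟨⟨i, j⟩, b⟩ hb
    simp only [Finset.mem_sigma, Finset.HasAntidiagonal.mem_antidiagonal,
      Finset.Nat.mem_antidiagonalTuple] at hb
    rw [Finset.Nat.mem_antidiagonalTuple, Fin.sum_univ_succ]
    simp only [Fin.cons_zero, Fin.cons_succ, hb.2, hb.1]
  · intro a _
    exact Fin.cons_self_tail a
  · rintro ⟨⟨i, j⟩, b⟩ hb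
    simp only [Finset.mem_sigma, Finset.HasAntidiagonal.mem_antidiagonal,
      Finset.Nat.mem_antidiagonalTuple] at hb
    simp only [Fin.cons_zero, Fin.cons_succ, hb.2, Fin.tail_cons]
  · intro a _
    simp only
    rw [Fin.cons_self_tail]

theorem taylorTerm_zero (α : ℕ → R) (N : ℕ) (f : MvPowerSeries ℕ R) :
    taylorTerm K α 0 N f = if N = 0 then MvPowerSeries.coeff 0 f else 0 := by
  unfold taylorTerm
  cases N with
  | zero => simp [taylorCoeff, diffMon_zero]
  | succ N => simp

omit [CharZero K] in
theorem taylorTerm_eq_zero (α : ℕ → R) {k N : ℕ} (h : N < k) (f : MvPowerSeries ℕ R) :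
    taylorTerm K α k N f = 0 := by
  refine Finset.sum_eq_zero fun a ha => ?_
  rw [Finset.Nat.mem_antidiagonalTuple] at ha
  rw [taylorCoeff, if_neg, mul_zero]
  intro hpos
  have h1 : ∑ _i : Fin k, 1 ≤ ∑ i, a i := Finset.sum_le_sum fun i _ => hpos i
  simp at h1
  omega

/-- The chain rule for the individual terms of Taylor's formula; by symmetry the first of the
`k + 1` arguments may be singled out. -/
theorem natCast_mul_taylorTerm (α : ℕ → R) (k N : ℕ) (f : MvPowerSeries ℕ R) :
    (N : R) * taylorTerm K α (k + 1) N f = (k + 1 : ℕ) * ∑ a ∈ Finset.Icc 1 N,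
      a * α a * taylorTerm K α k (N - a) (annihil R a f) := by
  have h1 : ∀ i : Fin (k + 1), ∑ a ∈ Finset.Nat.antidiagonalTuple (k + 1) N,
      (a i : R) * ((∏ i, α (a i)) * taylorCoeff K a f) =
      ∑ a ∈ Finset.Nat.antidiagonalTuple (k + 1) N,
        (a 0 : R) * ((∏ i, α (a i)) * taylorCoeff K a f) := by
    intro i
    refine Finset.sum_nbij' (fun a => a ∘ Equiv.swap 0 i) (fun a => a ∘ Equiv.swap 0 i)
      ?_ ?_ ?_ ?_ ?_
    · intro a ha
      rw [Finset.Nat.mem_antidiagonalTuple] at ha ⊢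
      rw [← ha]
      exact Equiv.sum_comp (Equiv.swap 0 i) a
    · intro a ha
      rw [Finset.Nat.mem_antidiagonalTuple] at ha ⊢
      rw [← ha]
      exact Equiv.sum_comp (Equiv.swap 0 i) a
    · intro a _; funext j; simp
    · intro a _; funext j; simp
    · intro a _
      rw [taylorCoeff_comp_perm, show ∏ j, α ((a ∘ Equiv.swap 0 i) j) = ∏ j, α (a j) from
        Equiv.prod_comp (Equiv.swap 0 i) fun j => α (a j), Function.comp_apply,
        Equiv.swap_apply_left]
  have h2 : (N : R) * taylorTerm K α (k + 1) N f = ∑ i : Fin (k + 1),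
      ∑ a ∈ Finset.Nat.antidiagonalTuple (k + 1) N,
        (a i : R) * ((∏ i, α (a i)) * taylorCoeff K a f) := by
    rw [Finset.sum_comm, taylorTerm, Finset.mul_sum]
    refine Finset.sum_congr rfl fun a ha => ?_
    rw [Finset.Nat.mem_antidiagonalTuple] at ha
    rw [← Finset.sum_mul, ← Nat.cast_sum, ha]
  rw [h2, Finset.sum_congr rfl fun i _ => h1 i, Finset.sum_const, Finset.card_univ,
    Fintype.card_fin, nsmul_eq_mul, sum_antidiagonalTuple_succ,
    Finset.Nat.sum_antidiagonal_eq_sum_range_succ_mk, Finset.sum_range_succ']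
  congr 1
  simp only [Fin.cons_zero, Nat.cast_zero, zero_mul, Finset.sum_const_zero, add_zero]
  rw [← Finset.Ico_add_one_right_eq_Icc, Finset.sum_Ico_eq_sum_range]
  refine Finset.sum_congr (by simp) fun b _ => ?_
  rw [taylorTerm, Finset.mul_sum, add_comm 1 b]
  refine Finset.sum_congr rfl fun a _ => ?_
  rw [Fin.prod_univ_succ, taylorCoeff_cons, if_pos (Nat.succ_pos b)]
  simp only [Fin.cons_zero, Fin.cons_succ]
  ring

/-- Taylor's formula for the evaluation of a power series in the `p_k`. -/
theorem coeff_evalHom_eq_sum_taylorTerm (α : ℕ → R) (N : ℕ) : ∀ (f : MvPowerSeries ℕ R) (M : ℕ),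
    N < M → PowerSeries.coeff N (evalHom K α f) =
      ∑ k ∈ Finset.range M, algebraMap K R ((k.factorial : K)⁻¹) * taylorTerm K α k N f := by
  induction N using Nat.strong_induction_on with
  | _ N ih =>
  intro f M hM
  obtain ⟨M, rfl⟩ : ∃ M', M = M' + 1 := ⟨M - 1, by omega⟩
  rw [Finset.sum_range_succ', taylorTerm_zero]
  rcases Nat.eq_zero_or_pos N with rfl | hN
  · rw [evalHom_apply, coeff_zero_evalSeries, Finset.sum_eq_zero]
    · simp
    · intro k _; rw [taylorTerm_eq_zero K α (Nat.succ_pos k), mul_zero]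
  · rw [if_neg hN.ne', mul_zero, add_zero]
    refine eq_of_natCast_mul_eq K hN.ne' ?_
    rw [evalHom_apply, natCast_mul_coeff_evalSeries, Finset.mul_sum]
    have h1 : ∀ k ∈ Finset.range M, (N : R) * (algebraMap K R (((k + 1).factorial : K)⁻¹) *
        taylorTerm K α (k + 1) N f) = ∑ a ∈ Finset.Icc 1 N, a * α a *
          (algebraMap K R ((k.factorial : K)⁻¹) * taylorTerm K α k (N - a) (annihil R a f)) := by
      intro k _
      have h4 : algebraMap K R (((k + 1).factorial : K)⁻¹) * ((k + 1 : ℕ) : R) =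
          algebraMap K R ((k.factorial : K)⁻¹) := by
        rw [← map_natCast (algebraMap K R), ← map_mul]
        congr 1
        have f1 : (k.factorial : K) ≠ 0 := Nat.cast_ne_zero.2 (Nat.factorial_ne_zero _)
        have f2 : ((k + 1 : ℕ) : K) ≠ 0 := Nat.cast_ne_zero.2 (Nat.succ_ne_zero _)
        rw [Nat.factorial_succ, Nat.cast_mul]
        field_simp
      rw [mul_left_comm, natCast_mul_taylorTerm, ← mul_assoc, h4, Finset.mul_sum]
      exact Finset.sum_congr rfl fun a _ => mul_left_comm _ _ _
    rw [Finset.sum_congr rfl h1, Finset.sum_comm]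
    refine Finset.sum_congr rfl fun a ha => ?_
    rw [Finset.mem_Icc] at ha
    rw [← Finset.mul_sum, ← ih (N - a) (by omega) (annihil R a f) M (by omega), evalHom_apply]

end Taylor

/-! ### The functions `T` as evaluations -/

section ConnectedSeries

variable {K : Type*} [Field K] [CharZero K]

/-- The logarithm of the partition function, regarded as a power series over `K((ħ))⟦u⟧`. -/
def logScal (ψ y : PowerSeries (PowerSeries K)) : MvPowerSeries ℕ (Scal K) :=
  logSeries K (partitionScal ψ y - 1)

theorem coeff_zero_partitionScal_sub_one (ψ y : PowerSeries (PowerSeries K)) :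
    MvPowerSeries.coeff 0 (partitionScal ψ y - 1) = 0 := by
  rw [map_sub, constantCoeff_partitionScal, MvPowerSeries.coeff_zero_one, sub_self]

omit [CharZero K] in
theorem coeff_zero_logScal (ψ y : PowerSeries (PowerSeries K)) :
    MvPowerSeries.coeff 0 (logScal ψ y) = 0 := by
  change MvPowerSeries.coeff 0 (logTrunc K (Finsupp.degree (0 : ℕ →₀ ℕ))
    (partitionScal ψ y - 1)) = 0
  rw [map_zero]
  simp [logTrunc]

omit [CharZero K] in
theorem coeff_logScal (ψ y : PowerSeries (PowerSeries K)) (d : ℕ →₀ ℕ) :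
    MvPowerSeries.coeff d (logScal ψ y) = PowerSeries.C (MvPowerSeries.coeff d (logZ ψ y)) := by
  change MvPowerSeries.coeff d (logTrunc K d.degree (partitionScal ψ y - 1)) =
    PowerSeries.C (logZ ψ y d)
  rw [logTrunc, logZ, map_sum, map_sum]
  refine Finset.sum_congr rfl fun q _ => ?_
  have h1 : (partitionScal ψ y - 1) ^ q =
      MvPowerSeries.map PowerSeries.C ((partitionFunction ψ y - 1) ^ q) := by
    rw [map_pow, map_sub, map_one, partitionScal]
  rw [coeff_algebraMap_mul, h1, MvPowerSeries.coeff_map, laurent_smul_def, map_mul,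
    PowerSeries.algebraMap_apply]

/-- The partition function solves the differential equations of the exponential of its
logarithm. -/
theorem annihil_partitionScal (ψ y : PowerSeries (PowerSeries K)) (a : ℕ) :
    annihil (Scal K) a (partitionScal ψ y) =
      partitionScal ψ y * annihil (Scal K) a (logScal ψ y) := by
  have h1 := pderiv_logSeries (K := K) (coeff_zero_partitionScal_sub_one ψ y) a
  rw [add_sub_cancel, map_sub, Derivation.map_one_eq_zero, sub_zero] at h1
  rw [annihil, Derivation.smul_apply, Derivation.smul_apply, ← h1, mul_smul_comm, logScal]

omit [CharZero K] in
/-- The regular part of the functions `W_n` is a derivative of the logarithm at the origin. -/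
theorem C_regW (ψ y : PowerSeries (PowerSeries K)) {ι : Type*} [Fintype ι] {m : ι → ℤ}
    (hm : ∀ i, 0 < m i) : PowerSeries.C (regW ψ y m) = MvPowerSeries.coeff 0
      (diffMon K (∑ i, Finsupp.single (m i).toNat 1) (logScal ψ y)) := by
  have h1 : ∏ i, (m i : K) = ∏ i, ((m i).toNat : K) := Finset.prod_congr rfl fun i _ => by
    rw [← Int.cast_natCast, Int.toNat_of_nonneg (hm i).le]
  rw [coeff_zero_diffMon, coeff_logScal, regW, if_pos hm]
  simp only
  rw [laurent_smul_def, map_mul, indexProd_sum, h1, PowerSeries.algebraMap_apply]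
  rfl

/-- The series whose value at the origin is the connected correlator of the currents with
indices `m_i`, `i ∈ l`: a negative index stands for the variable `p_{-m}`, on which the
annihilation operators to the left of it act. -/
def connSeries (ψ y : PowerSeries (PowerSeries K)) {ι : Type*} (m : ι → ℤ) :
    List ι → MvPowerSeries ℕ (Scal K)
  | [] => logScal ψ y
  | i :: l => if 0 < m i then annihil (Scal K) (m i).toNat (connSeries ψ y m l)
      else if l = [] ∧ m i < 0 then MvPowerSeries.X (-m i).toNat else 0

theorem connSeries_of_pos (ψ y : PowerSeries (PowerSeries K)) {ι : Type*} (m : ι → ℤ)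
    {l : List ι} (hl : ∀ i ∈ l, 0 < m i) : connSeries ψ y m l =
      diffMon K (l.map fun i => Finsupp.single (m i).toNat 1).sum (logScal ψ y) := by
  induction l with
  | nil => rw [connSeries, List.map_nil, List.sum_nil, diffMon_zero]
  | cons i l ih =>
    rw [connSeries, if_pos (hl i List.mem_cons_self),
      ih fun j hj => hl j (List.mem_cons_of_mem i hj),
      List.map_cons, List.sum_cons, diffMon_add, diffMon_single]

omit [CharZero K] in
/-- With at least two currents, one of which is not an annihilation operator, the connected
series is constant. -/
theorem connSeries_eq_C (ψ y : PowerSeries (PowerSeries K)) {ι : Type*} (m : ι → ℤ) :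
    ∀ {l : List ι}, 2 ≤ l.length → (∃ i ∈ l, m i ≤ 0) →
      ∃ c, connSeries ψ y m l = MvPowerSeries.C c
  | [], h, _ => by simp at h
  | [_], h, _ => by simp at h
  | [i, j], _, h => by
    rw [connSeries]
    split_ifs with h1 h2
    · have hj : ¬ 0 < m j := by
        rcases h with ⟨k, hk, hk'⟩
        simp only [List.mem_cons, List.not_mem_nil, or_false] at hk
        rcases hk with rfl | rfl <;> omega
      rw [connSeries, if_neg hj]
      split_ifs with h3
      · rw [annihil_X]
        split_ifs
        · exact ⟨((m i).toNat : Scal K), (map_natCast _ _).symm⟩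
        · exact ⟨0, (map_zero _).symm⟩
      · exact ⟨0, by rw [map_zero, map_zero]⟩
    · exact absurd h2.1 (by simp)
    · exact ⟨0, (map_zero _).symm⟩
  | i :: j :: k :: l, _, h => by
    rw [connSeries]
    split_ifs with h1 h2
    · obtain ⟨c, hc⟩ := connSeries_eq_C ψ y m (l := j :: k :: l) (by simp) (by
        rcases h with ⟨a, ha, ha'⟩
        rcases List.mem_cons.1 ha with rfl | ha
        · omega
        · exact ⟨a, ha, ha'⟩)
      rw [hc]
      exact ⟨0, by rw [map_zero]; exact (annihil (Scal K) _).map_algebraMap c⟩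
    · exact absurd h2.1 (by simp)
    · exact ⟨0, (map_zero _).symm⟩

/-- The weights `uħ𝒮(a uħ)` of the evaluation that produces the functions `T`. -/
def evalWeight (K : Type*) [Field K] (a : ℕ) : Scal K := uh K * sAt (a : K)

theorem coeffW_of_pos (ψ y : PowerSeries (PowerSeries K)) {n k : ℕ} {J : Finset (Fin n)}
    (a : Fin k → ℕ) {m : Fin n → ℤ} (hJ : ∀ j ∈ J, 0 < m j) :
    PowerSeries.C (coeffW ψ y J (fun i => (a i : ℤ)) m) =
      taylorCoeff K a (connSeries ψ y m (J.sort (· ≤ ·))) := by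
  have hsing : (if k = 1 ∧ J.card = 1 then ∑ i : Fin k, ∑ j ∈ J,
      (sing ((a i : ℕ) : ℤ) (m j) : LaurentSeries K) else 0) = 0 := by
    refine ite_eq_right_iff.2 fun _ => Finset.sum_eq_zero fun i _ => Finset.sum_eq_zero
      fun j hj => if_neg ?_
    have := hJ j hj
    omega
  have hsum : ∑ j : J, Finsupp.single (m j).toNat 1 =
      ((J.sort (· ≤ ·)).map fun i => Finsupp.single (m i).toNat 1).sum := by
    rw [Finset.univ_eq_attach, Finset.sum_attach J fun j => Finsupp.single (m j).toNat 1,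
      ← Multiset.sum_coe, ← Multiset.map_coe, Finset.sort_eq]
    rfl
  rw [coeffW, hsing, add_zero, taylorCoeff]
  split_ifs with ha
  · rw [C_regW, connSeries_of_pos ψ y m fun j hj => hJ j ((Finset.mem_sort _).1 hj), ← diffMon_add,
      Fintype.sum_sum_type, ← hsum]
    · simp only [Sum.elim_inl, Sum.elim_inr, Int.toNat_natCast]
    · rintro (i | j)
      · exact Int.natCast_pos.2 (ha i)
      · exact hJ j j.2
  · rw [regW, if_neg, map_zero]
    exact fun h => ha fun i => Int.natCast_pos.1 (h (Sum.inl i))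

omit [CharZero K] in
theorem regW_of_nonpos (ψ y : PowerSeries (PowerSeries K)) {n k : ℕ} {J : Finset (Fin n)}
    (a : Fin k → ℤ) {m : Fin n → ℤ} {j : Fin n} (hj : j ∈ J) (hm : m j ≤ 0) :
    regW ψ y (Sum.elim a (fun j : J => m j)) = 0 := by
  rw [regW, if_neg]
  intro h
  have := h (Sum.inr ⟨j, hj⟩)
  simp only [Sum.elim_inr] at this
  omega

theorem coeff_seriesT (ψ y : PowerSeries (PowerSeries K)) {n : ℕ} (J : Finset (Fin n))
    (m : Fin n → ℤ) {N : ℕ} (hN : 0 < N) : PowerSeries.coeff N (seriesT ψ y J m) =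
      PowerSeries.coeff N
        (evalHom K (evalWeight K) (connSeries ψ y m (J.sort (· ≤ ·)))) := by
  rw [seriesT, PowerSeries.coeff_mk]
  by_cases hJ : ∀ j ∈ J, 0 < m j
  · rw [coeff_evalHom_eq_sum_taylorTerm K _ N _ (N + 1) (Nat.lt_succ_self N),
      Finset.sum_range_succ', taylorTerm_zero, if_neg hN.ne', mul_zero, add_zero,
      ← Finset.Ico_add_one_right_eq_Icc, Finset.sum_Ico_eq_sum_range]
    refine Finset.sum_congr (by simp) fun k _ => ?_
    rw [add_comm 1 k, Algebra.smul_def, taylorTerm]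
    refine congrArg (algebraMap K (Scal K) _ * ·) (Finset.sum_congr rfl fun a _ => ?_)
    exact congrArg ((∏ i, uh K * sAt ((a i : ℕ) : K)) * ·) (coeffW_of_pos ψ y a hJ)
  · push Not at hJ
    obtain ⟨j, hj, hm⟩ := hJ
    have hcard : 0 < J.card := Finset.card_pos.2 ⟨j, hj⟩
    rcases Nat.lt_or_ge 1 J.card with h2 | h2
    · obtain ⟨c, hc⟩ := connSeries_eq_C ψ y m (l := J.sort (· ≤ ·)) (by rwa [Finset.length_sort])
        ⟨j, (Finset.mem_sort _).2 hj, hm⟩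
      rw [hc, evalHom_C, PowerSeries.coeff_C, if_neg hN.ne']
      refine Finset.sum_eq_zero fun k _ => ?_
      rw [Finset.sum_eq_zero, Algebra.smul_def, mul_zero]
      intro a _
      rw [coeffW, regW_of_nonpos ψ y _ hj hm, if_neg (by omega), add_zero, map_zero, mul_zero]
    · obtain rfl : J = {j} := by
        obtain ⟨j', hj'⟩ := Finset.card_eq_one.1 (le_antisymm h2 hcard)
        subst hj'
        rw [Finset.mem_singleton.1 hj]
      have hT : ∀ k ∈ Finset.Icc 1 N, ((k.factorial : K)⁻¹) •
          ∑ a ∈ Finset.Nat.antidiagonalTuple k N, (∏ i, uh K * sAt ((a i : ℕ) : K)) *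
            PowerSeries.C (coeffW ψ y {j} (fun i => (a i : ℤ)) m) =
          if k = 1 then evalWeight K N * PowerSeries.C (sing N (m j)) else 0 := by
        intro k _
        split_ifs with hk
        · subst hk
          rw [Finset.Nat.antidiagonalTuple_one, Finset.sum_singleton, Nat.factorial_one,
            Nat.cast_one, inv_one, Algebra.smul_def, map_one, one_mul, coeffW,
            regW_of_nonpos ψ y _ hj hm]
          simp [evalWeight]
        · rw [Finset.sum_eq_zero, Algebra.smul_def, mul_zero]
          intro a _
          rw [coeffW, regW_of_nonpos ψ y _ hj hm, if_neg (by tauto), add_zero, map_zero, mul_zero]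
      rw [Finset.sum_congr rfl hT, Finset.sum_ite_eq', if_pos (Finset.mem_Icc.2 ⟨le_rfl, hN⟩),
        Finset.sort_singleton, connSeries, if_neg (by omega)]
      -- the singular part of `W_2` is the linear term `p_{-m_j}` of the connected series
      by_cases h0 : m j < 0
      · rw [if_pos (⟨rfl, h0⟩ : ([] : List (Fin n)) = [] ∧ m j < 0), evalHom_X _ (by omega),
          PowerSeries.coeff_monomial, sing]
        by_cases h3 : N = (-m j).toNat
        · rw [if_pos (by omega), if_pos h3, ← h3, laurent_smul_def, mul_one, Int.cast_natCast,
            map_natCast, map_natCast, mul_comm]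
        · rw [if_neg (by omega), if_neg h3, map_zero, mul_zero]
      · rw [if_neg (fun h : ([] : List (Fin n)) = [] ∧ m j < 0 => h0 h.2), sing,
          if_neg (by omega), map_zero, map_zero, map_zero, mul_zero]

/-- The series `T` are the evaluations of the connected series, without their values at the
origin. -/
theorem seriesT_eq (ψ y : PowerSeries (PowerSeries K)) {n : ℕ} (J : Finset (Fin n))
    (m : Fin n → ℤ) : evalHom K (evalWeight K) (connSeries ψ y m (J.sort (· ≤ ·))) =
      seriesT ψ y J m +
        PowerSeries.C (MvPowerSeries.coeff 0 (connSeries ψ y m (J.sort (· ≤ ·)))) := by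
  ext1 N
  rw [map_add, PowerSeries.coeff_C]
  rcases Nat.eq_zero_or_pos N with rfl | hN
  · rw [evalHom_apply, coeff_zero_evalSeries, if_pos rfl, seriesT, PowerSeries.coeff_mk]
    simp
  · rw [coeff_seriesT ψ y J m hN, if_neg hN.ne', add_zero]

end ConnectedSeries

/-! ### The exponential relation between set functions -/

section ExpRelation

open Finset

variable {ι B : Type*} [LinearOrder ι] [CommRing B]

theorem coeff_ind_mul_congr {f f' g g' : MvPowerSeries ι B} {I : Finset ι}
    (hf : ∀ A ⊆ I, MvPowerSeries.coeff (ind A) f = MvPowerSeries.coeff (ind A) f')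
    (hg : ∀ A ⊆ I, MvPowerSeries.coeff (ind A) g = MvPowerSeries.coeff (ind A) g') :
    MvPowerSeries.coeff (ind I) (f * g) = MvPowerSeries.coeff (ind I) (f' * g') := by
  rw [coeff_ind_mul, coeff_ind_mul]
  exact sum_congr rfl fun A hA => by rw [hf A (mem_powerset.1 hA), hg _ sdiff_subset]

/-- Subset convolution. -/
def conv (f g : Finset ι → B) (I : Finset ι) : B :=
  ∑ A ∈ I.powerset, f A * g (I \ A)

theorem coeff_ind_hat_mul_hat (f g : Finset ι → B) (I : Finset ι) :
    MvPowerSeries.coeff (ind I) (hat f * hat g) = conv f g I := by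
  rw [coeff_ind_mul, conv]
  exact sum_congr rfl fun A _ => by rw [coeff_ind_hat, coeff_ind_hat]

theorem conv_empty (f g : Finset ι → B) : conv f g ∅ = f ∅ * g ∅ := by
  simp [conv]

/-- The relation `f(i ∪ I) = ∑_{A ⊆ I} g(i ∪ A) f(I \ A)` for `i` smaller than all elements of
`I`. It says that `f(I)` is `f(∅)` times the sum of `∏ g(B)` over the set partitions of `I` into
blocks `B`: the generating function of `f` is proportional to the exponential of that of `g`. -/
def IsExp (f g : Finset ι → B) : Prop :=
  ∀ (i : ι) (I : Finset ι), (∀ j ∈ I, i < j) →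
    f (insert i I) = conv (fun A => g (insert i A)) f I

/-- The exponential relation is a recursion on the number of elements. -/
theorem IsExp.unique {f f' g : Finset ι → B} (h : IsExp f g) (h' : IsExp f' g) (h0 : f ∅ = f' ∅) :
    f = f' := by
  funext I
  induction I using Finset.strongInduction with
  | _ I ih =>
  rcases I.eq_empty_or_nonempty with rfl | hI
  · exact h0
  · set i := I.min' hI with hi
    have hmem : i ∈ I := I.min'_mem hI
    have hlt : ∀ j ∈ I.erase i, i < j := fun j hj => I.min'_lt_of_mem_erase_min' hI hj
    rw [← insert_erase hmem, h _ _ hlt, h' _ _ hlt]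
    exact sum_congr rfl fun A _ => by
      rw [ih (I.erase i \ A) (lt_of_le_of_lt sdiff_subset (erase_ssubset hmem))]

theorem IsExp.map {C : Type*} [CommRing C] (φ : B →+* C) {f g : Finset ι → B} (h : IsExp f g) :
    IsExp (fun I => φ (f I)) (fun I => φ (g I)) := by
  intro i I hI
  simp only [h i I hI, conv, map_sum, map_mul]

/-- Products of exponentials are exponentials of sums. -/
theorem IsExp.conv {f f' g g' : Finset ι → B} (h : IsExp f g) (h' : IsExp f' g') :
    IsExp (conv f f') (fun A => g A + g' A) := by
  intro i I hI
  have hi : i ∉ I := fun h => lt_irrefl i (hI i h)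
  have key : ∀ {u v : Finset ι → B}, IsExp u v → ∀ A ⊆ I,
      MvPowerSeries.coeff (ind A) (MvPowerSeries.pderiv B i (hat u)) =
        MvPowerSeries.coeff (ind A) (hat (fun A => v (insert i A)) * hat u) := by
    intro u v huv A hA
    rw [coeff_ind_pderiv _ fun h => hi (hA h), coeff_ind_hat,
      huv i A fun j hj => hI j (hA hj), coeff_ind_hat_mul_hat]
  have h1 : MvPowerSeries.coeff (ind I) (hat (fun A => g (insert i A) + g' (insert i A)) *
      (hat f * hat f')) = HypKP.conv (fun A => g (insert i A) + g' (insert i A))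
        (HypKP.conv f f') I := by
    rw [coeff_ind_mul, HypKP.conv]
    exact sum_congr rfl fun A _ => by rw [coeff_ind_hat, coeff_ind_hat_mul_hat]
  have h2 : MvPowerSeries.coeff (ind I) (hat (fun A => g (insert i A) + g' (insert i A)) *
      (hat f * hat f')) = MvPowerSeries.coeff (ind I)
        ((hat (fun A => g (insert i A)) + hat (fun A => g' (insert i A))) * (hat f * hat f')) := by
    refine coeff_ind_mul_congr (fun A _ => ?_) fun _ _ => rfl
    rw [map_add, coeff_ind_hat, coeff_ind_hat, coeff_ind_hat]
  rw [← coeff_ind_hat_mul_hat, ← coeff_ind_pderiv _ hi, Derivation.leibniz, smul_eq_mul,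
    smul_eq_mul, map_add, coeff_ind_mul_congr (fun _ _ => rfl) (key h'),
    coeff_ind_mul_congr (fun _ _ => rfl) (key h), ← h1, h2, ← map_add]
  congr 1
  ring

/-- A derivation of the values of a set function that is given by the exponential formula. -/
theorem derivation_insert {R : Type*} [CommRing R] [Algebra R B] (δ : Derivation R B B)
    {f g : Finset ι → B} {i : ι} {I : Finset ι} (hi : i ∉ I)
    (h1 : ∀ A ⊆ I, f (insert i A) = conv (fun C => g (insert i C)) f A)
    (h2 : ∀ A ⊆ I, δ (f A) = conv (fun C => δ (g C)) f A) :
    δ (f (insert i I)) = conv (fun C => δ (g C)) f (insert i I) := by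
  have e1 : ∀ A ⊆ I, MvPowerSeries.coeff (ind A) (MvPowerSeries.pderiv B i (hat f)) =
      MvPowerSeries.coeff (ind A) (hat (fun A => g (insert i A)) * hat f) := by
    intro A hA
    rw [coeff_ind_pderiv _ fun h => hi (hA h), coeff_ind_hat, h1 A hA, coeff_ind_hat_mul_hat]
  have e2 : ∀ A ⊆ I, MvPowerSeries.coeff (ind A)
      (MvPowerSeries.pderiv B i (hat fun C => δ (g C))) =
      MvPowerSeries.coeff (ind A) (hat fun C => δ (g (insert i C))) := by
    intro A hA
    rw [coeff_ind_pderiv _ fun h => hi (hA h), coeff_ind_hat, coeff_ind_hat]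
  have e3 : ∀ A ⊆ I, MvPowerSeries.coeff (ind A) (hat fun C => δ (f C)) =
      MvPowerSeries.coeff (ind A) (hat (fun C => δ (g C)) * hat f) := by
    intro A hA
    rw [coeff_ind_hat, h2 A hA, coeff_ind_hat_mul_hat]
  have e4 : δ (f (insert i I)) = MvPowerSeries.coeff (ind I)
      (hat (fun C => g (insert i C)) * hat (fun C => δ (f C)) +
        hat f * hat fun C => δ (g (insert i C))) := by
    rw [h1 I subset_rfl, conv, map_sum, map_add, coeff_ind_hat_mul_hat,
      mul_comm (hat f), coeff_ind_hat_mul_hat, conv, conv, ← sum_add_distrib]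
    refine sum_congr rfl fun A _ => ?_
    rw [Derivation.leibniz, smul_eq_mul, smul_eq_mul]
    ring
  rw [e4, ← coeff_ind_hat_mul_hat, ← coeff_ind_pderiv _ hi, Derivation.leibniz, smul_eq_mul,
    smul_eq_mul, map_add, map_add, coeff_ind_mul_congr (fun _ _ => rfl) e3,
    coeff_ind_mul_congr (fun _ _ => rfl) e1, coeff_ind_mul_congr (fun _ _ => rfl) e2]
  congr 2
  ring

end ExpRelation

section Currents

open Finset

variable {K : Type*} [Field K] [CharZero K] (ψ y : PowerSeries (PowerSeries K))

/-- The bosonic image of a product of currents applied to the vector `G|0⟩`. -/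
def currentSeries {ι : Type*} (m : ι → ℤ) : List ι → MvPowerSeries ℕ (Scal K)
  | [] => partitionScal ψ y
  | i :: l => if 0 < m i then annihil (Scal K) (m i).toNat (currentSeries m l)
      else if m i < 0 then MvPowerSeries.X (-m i).toNat * currentSeries m l else 0

/-- Under the boson–fermion correspondence annihilation operators become derivations and
creation operators become variables. -/
theorem boson_foldr_Jop {ι : Type*} (m : ι → ℤ) (l : List ι) :
    boson K (l.foldr (fun i v => Jop (m i) v) (Gop ψ y (vacVec (Scal K)))) =
      currentSeries ψ y m l := by
  induction l with
  | nil => exact boson_Gop_vac ψ y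
  | cons i l ih =>
    rw [List.foldr_cons, currentSeries, ← ih]
    split_ifs with h1 h2
    · rw [← boson_Jop_pos K (by omega), Int.toNat_of_nonneg h1.le]
    · rw [← boson_Jop_neg K (by omega), Int.toNat_of_nonneg (by omega), neg_neg]
    · rw [show m i = 0 by omega, boson_Jop_zero]

theorem sort_insert_of_lt {ι : Type*} [LinearOrder ι] {i : ι} {I : Finset ι}
    (hI : ∀ j ∈ I, i < j) : (insert i I).sort (· ≤ ·) = i :: I.sort (· ≤ ·) :=
  Finset.sort_insert (· ≤ ·) (fun j hj => (hI j hj).le) fun h => lt_irrefl i (hI i h)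

/-- The currents and the connected series satisfy the exponential relation. -/
theorem isExp_currentSeries {ι : Type*} [LinearOrder ι] (m : ι → ℤ) :
    IsExp (fun I : Finset ι => currentSeries ψ y m (I.sort (· ≤ ·)))
      (fun I => connSeries ψ y m (I.sort (· ≤ ·))) := by
  set F := fun I : Finset ι => currentSeries ψ y m (I.sort (· ≤ ·)) with hF
  set S := fun I : Finset ι => connSeries ψ y m (I.sort (· ≤ ·)) with hS
  -- an annihilation operator in front needs the derivatives of the shorter products, a creation
  -- operator only contributes the singleton block
  have step : ∀ (i : ι) (I : Finset ι), (∀ j ∈ I, i < j) →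
      (∀ a, annihil (Scal K) a (F I) = conv (fun A => annihil (Scal K) a (S A)) F I) →
      F (insert i I) = conv (fun A => S (insert i A)) F I := by
    intro i I hI hD
    have hSi : ∀ A ∈ I.powerset, S (insert i A) =
        if 0 < m i then annihil (Scal K) (m i).toNat (S A)
        else if A = ∅ ∧ m i < 0 then MvPowerSeries.X (-m i).toNat else 0 := by
      intro A hA
      have : A.sort (· ≤ ·) = [] ↔ A = ∅ := by
        rw [← List.length_eq_zero_iff, Finset.length_sort, Finset.card_eq_zero]
      simp only [hS]
      rw [sort_insert_of_lt fun j hj => hI j (mem_powerset.1 hA hj), connSeries]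
      simp only [this]
    have hFi : F (insert i I) = if 0 < m i then annihil (Scal K) (m i).toNat (F I)
        else if m i < 0 then MvPowerSeries.X (-m i).toNat * F I else 0 := by
      simp only [hF]
      rw [sort_insert_of_lt hI, currentSeries]
    rw [hFi, conv]
    split_ifs with h1 h2
    · rw [hD]
      exact sum_congr rfl fun A hA => by rw [hSi A hA, if_pos h1]
    · rw [sum_eq_single ∅]
      · rw [hSi ∅ (empty_mem_powerset _), if_neg h1, if_pos ⟨rfl, h2⟩, sdiff_empty]
      · intro A hA hne
        rw [hSi A hA, if_neg h1, if_neg fun h => hne h.1, zero_mul]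
      · exact fun h => absurd (empty_mem_powerset _) h
    · symm
      refine sum_eq_zero fun A hA => ?_
      rw [hSi A hA, if_neg h1, if_neg fun h => h2 h.2, zero_mul]
  have hD : ∀ I : Finset ι, ∀ A ⊆ I, ∀ a,
      annihil (Scal K) a (F A) = conv (fun C => annihil (Scal K) a (S C)) F A := by
    intro I
    induction I using Finset.induction_on_min with
    | empty =>
      intro A hA a
      rw [subset_empty.1 hA, conv_empty]
      simp only [hF, hS, Finset.sort_empty, currentSeries, connSeries]
      rw [annihil_partitionScal, mul_comm]
    | insert i I hI ih =>
      intro A hA a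
      by_cases hi : i ∈ A
      · have hsub : A.erase i ⊆ I := by
          intro j hj
          rcases mem_insert.1 (hA (mem_of_mem_erase hj)) with h | h
          · exact absurd h (ne_of_mem_erase hj)
          · exact h
        rw [← insert_erase hi]
        refine derivation_insert _ (notMem_erase i A) (fun C hC => ?_) fun C hC =>
          ih C (hC.trans hsub) a
        exact step i C (fun j hj => hI j (hsub (hC hj))) (ih C (hC.trans hsub))
      · exact ih A (fun j hj => ((mem_insert.1 (hA hj)).resolve_left fun h => hi (h ▸ hj))) a
  exact fun i I hI => step i I hI (hD I I subset_rfl)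

end Currents

/-! ### The generating function of the products of the `T` -/

section ExpSeries

open Finset

variable {K : Type*} [Field K] [CharZero K] {R : Type*} [CommRing R] [Algebra K R]
  {ι : Type*} [LinearOrder ι]

/-- The truncated exponential `∑_{l < M} x^l / l!`. -/
def expTrunc (K : Type*) [Field K] {A : Type*} [CommRing A] [Algebra K A] (M : ℕ) (x : A) : A :=
  ∑ l ∈ range M, algebraMap K A ((l.factorial : K)⁻¹) * x ^ l

omit [LinearOrder ι] in
/-- Differentiation lowers the truncation of the exponential by one. -/
theorem pderiv_expTrunc_succ (M : ℕ) (x : MvPowerSeries ι (PowerSeries R)) (i : ι) :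
    MvPowerSeries.pderiv (PowerSeries R) i (expTrunc K (M + 1) x) =
      expTrunc K M x * MvPowerSeries.pderiv (PowerSeries R) i x := by
  set δ := MvPowerSeries.pderiv (PowerSeries R) i
  have hC : ∀ c : K, δ (algebraMap K (MvPowerSeries ι (PowerSeries R)) c) = 0 := fun c => by
    rw [MvPowerSeries.algebraMap_apply]
    exact δ.map_algebraMap _
  rw [expTrunc, expTrunc, map_sum, sum_range_succ', Derivation.leibniz, hC, smul_zero, pow_zero,
    Derivation.map_one_eq_zero, smul_zero, add_zero, add_zero, sum_mul]
  refine sum_congr rfl fun l _ => ?_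
  have f1 : (l.factorial : K) ≠ 0 := Nat.cast_ne_zero.2 (Nat.factorial_ne_zero _)
  have f2 : ((l + 1 : ℕ) : K) ≠ 0 := Nat.cast_ne_zero.2 (Nat.succ_ne_zero _)
  have f3 : (((l + 1).factorial : K)⁻¹) * ((l + 1 : ℕ) : K) = ((l.factorial : K)⁻¹) := by
    rw [Nat.factorial_succ, Nat.cast_mul]
    field_simp
  rw [Derivation.leibniz, hC, smul_zero, add_zero, Derivation.leibniz_pow, smul_eq_mul,
    nsmul_eq_mul, smul_eq_mul, Nat.add_sub_cancel, ← f3, map_mul, map_natCast]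
  ring

/-- Powers of a generating function of series without constant term. -/
theorem coeff_ind_hat_pow_eq_zero {T : Finset ι → PowerSeries R}
    (hT : ∀ J, PowerSeries.coeff 0 (T J) = 0) {l N : ℕ} (h : N < l) (I : Finset ι) :
    PowerSeries.coeff N (MvPowerSeries.coeff (ind I) (hat T ^ l)) = 0 := by
  -- the generating function is divisible by the variable of the coefficient ring
  have h1 : hat T = MvPowerSeries.C PowerSeries.X *
      hat (fun J => PowerSeries.mk fun n => PowerSeries.coeff (n + 1) (T J)) := by
    ext1 d
    rw [MvPowerSeries.coeff_C_mul]
    change (if ind d.support = d then T d.support else 0) = PowerSeries.X *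
      (if ind d.support = d then _ else 0)
    split_ifs
    · ext n
      cases n with
      | zero => rw [hT, PowerSeries.coeff_zero_X_mul]
      | succ n => rw [PowerSeries.coeff_succ_X_mul, PowerSeries.coeff_mk]
    · rw [mul_zero]
  rw [h1, mul_pow, ← map_pow, MvPowerSeries.coeff_C_mul, PowerSeries.coeff_X_pow_mul',
    if_neg (by omega)]

/-- The coefficients of the exponential of the generating function of the series `T(J)`, for
series without constant term. -/
def expSet (K : Type*) [Field K] [Algebra K R] (T : Finset ι → PowerSeries R) (I : Finset ι) :
    PowerSeries R :=
  PowerSeries.mk fun N =>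
    PowerSeries.coeff N (MvPowerSeries.coeff (ind I) (expTrunc K (N + 1) (hat T)))

omit [CharZero K] [LinearOrder ι] in
theorem coeff_ind_algebraMap_mul (c : K) (f : MvPowerSeries ι (PowerSeries R)) (I : Finset ι)
    (N : ℕ) : PowerSeries.coeff N (MvPowerSeries.coeff (ind I)
      (algebraMap K (MvPowerSeries ι (PowerSeries R)) c * f)) =
      algebraMap K R c * PowerSeries.coeff N (MvPowerSeries.coeff (ind I) f) := by
  rw [coeff_algebraMap_mul, PowerSeries.algebraMap_apply, PowerSeries.coeff_C_mul]

omit [CharZero K] in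
theorem coeff_expSet {T : Finset ι → PowerSeries R} (hT : ∀ J, PowerSeries.coeff 0 (T J) = 0)
    {N M : ℕ} (h : N < M) (I : Finset ι) : PowerSeries.coeff N (expSet K T I) =
      PowerSeries.coeff N (MvPowerSeries.coeff (ind I) (expTrunc K M (hat T))) := by
  rw [expSet, PowerSeries.coeff_mk, expTrunc, expTrunc, map_sum, map_sum, map_sum, map_sum]
  refine sum_subset (range_mono h) fun l _ hl => ?_
  rw [coeff_ind_algebraMap_mul, coeff_ind_hat_pow_eq_zero hT (by simpa using hl), mul_zero]

theorem isExp_expSet {T : Finset ι → PowerSeries R} (hT : ∀ J, PowerSeries.coeff 0 (T J) = 0) :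
    IsExp (expSet K T) T := by
  intro i I hI
  have hi : i ∉ I := fun h => lt_irrefl i (hI i h)
  ext N
  rw [coeff_expSet hT (show N < N + 2 by omega), ← coeff_ind_pderiv _ hi, pderiv_expTrunc_succ,
    mul_comm, coeff_ind_mul, conv, map_sum, map_sum]
  refine sum_congr rfl fun A hA => ?_
  rw [coeff_ind_pderiv _ fun h => hi (mem_powerset.1 hA h), coeff_ind_hat, PowerSeries.coeff_mul,
    PowerSeries.coeff_mul]
  refine sum_congr rfl fun q hq => ?_
  have hq := HasAntidiagonal.mem_antidiagonal.1 hq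
  rw [coeff_expSet hT (show q.2 < N + 1 by omega)]

omit [CharZero K] in
theorem expSet_empty (T : Finset ι → PowerSeries R) : expSet K T ∅ = fexp K (T ∅) := by
  ext N
  rw [expSet, fexp, PowerSeries.coeff_mk, PowerSeries.coeff_mk, expTrunc, map_sum, map_sum]
  refine sum_congr rfl fun l _ => ?_
  rw [coeff_ind_algebraMap_mul, Algebra.smul_def, ind_empty]
  congr 2
  rw [MvPowerSeries.coeff_zero_eq_constantCoeff_apply, map_pow,
    ← MvPowerSeries.coeff_zero_eq_constantCoeff_apply, ← ind_empty, coeff_ind_hat]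

end ExpSeries

section FirstExpression

open Finset

variable {K : Type*} [Field K] [CharZero K] (ψ y : PowerSeries (PowerSeries K))

omit [CharZero K] in
theorem coeff_zero_seriesT {n : ℕ} (J : Finset (Fin n)) (m : Fin n → ℤ) :
    PowerSeries.coeff 0 (seriesT ψ y J m) = 0 := by
  rw [seriesT, PowerSeries.coeff_mk]
  simp

/-- The evaluations of the products of currents are the products of the first expression and of
the correlators of currents. -/
theorem evalHom_currentSeries {n : ℕ} (m : Fin n → ℤ) (I : Finset (Fin n)) :
    evalHom K (evalWeight K) (currentSeries ψ y m (I.sort (· ≤ ·))) =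
      conv (expSet K fun J => seriesT ψ y J m)
        (fun J => PowerSeries.C (MvPowerSeries.coeff 0
          (currentSeries ψ y m (J.sort (· ≤ ·))))) I := by
  have h1 := (isExp_currentSeries ψ y m).map (evalHom K (evalWeight K))
  have h2 := (isExp_currentSeries ψ y m).map ((PowerSeries.C (R := Scal K)).comp
    (MvPowerSeries.constantCoeff (σ := ℕ) (R := Scal K)))
  have h3 := (isExp_expSet (K := K) fun J => coeff_zero_seriesT ψ y J m).conv h2
  have h4 : (fun J : Finset (Fin n) =>
      evalHom K (evalWeight K) (connSeries ψ y m (J.sort (· ≤ ·)))) = fun J =>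
        seriesT ψ y J m + ((PowerSeries.C (R := Scal K)).comp
          (MvPowerSeries.constantCoeff (σ := ℕ) (R := Scal K)))
            (connSeries ψ y m (J.sort (· ≤ ·))) := funext fun J => seriesT_eq ψ y J m
  rw [h4] at h1
  -- both sides are exponentials of the same set function and agree at the empty set
  refine congrFun (h1.unique h3 ?_) I
  have h5 := seriesT_eq ψ y ∅ m
  simp only [Finset.sort_empty, connSeries, coeff_zero_logScal, map_zero, add_zero] at h5
  rw [conv_empty, expSet_empty, ← h5]
  simp only [Finset.sort_empty, currentSeries]
  rw [RingHom.comp_apply, ← MvPowerSeries.coeff_zero_eq_constantCoeff_apply,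
    constantCoeff_partitionScal, map_one, mul_one]
  exact evalHom_eq_fexp _ (constantCoeff_partitionScal ψ y) (coeff_zero_logScal ψ y)
    fun a _ => annihil_partitionScal ψ y a

/-- The prefactor `𝒮(uħD_1) / (ħ 𝒮(uħ))` at `X_1 ^ N`. -/
def prefactor (K : Type*) [Field K] (N : ℕ) : Scal K :=
  sAt (N : K) * PowerSeries.C (hbar K)⁻¹ * (sAt (1 : K))⁻¹

omit [CharZero K] in
/-- The sum over ordered partitions in the first expression is a squarefree coefficient of an
exponential without its constant term, which does not contribute in positive degree. -/
theorem calT_eq (n : ℕ) {m₁ : ℤ} (hm : 0 < m₁) (m : Fin n → ℤ) : calT ψ y n m₁ m =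
    prefactor K m₁.toNat * PowerSeries.coeff m₁.toNat
      (expSet K (fun J => seriesT ψ y J m) univ) := by
  obtain ⟨N, rfl⟩ := Int.eq_ofNat_of_zero_le hm.le
  rw [calT, if_pos hm, Int.toNat_natCast, Int.cast_natCast, prefactor]
  congr 1
  have hN : 0 < N := by exact_mod_cast hm
  rw [expSet, PowerSeries.coeff_mk, expTrunc, sum_range_succ', map_add, map_add, map_sum, map_sum]
  have h0 : PowerSeries.coeff N (MvPowerSeries.coeff (ind (univ : Finset (Fin n)))
      (algebraMap K (MvPowerSeries (Fin n) (PowerSeries (Scal K)))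
        (((0 : ℕ).factorial : K)⁻¹) * hat (fun J => seriesT ψ y J m) ^ 0)) = 0 := by
    rw [coeff_ind_algebraMap_mul, pow_zero, MvPowerSeries.coeff_one]
    split_ifs
    · rw [PowerSeries.coeff_one, if_neg hN.ne', mul_zero]
    · rw [map_zero, mul_zero]
  rw [h0, add_zero, ← Finset.Ico_add_one_right_eq_Icc, Finset.sum_Ico_eq_sum_range]
  refine sum_congr (by simp) fun l _ => ?_
  rw [coeff_ind_algebraMap_mul, Algebra.smul_def, add_comm 1 l]
  refine congrArg (algebraMap K (Scal K) _ * ·) ?_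
  have h1 : hat (fun J => seriesT ψ y J m) ^ (l + 1) =
      ∏ _i : Fin (l + 1), hat (fun J => seriesT ψ y J m) := by
    rw [prod_const, card_univ, Fintype.card_fin]
  rw [h1, coeff_ind_univ_prod, map_sum]
  simp only [coeff_ind_hat]

end FirstExpression

/-! ### Connected correlators -/

section Connected

open Finset

theorem conv_right_cancel {ι B : Type*} [DecidableEq ι] [CommRing B] {a b c : Finset ι → B}
    (hc : c ∅ = 1)
    (h : ∀ I, ∑ A ∈ I.powerset, a A * c (I \ A) = ∑ A ∈ I.powerset, b A * c (I \ A)) : a = b := by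
  funext I
  induction I using Finset.strongInduction with
  | _ I ih =>
  have h1 := h I
  rw [← insert_erase (mem_powerset_self I), sum_insert (notMem_erase _ _),
    sum_insert (notMem_erase _ _), sdiff_self, bot_eq_empty, hc, mul_one, mul_one] at h1
  rw [sum_congr rfl fun A hA => by rw [ih A
    (ssubset_of_subset_of_ne (mem_powerset.1 (mem_of_mem_erase hA)) (ne_of_mem_erase hA))]] at h1
  exact add_right_cancel h1

variable {K B : Type*} [Field K] [CharZero K] [CommRing B] [Algebra K B]

/-- The connected part of a set function `c` with `c(∅) = 1`: the squarefree coefficients of the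
logarithm of its generating function. -/
def connPart (K : Type*) [Field K] [Algebra K B] {ι : Type*} [DecidableEq ι]
    (c : Finset ι → B) (I : Finset ι) : B :=
  MvPowerSeries.coeff (ind I) (logSeries K (hat fun A => if A = ∅ then 0 else c A))

/-- Differentiation of the logarithm of the generating function: the values of `c` on sets
containing the first element are determined by its connected part. -/
theorem sum_connPart_mul {n : ℕ} {c : Finset (Fin (n + 1)) → B} (hc : c ∅ = 1)
    (I : Finset (Fin n)) :
    ∑ A ∈ I.powerset, connPart K c (insert 0 (A.map (Fin.succEmb n))) *
      c ((I \ A).map (Fin.succEmb n)) = c (insert 0 (I.map (Fin.succEmb n))) := by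
  set z : MvPowerSeries (Fin (n + 1)) B := hat fun A => if A = ∅ then 0 else c A with hz
  -- coefficients of `∂/∂ε_0` at sets without the first element are coefficients of the series at
  -- the sets enlarged by it, so the logarithmic derivative of `1 + z` is the claimed identity
  have h0 : ∀ A : Finset (Fin n), (0 : Fin (n + 1)) ∉ A.map (Fin.succEmb n) := fun A h => by
    obtain ⟨j, -, hj⟩ := mem_map.1 h
    exact Fin.succ_ne_zero j hj
  have hz0 : MvPowerSeries.coeff 0 z = 0 := by
    rw [← ind_empty, hz, coeff_ind_hat, if_pos rfl]
  have h1z : ∀ A, MvPowerSeries.coeff (ind A) (1 + z) = c A := fun A => by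
    have : ind A = 0 ↔ A = ∅ :=
      ⟨fun h => by rw [← support_ind A, h, Finsupp.support_zero], fun h => h ▸ ind_empty⟩
    rw [map_add, MvPowerSeries.coeff_one, hz, coeff_ind_hat]
    by_cases hA : A = ∅
    · rw [if_pos (this.2 hA), if_pos hA, add_zero, hA, hc]
    · rw [if_neg (mt this.1 hA), if_neg hA, zero_add]
  have h2 := congrArg (MvPowerSeries.coeff (ind (I.map (Fin.succEmb n))))
    (pderiv_logSeries (K := K) hz0 0)
  rw [mul_comm, coeff_ind_pderiv _ (h0 I), hz, coeff_ind_hat, if_neg (insert_ne_empty _ _), ← hz,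
    coeff_ind_mul] at h2
  rw [← h2]
  refine sum_bij (fun A _ => A.map (Fin.succEmb n)) (fun A hA => ?_) (fun A _ A' _ h => ?_)
    (fun C hC => ?_) fun A hA => ?_
  · exact mem_powerset.2 (map_subset_map.2 (mem_powerset.1 hA))
  · exact map_injective _ h
  · obtain ⟨A, hA, rfl⟩ := subset_map_iff.1 (mem_powerset.1 hC)
    exact ⟨A, mem_powerset.2 hA, rfl⟩
  · rw [coeff_ind_pderiv _ (h0 A), h1z, ← Finset.map_sdiff, connPart]

/-- Inclusion-exclusion over ordered partitions into non-empty sets computes the connected part. -/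
theorem connPart_univ {n : ℕ} (c : Finset (Fin (n + 1)) → B) :
    connPart K c univ = ∑ l ∈ Icc 1 (n + 1), ((l.factorial : K)⁻¹) •
      ∑ f : {f : Fin (n + 1) → Fin l // Function.Surjective f},
        ((-1 : K) ^ (l - 1) * ((l - 1).factorial : K)) •
          ∏ i : Fin l, c (univ.filter fun j => f.1 j = i) := by
  have hdeg : (ind (univ : Finset (Fin (n + 1)))).degree = n + 1 := by
    rw [Finsupp.degree_eq_sum]
    simp [ind_apply]
  change MvPowerSeries.coeff (ind univ) (logTrunc K (ind univ).degree _) = _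
  rw [hdeg, logTrunc, map_sum]
  refine sum_congr rfl fun l hl => ?_
  obtain ⟨l, rfl⟩ : ∃ k, l = k + 1 := ⟨l - 1, by have := mem_Icc.1 hl; omega⟩
  have f1 : (l.factorial : K) ≠ 0 := Nat.cast_ne_zero.2 (Nat.factorial_ne_zero _)
  have f2 : ((l + 1 : ℕ) : K) ≠ 0 := Nat.cast_ne_zero.2 (Nat.succ_ne_zero _)
  have h1 : (hat fun A => if A = ∅ then 0 else c A) ^ (l + 1) =
      ∏ _i : Fin (l + 1), hat fun A => if A = ∅ then 0 else c A := by
    rw [prod_const, card_univ, Fintype.card_fin]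
  rw [coeff_algebraMap_mul, h1, coeff_ind_univ_prod, ← smul_sum, smul_smul, Algebra.smul_def,
    Nat.add_sub_cancel, Nat.factorial_succ, Nat.cast_mul]
  have e1 : (-1 : K) ^ (l + 1 + 1) / ((l + 1 : ℕ) : K) =
      (((l + 1 : ℕ) : K) * (l.factorial : K))⁻¹ * ((-1) ^ l * (l.factorial : K)) := by
    field_simp
    ring
  -- maps that are not surjective have an empty fibre, at which the generating function vanishes
  have e2 : ∀ g : Fin (n + 1) → Fin (l + 1), ∏ i, MvPowerSeries.coeff
      (ind (univ.filter fun j => g j = i)) (hat fun A => if A = ∅ then 0 else c A) =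
      if Function.Surjective g then ∏ i, c (univ.filter fun j => g j = i) else 0 := by
    intro g
    simp only [coeff_ind_hat]
    split_ifs with hg
    · refine prod_congr rfl fun i _ => if_neg ?_
      obtain ⟨j, hj⟩ := hg i
      exact nonempty_iff_ne_empty.1 ⟨j, mem_filter.2 ⟨mem_univ _, hj⟩⟩
    · obtain ⟨i, hi⟩ := not_forall.1 hg
      refine prod_eq_zero (mem_univ i) (if_pos ?_)
      exact filter_eq_empty_iff.2 fun j _ hj => hi ⟨j, hj⟩
  rw [e1, sum_congr rfl fun g _ => e2 g, ← sum_filter,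
    sum_subtype (p := Function.Surjective) _ fun g => by simp]

end Connected

section Correlators

open Finset

variable {K : Type*} [Field K] [CharZero K] {ψ : PowerSeries (PowerSeries K)}
  (y : PowerSeries (PowerSeries K))
  {n : ℕ} (m₁ : ℤ) (m : Fin n → ℤ)

theorem sort_map_succ (I : Finset (Fin n)) :
    (I.map (Fin.succEmb n)).sort (· ≤ ·) = (I.sort (· ≤ ·)).map Fin.succ :=
  ((Fin.strictMono_succ.strictMonoOn _).map_finsetSort (f := Fin.succEmb n) (s := I)).symm

/-- Conjugation by `G` cancels between neighbouring operators. -/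
theorem Gop_foldr_opA (hψ : PowerSeries.constantCoeff ψ = 0) (l : List (Fin n))
    (f : Fock (Scal K)) :
    Gop ψ y ((((l.map Fin.succ).map (opA ψ y (Fin.cons m₁ m))).foldr
      (fun A B => A ∘ B) id) f) = l.foldr (fun i v => Jop (m i) v) (Gop ψ y f) := by
  induction l with
  | nil => rfl
  | cons i l ih =>
    rw [List.map_cons, List.map_cons, List.foldr_cons, List.foldr_cons, Function.comp_apply, ← ih,
      opA, if_neg (Fin.succ_ne_zero i), Fin.cons_succ, Function.comp_apply, Function.comp_apply,
      Gop_GopInv hψ]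

/-- The correlators of the currents `𝒜_k`, `k ≥ 2`, are constant terms of bosonic images. -/
theorem corr_map_succ (hψ : PowerSeries.constantCoeff ψ = 0) (I : Finset (Fin n)) :
    corr ψ y (Fin.cons m₁ m) (I.map (Fin.succEmb n)) =
      MvPowerSeries.coeff 0 (currentSeries ψ y m (I.sort (· ≤ ·))) := by
  rw [corr, sort_map_succ, vev, ← boson_foldr_Jop, constantCoeff_boson, ← Gop_foldr_opA y m₁ m hψ]
  cases I.sort (· ≤ ·) with
  | nil =>
    simp only [List.map_nil, List.foldr_nil, id_eq]
    rw [← constantCoeff_boson K (Gop ψ y (vacVec (Scal K))), boson_Gop_vac,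
      constantCoeff_partitionScal, vacVec, if_pos rfl]
  | cons i l =>
    simp only [List.map_cons, List.foldr_cons, Function.comp_apply]
    rw [opA, Function.comp_apply, GopInv_vac, Gop_GopInv hψ]

/-- In a correlator that contains `𝒜_1`, the covacuum absorbs the leftmost `G⁻¹`. -/
theorem corr_insert_zero (hψ : PowerSeries.constantCoeff ψ = 0) (I : Finset (Fin n)) :
    corr ψ y (Fin.cons m₁ m) (insert 0 (I.map (Fin.succEmb n))) =
      insertion K m₁ ((I.sort (· ≤ ·)).foldr (fun i v => Jop (m i) v)
        (Gop ψ y (vacVec (Scal K)))) Maya.vac := by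
  rw [corr, sort_insert_of_lt fun j hj => by
    obtain ⟨i, -, rfl⟩ := mem_map.1 hj
    exact Fin.succ_pos i, sort_map_succ, vev, List.map_cons, List.foldr_cons, Function.comp_apply,
    ← Gop_foldr_opA y m₁ m hψ, opA, Function.comp_apply, Function.comp_apply, GopInv_vac,
    if_pos rfl, Fin.cons_zero]

omit [CharZero K] in
theorem insertion_vac_of_nonpos (hm : m₁ ≤ 0) (v : Fock (Scal K)) :
    insertion K m₁ v Maya.vac = 0 := by
  rw [insertion]
  split_ifs with h
  · rfl
  · have : Jop m₁ (E0 K v) Maya.vac = 0 := by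
      rw [← neg_neg m₁]
      exact Jop_eq_zero_of_energy_lt (by omega) _ (by rw [Maya.energy_vac]; omega)
    rw [this, mul_zero, Algebra.smul_def, mul_zero]

theorem calW_eq_connPart : calW ψ y n m₁ m = connPart K (corr ψ y (Fin.cons m₁ m)) univ :=
  (connPart_univ _).symm

/-- The correlators satisfy the same relation with the first expression in place of the connected
correlators. -/
theorem corr_insert_zero_eq_sum (hψ : PowerSeries.constantCoeff ψ = 0) (hm : 0 < m₁)
    (I : Finset (Fin n)) :
    corr ψ y (Fin.cons m₁ m) (insert 0 (I.map (Fin.succEmb n))) = ∑ A ∈ I.powerset,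
      (prefactor K m₁.toNat * PowerSeries.coeff m₁.toNat
        (expSet K (fun J => seriesT ψ y J m) A)) *
        corr ψ y (Fin.cons m₁ m) ((I \ A).map (Fin.succEmb n)) := by
  obtain ⟨N, rfl⟩ := Int.eq_ofNat_of_zero_le hm.le
  have h1 := coeff_evalHom_boson (K := K) (evalWeight K) N ((I.sort (· ≤ ·)).foldr
    (fun i v => Jop (m i) v) (Gop ψ y (vacVec (Scal K))))
  rw [boson_foldr_Jop, evalHom_currentSeries, conv, map_sum] at h1
  rw [corr_insert_zero y _ m hψ, insertion_vac N (by exact_mod_cast hm)]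
  simp only [evalWeight] at h1
  rw [← h1, mul_sum, Int.toNat_natCast]
  refine sum_congr rfl fun A _ => ?_
  rw [corr_map_succ y _ m hψ, PowerSeries.coeff_mul_C, mul_assoc (prefactor K N), prefactor]

theorem calW_eq_calT (hψ : PowerSeries.constantCoeff ψ = 0) :
    calW ψ y n m₁ m = calT ψ y n m₁ m := by
  have hc : corr ψ y (Fin.cons m₁ m : Fin (n + 1) → ℤ) ∅ = 1 := by
    rw [corr, Finset.sort_empty, vev]
    exact if_pos rfl
  have hw := sum_connPart_mul (K := K) hc
  have huniv : insert 0 ((univ : Finset (Fin n)).map (Fin.succEmb n)) = univ := by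
    ext j
    refine ⟨fun _ => mem_univ _, fun _ => ?_⟩
    rcases Fin.eq_zero_or_eq_succ j with rfl | ⟨i, rfl⟩
    · exact mem_insert_self _ _
    · exact mem_insert_of_mem (mem_map_of_mem _ (mem_univ i))
  rw [calW_eq_connPart, ← huniv]
  have key : ∀ b : Finset (Fin n) → Scal K,
      (∀ I, corr ψ y (Fin.cons m₁ m) (insert 0 (I.map (Fin.succEmb n))) = ∑ A ∈ I.powerset,
        b A * corr ψ y (Fin.cons m₁ m) ((I \ A).map (Fin.succEmb n))) →
      connPart K (corr ψ y (Fin.cons m₁ m)) (insert 0 (univ.map (Fin.succEmb n))) = b univ :=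
    fun b hb => congrFun (conv_right_cancel
      (a := fun A => connPart K (corr ψ y (Fin.cons m₁ m)) (insert 0 (A.map (Fin.succEmb n))))
      (c := fun J => corr ψ y (Fin.cons m₁ m) (J.map (Fin.succEmb n))) hc
      fun I => (hw I).trans (hb I)) univ
  rcases lt_or_ge 0 m₁ with hm | hm
  · rw [calT_eq ψ y n hm]
    exact key (fun A => prefactor K m₁.toNat * PowerSeries.coeff m₁.toNat
      (expSet K (fun J => seriesT ψ y J m) A)) (corr_insert_zero_eq_sum y m₁ m hψ hm)
  · rw [calT, if_neg hm.not_gt]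
    refine key (fun _ => 0) fun I => ?_
    simp only [zero_mul, sum_const_zero]
    rw [corr_insert_zero y m₁ m hψ, insertion_vac_of_nonpos m₁ hm]

end Correlators

end

end HypKP

theorem mainTheorem4 {K : Type*} [Field K] [CharZero K]
    (ψ y : PowerSeries (PowerSeries K))
    (hψ : PowerSeries.constantCoeff ψ = 0) (hy : PowerSeries.constantCoeff y = 0) :
    (∀ n : ℕ, HypKP.calW ψ y n = HypKP.calT ψ y n) ∧
      ∀ r g n : ℕ, HypKP.calWrVEV ψ y r g n = HypKP.calWrFirst ψ y r g n := by
  have h : ∀ n : ℕ, HypKP.calW ψ y n = HypKP.calT ψ y n := fun n =>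
    funext fun m₁ => funext fun m => HypKP.calW_eq_calT y m₁ m hψ
  refine ⟨h, fun r g n => ?_⟩
  funext m₁ m
  rw [HypKP.calWrVEV, HypKP.calWrFirst, h]
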